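/- **Setting.** Functions on $\mathbb R/\mathbb Z$ are functions on $\mathbb R$ of period $1$. For $f\in L^2(\mathbb R/\mathbb Z,\mathbb C^n)$ let $\widehat f(k)=\int_0^1 f(x)e^{-2\pi i kx}\,dx$ and $$\|f\|_{H^1}=\Big(\sum_{k\in\mathbb Z}(1+k^2)\,|\widehat f(k)|^2\Big)^{1/2};$$ $H^1$ is the set of all $f\in L^2$ with $\|f\|_{H^1}<\infty$. Let $\gamma:\mathbb R/\mathbb Z\to\mathbb R^n$ be a $C^\infty$ closed curve that is simple (injective on $[0,1)$) and parametrized by arc-length ($|\dot\gamma|\equiv 1$), and let $\gamma$ be a critical point of the Möbius energy $$\mathcal E(\gamma)=\iint_{(\mathbb R/\mathbb Z)^2}\Big(\frac1{|\gamma(u)-\gamma(v)|^2}-\frac1{\mathcal D(\gamma(u),\gamma(v))^2}\Big)|\gamma'(u)||\gamma'(v)|\,du\,dv,$$ where $\mathcal D$ is the length of the shorter arc between the two points; that is, $\lim_{\tau\to0}\frac{\mathcal E(\gamma+\tau h)-\mathcal E(\gamma)}{\tau}=0$ for all $h\in C^\infty(\mathbb R/\mathbb Z,\mathbb R^n)$.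 Put $$Q\gamma(x)=\lim_{\varepsilon\downarrow0}2\int_{\varepsilon\le|w|\le\frac12}\Big(2\,\frac{\gamma(x+w)-\gamma(x)-w\dot\gamma(x)}{w^2}-\ddot\gamma(x)\Big)\frac{dw}{w^2},$$ $$R_1\gamma(x)=\lim_{\varepsilon\downarrow0}4\int_{\varepsilon\le|w|\le\frac12}\Big(\frac1{|\gamma(x+w)-\gamma(x)|^4}-\frac1{w^4}\Big)(\gamma(x+w)-\gamma(x)-w\dot\gamma(x))\,dw,$$ $$R_2\gamma(x)=\lim_{\varepsilon\downarrow0}(-2)\int_{\varepsilon\le|w|\le\frac12}\Big(\frac1{|\gamma(x+w)-\gamma(x)|^2}-\frac1{w^2}\Big)\ddot\gamma(x)\,dw,$$ and $P^T_\gamma V=\langle V,\dot\gamma\rangle\dot\gamma$, $P^\perp_{\dot\gamma}V=V-\langle V,\dot\gamma\rangle\dot\gamma$ for vector fields $V$ along $\gamma$. For $l,m\in\mathbb N$ let $p^{(m)}_l$ be the universal polynomial of Faà di Bruno's formula, for which $\partial^l (g\circ f)=p_l^{(m)}\big(\{(\partial^\alpha g)\circ f\}_{|\alpha|\le l},\{f_i^{(j)}\}_{1\le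 j\le l,1\le i\le m}\big)$ for $f:\mathbb R\to\mathbb R^m$, $g:\mathbb R^m\to\mathbb R$; explicitly $$p_l^{(m)}\big(\{A_\alpha\},\{b_{i,j}\}\big)=\sum_{q}\frac{l!}{\prod_{j=1}^l (j!)^{r_j}\prod_{j=1}^l\prod_{i=1}^m q_{ji}!}\,A_{\alpha(q)}\prod_{j=1}^l\prod_{i=1}^m b_{i,j}^{\,q_{ji}},$$ the sum running over all $q=(q_{ji})\in\mathbb N_0^{l\times m}$ with $r_1+2r_2+\dots+lr_l=l$, where $r_j=\sum_i q_{ji}$ and $\alpha(q)_i=\sum_j q_{ji}$. Finally let $f=(f_1,\dots,f_{4n})=(\dot\gamma,\ddot\gamma,\ddot\gamma,\ddot\gamma):\mathbb R/\mathbb Z\to\mathbb R^{4n}$. **Theorem.** The limits defining $Q\gamma(x)$, $R_1\gamma(x)$, $R_2\gamma(x)$ exist for all $x$, and $P^T_\gamma Q\gamma$, $P^\perp_{\dot\gamma}R_1\gamma$, $P^\perp_{\dot\gamma}R_2\gamma$ are of class $C^\infty$. There are constants $C_1>0$ such that $\|uv\|_{H^1}\le C_1\|u\|_{H^1}\|v\|_{H^1}$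 for all $u,v\in H^1(\mathbb R/\mathbb Z,\mathbb R)$ (the product being in $H^1$), and for each such $C_1$ there are positive constants $C_Q,C_{R_1},C_{R_2},r,s<\infty$, independent of $l$, such that for every integer $l\ge1$ the functions $\partial^lP^T_\gamma Q\gamma$, $\partial^lP^\perp_{\dot\gamma}R_1\gamma$, $\partial^lP^\perp_{\dot\gamma}R_2\gamma$ lie in $H^1(\mathbb R/\mathbb Z,\mathbb R^n)$ and $$\|\partial^l P^T_\gamma Q\gamma\|_{H^1}\le C_Q\sum_{k_1=0}^l\sum_{k_2=0}^{k_1}\binom l{k_1}\binom{k_1}{k_2}\|\partial^{l-k_1+2}\gamma\|_{H^1}\|\partial^{k_1-k_2+2}\gamma\|_{H^1}\|\partial^{k_2+1}\gamma\|_{H^1},$$ $$\|\partial^l P^\perp_{\dot\gamma}R_1\gamma\|_{H^1}\le C_{R_1}\,p_l^{(4n)}\Big(\Big\{\frac{(|\alpha|+1)!}{r^{|\alpha|+1}}\Big\}_{|\alpha|\le l},\{C_1\|f_i^{(j)}\|_{H^1}\}_{1\le j\le l,\,1\le i\le4n}\Big),$$ $$\|\partial^l P^\perp_{\dot\gamma}R_2\gamma\|_{H^1}\le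 C_{R_2}\,p_l^{(4n)}\Big(\Big\{\frac{(|\alpha|+1)!}{s^{|\alpha|+1}}\Big\}_{|\alpha|\le l},\{C_1\|f_i^{(j)}\|_{H^1}\}_{1\le j\le l,\,1\le i\le4n}\Big).$$ -/

import Mathlib

open Filter Topology
open scoped ContDiff

noncomputable section

namespace MobiusEnergy

/-! ## Periodic functions and Sobolev spaces on the circle

Functions on `ℝ / ℤ` are functions on `ℝ` of period `1`. -/

/-- The `H ^ s` norm `(∑ k, (1 + k ^ 2) ^ s * ‖f̂ k‖ ^ 2) ^ (1 / 2)` of a function on `ℝ / ℤ`,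
where `f̂ k = ∫ x in 0..1, exp (-2 π i k x) • f x`. -/
def sobolevNorm {E : Type*} [NormedAddCommGroup E] [NormedSpace ℂ E] (s : ℝ) (f : ℝ → E) : ℝ :=
  Real.sqrt (∑' k : ℤ, (1 + (k : ℝ) ^ 2) ^ s * ‖fourierCoeffOn zero_lt_one f k‖ ^ 2)

/-- Membership in `H ^ s (ℝ / ℤ)`: a square integrable function of finite `H ^ s` norm. -/
structure MemSobolev {E : Type*} [NormedAddCommGroup E] [NormedSpace ℂ E] (s : ℝ) (f : ℝ → E) :
    Prop where
  periodic : Function.Periodic f 1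
  memLp : MeasureTheory.MemLp f 2 (MeasureTheory.volume.restrict (Set.Ioc (0 : ℝ) 1))
  summable : Summable fun k : ℤ =>
    (1 + (k : ℝ) ^ 2) ^ s * ‖fourierCoeffOn zero_lt_one f k‖ ^ 2

/-- The inclusion of `ℝ ^ n` into `ℂ ^ n`. -/
def complexify {n : ℕ} (v : EuclideanSpace ℝ (Fin n)) : EuclideanSpace ℂ (Fin n) :=
  WithLp.toLp 2 fun i => (v i : ℂ)

/-- The `H¹` norm of an `ℝ ^ n`-valued function on `ℝ / ℤ`. -/
def normH1 {n : ℕ} (f : ℝ → EuclideanSpace ℝ (Fin n)) : ℝ :=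
  sobolevNorm 1 fun x => complexify (f x)

/-- Membership in `H¹ (ℝ / ℤ, ℝ ^ n)`. -/
def MemH1 {n : ℕ} (f : ℝ → EuclideanSpace ℝ (Fin n)) : Prop :=
  MemSobolev 1 fun x => complexify (f x)

/-- The `H¹` norm of a real-valued function on `ℝ / ℤ`. -/
def scalarNormH1 (f : ℝ → ℝ) : ℝ :=
  sobolevNorm 1 fun x => (f x : ℂ)

/-- Membership in `H¹ (ℝ / ℤ, ℝ)`. -/
def ScalarMemH1 (f : ℝ → ℝ) : Prop :=
  MemSobolev 1 fun x => (f x : ℂ)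

/-- `C` is a positive constant in the Banach algebra inequality
`‖f g‖ ≤ C ‖f‖ ‖g‖` of `H¹ (ℝ / ℤ, ℝ)`. -/
def IsAlgebraConstantH1 (C : ℝ) : Prop :=
  0 < C ∧ ∀ f g : ℝ → ℝ, ScalarMemH1 f → ScalarMemH1 g →
    ScalarMemH1 (fun x => f x * g x) ∧
      scalarNormH1 (fun x => f x * g x) ≤ C * scalarNormH1 f * scalarNormH1 g

/-! ## Curves, the Möbius energy and its critical points -/

/-- A smooth, closed, simple curve `ℝ / ℤ → ℝ ^ n` parametrized by arc-length. -/
structure IsSmoothArclengthKnot {n : ℕ} (γ : ℝ → EuclideanSpace ℝ (Fin n)) : Prop where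
  periodic : Function.Periodic γ 1
  smooth : ContDiff ℝ ∞ γ
  injOn : Set.InjOn γ (Set.Ico 0 1)
  arclength : ∀ x, ‖deriv γ x‖ = 1

/-- The distance of `γ u` and `γ v` along the closed curve `γ`, for `u, v ∈ [0, 1]`: the length of
the shorter one of the two arcs. -/
def intrinsicDist {n : ℕ} (γ : ℝ → EuclideanSpace ℝ (Fin n)) (u v : ℝ) : ℝ :=
  min |∫ t in u..v, ‖deriv γ t‖| ((∫ t in (0 : ℝ)..1, ‖deriv γ t‖) - |∫ t in u..v, ‖deriv γ t‖|)

/-- The Möbius energy of a closed curve. -/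
def energy {n : ℕ} (γ : ℝ → EuclideanSpace ℝ (Fin n)) : ℝ :=
  ∫ p in Set.Ioc (0 : ℝ) 1 ×ˢ Set.Ioc (0 : ℝ) 1,
    (1 / ‖γ p.1 - γ p.2‖ ^ 2 - 1 / intrinsicDist γ p.1 p.2 ^ 2) * ‖deriv γ p.1‖ * ‖deriv γ p.2‖

/-- The first variation of the Möbius energy at `γ` exists and vanishes in the direction of every
smooth `h : ℝ / ℤ → ℝ ^ n`. -/
def IsCriticalPoint {n : ℕ} (γ : ℝ → EuclideanSpace ℝ (Fin n)) : Prop :=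
  ∀ h : ℝ → EuclideanSpace ℝ (Fin n), Function.Periodic h 1 → ContDiff ℝ ∞ h →
    Tendsto (fun τ : ℝ => (energy (fun x => γ x + τ • h x) - energy γ) / τ) (𝓝[≠] 0) (𝓝 0)

/-! ## The parts of the gradient -/

/-- The domain `ε ≤ |w| ≤ 1 / 2` of the truncated integrals. -/
def truncated (ε : ℝ) : Set ℝ := {w | |w| ∈ Set.Icc ε (1 / 2)}

/-- The truncated main term. -/
def Qtrunc {n : ℕ} (γ : ℝ → EuclideanSpace ℝ (Fin n)) (ε x : ℝ) : EuclideanSpace ℝ (Fin n) :=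
  (2 : ℝ) • ∫ w in truncated ε,
    (1 / w ^ 2) • ((2 / w ^ 2) • (γ (x + w) - γ x - w • deriv γ x) - iteratedDeriv 2 γ x)

/-- The truncated first remainder. -/
def R₁trunc {n : ℕ} (γ : ℝ → EuclideanSpace ℝ (Fin n)) (ε x : ℝ) : EuclideanSpace ℝ (Fin n) :=
  (4 : ℝ) • ∫ w in truncated ε,
    (1 / ‖γ (x + w) - γ x‖ ^ 4 - 1 / w ^ 4) • (γ (x + w) - γ x - w • deriv γ x)

/-- The truncated second remainder. -/
def R₂trunc {n : ℕ} (γ : ℝ → EuclideanSpace ℝ (Fin n)) (ε x : ℝ) : EuclideanSpace ℝ (Fin n) :=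
  (-2 : ℝ) • ∫ w in truncated ε,
    (1 / ‖γ (x + w) - γ x‖ ^ 2 - 1 / w ^ 2) • iteratedDeriv 2 γ x

/-- The main term, the pointwise limit of `Qtrunc γ ε` as `ε ↓ 0`. -/
def Q {n : ℕ} (γ : ℝ → EuclideanSpace ℝ (Fin n)) (x : ℝ) : EuclideanSpace ℝ (Fin n) :=
  limUnder (𝓝[>] (0 : ℝ)) fun ε => Qtrunc γ ε x

/-- The first remainder, the pointwise limit of `R₁trunc γ ε` as `ε ↓ 0`. -/
def R₁ {n : ℕ} (γ : ℝ → EuclideanSpace ℝ (Fin n)) (x : ℝ) : EuclideanSpace ℝ (Fin n) :=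
  limUnder (𝓝[>] (0 : ℝ)) fun ε => R₁trunc γ ε x

/-- The second remainder, the pointwise limit of `R₂trunc γ ε` as `ε ↓ 0`. -/
def R₂ {n : ℕ} (γ : ℝ → EuclideanSpace ℝ (Fin n)) (x : ℝ) : EuclideanSpace ℝ (Fin n) :=
  limUnder (𝓝[>] (0 : ℝ)) fun ε => R₂trunc γ ε x

/-- The part of the vector field `V` tangential to the arc-length parametrized curve `γ`. -/
def tangentialPart {n : ℕ} (γ V : ℝ → EuclideanSpace ℝ (Fin n)) (x : ℝ) :
    EuclideanSpace ℝ (Fin n) :=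
  inner ℝ (V x) (deriv γ x) • deriv γ x

/-- The part of the vector field `V` normal to the arc-length parametrized curve `γ`. -/
def normalPart {n : ℕ} (γ V : ℝ → EuclideanSpace ℝ (Fin n)) (x : ℝ) :
    EuclideanSpace ℝ (Fin n) :=
  V x - inner ℝ (V x) (deriv γ x) • deriv γ x

/-! ## The universal polynomials of Faà di Bruno's formula -/

/-- The index set of the multivariate Faà di Bruno formula of order `k` for maps into `ℝ ^ ι`:
families `q` of non-negative integers, where `q i j` is the `q_{i+1, j}` of the usual notation, with
`r_1 + 2 r_2 + ⋯ + k r_k = k` for the row sums `r_{i+1} = ∑ j, q i j`. The bound `q i j ≤ k` is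
implied by this equation. -/
def faaDiBrunoIndex (k : ℕ) (ι : Type) [Fintype ι] [DecidableEq ι] : Finset (Fin k → ι → ℕ) :=
  (Fintype.piFinset fun _ : Fin k => Fintype.piFinset fun _ : ι => Finset.range (k + 1)).filter
    fun q => ∑ i : Fin k, ((i : ℕ) + 1) * ∑ j, q i j = k

/-- The universal polynomial `p_k` in the variables `∂ ^ α g` (`α` a multi-index) and `f_j ^ (i)`
(`1 ≤ i ≤ k`, the index `i` being shifted by one) that expresses the `k`-th derivative of `g ∘ f`
for `f : ℝ → ℝ ^ ι` and `g : ℝ ^ ι → ℝ`. Only multi-indices of order at most `k` occur. -/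
def faaDiBrunoPoly (k : ℕ) (ι : Type) [Fintype ι] [DecidableEq ι] :
    MvPolynomial ((ι → ℕ) ⊕ (Fin k × ι)) ℝ :=
  ∑ q ∈ faaDiBrunoIndex k ι,
    MvPolynomial.C ((k.factorial : ℝ) /
        ((∏ i : Fin k, (((i : ℕ) + 1).factorial : ℝ) ^ (∑ j, q i j)) *
          ∏ i : Fin k, ∏ j, ((q i j).factorial : ℝ))) *
      MvPolynomial.X (Sum.inl fun j => ∑ i : Fin k, q i j) *
      ∏ i : Fin k, ∏ j, MvPolynomial.X (Sum.inr (i, j)) ^ q i j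

/-- The components of `f = (γ', γ'', γ'', γ'') : ℝ → ℝ ^ (4 n)`, with index set
`Fin 4 × Fin n` for the `4 n` coordinates. -/
def blockCurve {n : ℕ} (γ : ℝ → EuclideanSpace ℝ (Fin n)) (c : Fin 4 × Fin n) (x : ℝ) : ℝ :=
  if c.1 = 0 then deriv γ x c.2 else iteratedDeriv 2 γ x c.2

/-- The number `p_l ({(|α| + 1)! / r ^ (|α| + 1)}, {C₁ ‖f_c ^ (j)‖})` for
`f = (γ', γ'', γ'', γ'')`, with `H¹` norms. -/
def faaDiBrunoBound {n : ℕ} (γ : ℝ → EuclideanSpace ℝ (Fin n)) (C₁ r : ℝ) (l : ℕ) : ℝ :=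
  MvPolynomial.eval
    (Sum.elim
      (fun α : Fin 4 × Fin n → ℕ =>
        (((∑ c, α c) + 1).factorial : ℝ) / r ^ ((∑ c, α c) + 1))
      (fun jc : Fin l × (Fin 4 × Fin n) =>
        C₁ * scalarNormH1 (iteratedDeriv ((jc.1 : ℕ) + 1) (blockCurve γ jc.2))))
    (faaDiBrunoPoly l (Fin 4 × Fin n))

end MobiusEnergy

end

open MobiusEnergy

noncomputable section

namespace MobiusEnergy

open MeasureTheory Set

/-! ### Smooth dependence of integrals on parameters -/

section ParametricIntegral

variable {H G : Type} [NormedAddCommGroup H] [NormedSpace ℝ H] [ProperSpace H]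
  [NormedAddCommGroup G] [NormedSpace ℝ G]

/-! The remainders and the main term obey their estimates for different reasons.

Remainders. Let Φ be the exponential generating series whose coefficient of order m ≥ 1 is Σ_c
‖f_c^(m)‖ / m!, with H¹ norms (`blockSeries`). When the variables A_α depend only on |α|, the
polynomial p_l is l! times the l-th coefficient of Σ_k (A_k / k!) Φ^k (`eval_faaDiBrunoPoly`). A
bound by l! times the l-th coefficient of 1 / (1 - cΦ) therefore suffices: it corresponds to A_k =
k! c^k, which the weights (k + 1)! / r^(k + 1) dominate for r = C₁ / c, up to a factor that does not
depend on l (`factorial_mul_coeff_geometricSeries_le`). Smooth functions U (x, w), periodic in x,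
whose x-derivatives are bounded by some C / (1 - cΦ) uniformly for |w| ≤ 1/2 form the class
`GoodFamily`. It is stable under sums, products, averages in w and reciprocals. Products work
because 1 / (1 - y)² is dominated by 1 / (1 - 2y), reciprocals because the recursion obtained from u
v = 1 can be absorbed by enlarging c (`H1Bound.iteratedDeriv_inv`). Translates of γ' and γ'' belong
to the class, hence so do the difference quotients of γ, which are averages of them. Arc length
gives |γ (x + w) - γ x|² = w² (1 - w² D) with D in the class (`chordQuotientSq_eq`), and the factor
w² D cancels the singularities of both kernels. Thus R₁γ and R₂γ are integrals over w of good
families. The H¹ norm is replaced throughout by the equivalent pair of sup norm of u and L² norm of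
u' (`H1Bound`), which averages do not increase.

Main term. Since |γ'| = 1 and ⟨γ', γ''⟩ = 0, the component of the symmetrized integrand along γ' is
-(A (x, w) - A (x, -w)) / w, where A is an s²-weighted average of |(γ' (x + sw) - γ' x) / (sw)|² and
hence quadratic in γ''. Bounding this difference quotient by a derivative would cost one order too
much. In Fourier space the odd kernel becomes ∫ sin (y w) / w dw, which is bounded uniformly in the
frequency y (`abs_integral_sin_div_le`). So the k-th coefficient of ⟨Qγ, γ'⟩ is dominated by a
self-convolution of the coefficients of γ'' (`norm_fourierCoeffUnit_tangential_le`). A weighted ℓ²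
convolution inequality and |k|^l ≤ (|a| + |k - a|)^l turn this into a Leibniz estimate, and one more
product with γ' produces the triple sum. -/

theorem hasFDerivAt_intervalIntegral_of_contDiff {f : H × ℝ → G} (hf : ContDiff ℝ 1 f) (a b : ℝ)
    (p : H) :
    HasFDerivAt (fun p => ∫ s in a..b, f (p, s))
      (∫ s in a..b, (fderiv ℝ f (p, s)).comp (ContinuousLinearMap.inl ℝ H ℝ)) p := by
  have hc : Continuous fun q : H × ℝ =>
      (fderiv ℝ f q).comp (ContinuousLinearMap.inl ℝ H ℝ) :=
    (hf.continuous_fderiv one_ne_zero).clm_comp continuous_const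
  have hcomp : IsCompact (Metric.closedBall p 1 ×ˢ uIcc a b) :=
    (isCompact_closedBall p 1).prod isCompact_uIcc
  obtain ⟨M, hM⟩ := hcomp.exists_bound_of_continuousOn hc.continuousOn
  refine intervalIntegral.hasFDerivAt_integral_of_dominated_of_fderiv_le
    (F' := fun p s => (fderiv ℝ f (p, s)).comp (ContinuousLinearMap.inl ℝ H ℝ))
    (bound := fun _ => M) (Metric.closedBall_mem_nhds p one_pos) ?_ ?_ ?_ ?_ ?_ ?_
  · exact Eventually.of_forall fun q => (hf.continuous.comp
      (by fun_prop : Continuous fun s : ℝ => (q, s))).aestronglyMeasurable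
  · exact (hf.continuous.comp (by fun_prop : Continuous fun s : ℝ => (p, s))).intervalIntegrable _ _
  · exact (hc.comp (by fun_prop : Continuous fun s : ℝ => (p, s))).aestronglyMeasurable
  · exact Eventually.of_forall fun s hs q hq => hM (q, s) ⟨hq, uIoc_subset_uIcc hs⟩
  · exact intervalIntegrable_const
  · refine Eventually.of_forall fun s _ q _ => ?_
    exact (hf.differentiable one_ne_zero (q, s)).hasFDerivAt.comp q (hasFDerivAt_prodMk_left q s)

/-- Differentiation under the integral sign replaces the integrand by its partial derivative, which
takes values in a space of linear maps. The target space must therefore vary during the induction.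
-/
theorem contDiff_intervalIntegral_nat {H : Type} [NormedAddCommGroup H] [NormedSpace ℝ H]
    [ProperSpace H] (n : ℕ) : ∀ {G : Type} [NormedAddCommGroup G] [NormedSpace ℝ G]
      [CompleteSpace G] {f : H × ℝ → G}, ContDiff ℝ n f → ∀ a b : ℝ,
        ContDiff ℝ n (fun p => ∫ s in a..b, f (p, s)) := by
  induction n with
  | zero =>
    intro G _ _ _ f hf a b
    simp only [Nat.cast_zero, contDiff_zero] at hf ⊢
    exact intervalIntegral.continuous_parametric_intervalIntegral_of_continuous'
      (f := fun p s => f (p, s)) hf a b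
  | succ n ih =>
    intro G _ _ _ f hf a b
    have h1 : ContDiff ℝ 1 f := hf.of_le (by exact_mod_cast Nat.le_add_left 1 n)
    have hd := hasFDerivAt_intervalIntegral_of_contDiff h1 a b
    rw [show ((n + 1 : ℕ) : ℕ∞ω) = (n : ℕ∞ω) + 1 by norm_cast,
      contDiff_succ_iff_fderiv] at hf ⊢
    refine ⟨fun p => (hd p).differentiableAt, by simp, ?_⟩
    rw [show fderiv ℝ (fun p => ∫ s in a..b, f (p, s)) = fun p =>
      ∫ s in a..b, (fderiv ℝ f (p, s)).comp (ContinuousLinearMap.inl ℝ H ℝ) from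
        funext fun p => (hd p).fderiv]
    exact ih (f := fun q => (fderiv ℝ f q).comp (ContinuousLinearMap.inl ℝ H ℝ))
      (hf.2.2.clm_comp contDiff_const) a b

theorem contDiff_intervalIntegral [CompleteSpace G] {f : H × ℝ → G} (hf : ContDiff ℝ ∞ f) (a b : ℝ) :
    ContDiff ℝ ∞ (fun p => ∫ s in a..b, f (p, s)) :=
  contDiff_infty.2 fun n => contDiff_intervalIntegral_nat n (contDiff_infty.1 hf n) a b

end ParametricIntegral

/-! ## Smooth families of functions -/

/-- The partial derivative in the first variable. -/
def partialFst (U : ℝ × ℝ → ℝ) (p : ℝ × ℝ) : ℝ :=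
  fderiv ℝ U p (1, 0)

/-- The partial derivative in the second variable. -/
def partialSnd (U : ℝ × ℝ → ℝ) (p : ℝ × ℝ) : ℝ :=
  fderiv ℝ U p (0, 1)

theorem contDiff_partialFst {U : ℝ × ℝ → ℝ} (hU : ContDiff ℝ ∞ U) :
    ContDiff ℝ ∞ (partialFst U) :=
  ((contDiff_infty_iff_fderiv.1 hU).2).clm_apply contDiff_const

theorem contDiff_partialSnd {U : ℝ × ℝ → ℝ} (hU : ContDiff ℝ ∞ U) :
    ContDiff ℝ ∞ (partialSnd U) :=
  ((contDiff_infty_iff_fderiv.1 hU).2).clm_apply contDiff_const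

theorem contDiff_iterate_partialFst {U : ℝ × ℝ → ℝ} (hU : ContDiff ℝ ∞ U) (l : ℕ) :
    ContDiff ℝ ∞ (partialFst^[l] U) := by
  induction l with
  | zero => exact hU
  | succ l ih => rw [Function.iterate_succ_apply']; exact contDiff_partialFst ih

theorem hasDerivAt_partialFst {U : ℝ × ℝ → ℝ} (hU : ContDiff ℝ ∞ U) (x w : ℝ) :
    HasDerivAt (fun x => U (x, w)) (partialFst U (x, w)) x := by
  have h := (hU.differentiable (by simp) (x, w)).hasFDerivAt
  exact h.comp_hasDerivAt x ((hasDerivAt_id x).prodMk (hasDerivAt_const x w))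

theorem hasDerivAt_partialSnd {U : ℝ × ℝ → ℝ} (hU : ContDiff ℝ ∞ U) (x w : ℝ) :
    HasDerivAt (fun w => U (x, w)) (partialSnd U (x, w)) w := by
  have h := (hU.differentiable (by simp) (x, w)).hasFDerivAt
  exact h.comp_hasDerivAt w ((hasDerivAt_const w x).prodMk (hasDerivAt_id w))

theorem iteratedDeriv_eq_iterate_partialFst {U : ℝ × ℝ → ℝ} (hU : ContDiff ℝ ∞ U) (l : ℕ) (w : ℝ) :
    iteratedDeriv l (fun x => U (x, w)) = fun x => (partialFst^[l] U) (x, w) := by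
  induction l with
  | zero => simp
  | succ l ih =>
    rw [iteratedDeriv_succ, ih, Function.iterate_succ_apply']
    exact funext fun x => (hasDerivAt_partialFst (contDiff_iterate_partialFst hU l) x w).deriv

/-- The average `∫ s in 0..1, k s * U (x, s * w)`. -/
def average (k : ℝ → ℝ) (U : ℝ × ℝ → ℝ) (p : ℝ × ℝ) : ℝ :=
  ∫ s in (0 : ℝ)..1, k s * U (p.1, s * p.2)

theorem contDiff_average_integrand {k : ℝ → ℝ} (hk : ContDiff ℝ ∞ k) {U : ℝ × ℝ → ℝ}
    (hU : ContDiff ℝ ∞ U) :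
    ContDiff ℝ ∞ fun q : (ℝ × ℝ) × ℝ => k q.2 * U (q.1.1, q.2 * q.1.2) :=
  (hk.comp contDiff_snd).mul (hU.comp (by fun_prop))

theorem contDiff_average {k : ℝ → ℝ} (hk : ContDiff ℝ ∞ k) {U : ℝ × ℝ → ℝ}
    (hU : ContDiff ℝ ∞ U) : ContDiff ℝ ∞ (average k U) :=
  contDiff_intervalIntegral (contDiff_average_integrand hk hU) 0 1

theorem partialFst_average {k : ℝ → ℝ} (hk : ContDiff ℝ ∞ k) {U : ℝ × ℝ → ℝ}
    (hU : ContDiff ℝ ∞ U) : partialFst (average k U) = average k (partialFst U) := by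
  funext p
  have hF := contDiff_average_integrand hk hU
  have h := hasFDerivAt_intervalIntegral_of_contDiff (hF.of_le (by exact_mod_cast le_top)) 0 1 p
  have h1 : partialFst (average k U) p = _ := congrArg (fun L => L (1, 0)) h.fderiv
  rw [h1, ContinuousLinearMap.intervalIntegral_apply]
  · refine intervalIntegral.integral_congr fun s _ => ?_
    have h2 := ((hF.differentiable (by simp) (p, s)).hasFDerivAt.comp p
      (hasFDerivAt_prodMk_left p s)).comp_hasDerivAt p.1
      ((hasDerivAt_id p.1).prodMk (hasDerivAt_const p.1 p.2))
    exact h2.unique ((hasDerivAt_partialFst hU p.1 (s * p.2)).const_mul (k s))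
  · refine Continuous.intervalIntegrable ?_ _ _
    exact ((hF.continuous_fderiv (by simp)).comp (by fun_prop :
      Continuous fun s : ℝ => (p, s))).clm_comp continuous_const

/-- Averaging acts on the second variable only, so bounds on x-derivatives pass from a family to its
averages. -/
theorem iterate_partialFst_average {k : ℝ → ℝ} (hk : ContDiff ℝ ∞ k) {U : ℝ × ℝ → ℝ}
    (hU : ContDiff ℝ ∞ U) (l : ℕ) :
    partialFst^[l] (average k U) = average k (partialFst^[l] U) := by
  induction l with
  | zero => rfl
  | succ l ih =>
    rw [Function.iterate_succ_apply', ih, Function.iterate_succ_apply',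
      partialFst_average hk (contDiff_iterate_partialFst hU l)]

/-- Hadamard's lemma. -/
theorem eq_add_mul_average_partialSnd {U : ℝ × ℝ → ℝ} (hU : ContDiff ℝ ∞ U) (x w : ℝ) :
    U (x, w) = U (x, 0) + w * average (fun _ => 1) (partialSnd U) (x, w) := by
  have h : ∀ s ∈ uIcc (0 : ℝ) 1,
      HasDerivAt (fun s => U (x, s * w)) (partialSnd U (x, s * w) * w) s := fun s _ =>
    HasDerivAt.comp (h₂ := fun w => U (x, w)) s (hasDerivAt_partialSnd hU x (s * w))
      (hasDerivAt_mul_const w)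
  have h2 := intervalIntegral.integral_eq_sub_of_hasDerivAt h (Continuous.intervalIntegrable
    (((contDiff_partialSnd hU).continuous.comp (by fun_prop)).mul continuous_const) _ _)
  rw [intervalIntegral.integral_mul_const] at h2
  simp only [one_mul, zero_mul] at h2
  simp only [average, one_mul]
  linarith

/-- An even function that vanishes for `w = 0` is divisible by `w ^ 2`. -/
theorem exists_eq_sq_mul {U : ℝ × ℝ → ℝ} (hU : ContDiff ℝ ∞ U) (h0 : ∀ x, U (x, 0) = 0)
    (heven : ∀ x w, U (x, -w) = U (x, w)) :
    ∃ V : ℝ × ℝ → ℝ, ContDiff ℝ ∞ V ∧ ∀ x w, U (x, w) = w ^ 2 * V (x, w) := by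
  have hV := contDiff_average (k := fun _ => 1) contDiff_const (contDiff_partialSnd hU)
  -- Evenness kills the first derivative at w = 0, so that Hadamard's lemma applies a second time,
  -- to the first quotient.
  have hd : ∀ x, partialSnd U (x, 0) = 0 := by
    intro x
    have h1 := hasDerivAt_partialSnd hU x 0
    have h2 : HasDerivAt (fun w => U (x, -w)) (partialSnd U (x, -0) * (-1)) 0 :=
      (hasDerivAt_partialSnd hU x (-0)).comp 0 (hasDerivAt_neg 0)
    simp only [heven, neg_zero] at h2
    have := h1.unique h2
    linarith
  refine ⟨average (fun _ => 1) (partialSnd (average (fun _ => 1) (partialSnd U))),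
    contDiff_average contDiff_const (contDiff_partialSnd hV), fun x w => ?_⟩
  have h1 := eq_add_mul_average_partialSnd hU x w
  have h2 := eq_add_mul_average_partialSnd hV x w
  have h3 : average (fun _ => 1) (partialSnd U) (x, 0) = 0 := by simp [average, hd]
  rw [h1, h2, h3, h0]
  ring

/-! ## An algebra bound equivalent to the `H¹` norm -/

/-- Both the supremum of `|u|` and the `L²` norm of `u'` over a period are at most `M`. -/
structure H1Bound (u : ℝ → ℝ) (M : ℝ) : Prop where
  abs_le : ∀ x, |u x| ≤ M
  energy_le : ∫ x in (0 : ℝ)..1, deriv u x ^ 2 ≤ M ^ 2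

theorem H1Bound.nonneg {u : ℝ → ℝ} {M : ℝ} (h : H1Bound u M) : 0 ≤ M :=
  (abs_nonneg _).trans (h.abs_le 0)

theorem H1Bound.mono {u : ℝ → ℝ} {M N : ℝ} (h : H1Bound u M) (hMN : M ≤ N) : H1Bound u N :=
  ⟨fun x => (h.abs_le x).trans hMN, h.energy_le.trans (pow_le_pow_left₀ h.nonneg hMN 2)⟩

/-- Minkowski's inequality in L², from the pointwise bound (p + q)² ≤ (a + b)/a · p² + (a + b)/b ·
q² with a = A + e and b = B + e. The shift e > 0, sent to 0 at the end, allows A or B to vanish. -/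
theorem integral_add_sq_le {p q : ℝ → ℝ} (hp : Continuous p) (hq : Continuous q) {A B : ℝ}
    (hA : 0 ≤ A) (hB : 0 ≤ B) (hpA : ∫ x in (0 : ℝ)..1, p x ^ 2 ≤ A ^ 2)
    (hqB : ∫ x in (0 : ℝ)..1, q x ^ 2 ≤ B ^ 2) :
    ∫ x in (0 : ℝ)..1, (p x + q x) ^ 2 ≤ (A + B) ^ 2 := by
  have key : ∀ e : ℝ, 0 < e →
      ∫ x in (0 : ℝ)..1, (p x + q x) ^ 2 ≤ (A + e + (B + e)) ^ 2 := by
    intro e he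
    have ha : 0 < A + e := by linarith
    have hb : 0 < B + e := by linarith
    have h1 : ∫ x in (0 : ℝ)..1, (p x + q x) ^ 2 ≤ ∫ x in (0 : ℝ)..1,
        ((A + e + (B + e)) / (A + e) * p x ^ 2 + (A + e + (B + e)) / (B + e) * q x ^ 2) := by
      refine intervalIntegral.integral_mono_on zero_le_one
        (Continuous.intervalIntegrable (by fun_prop) _ _)
        (Continuous.intervalIntegrable (by fun_prop) _ _) fun x _ => ?_
      have h2 : (A + e + (B + e)) / (A + e) * p x ^ 2 + (A + e + (B + e)) / (B + e) * q x ^ 2 -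
          (p x + q x) ^ 2 = ((B + e) * p x - (A + e) * q x) ^ 2 / ((A + e) * (B + e)) := by
        field_simp; ring
      have h3 : 0 ≤ ((B + e) * p x - (A + e) * q x) ^ 2 / ((A + e) * (B + e)) := by positivity
      linarith
    rw [intervalIntegral.integral_add (Continuous.intervalIntegrable (by fun_prop) _ _)
      (Continuous.intervalIntegrable (by fun_prop) _ _), intervalIntegral.integral_const_mul,
      intervalIntegral.integral_const_mul] at h1
    refine h1.trans ?_
    have h4 : (A + e + (B + e)) / (A + e) * ∫ x in (0 : ℝ)..1, p x ^ 2 ≤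
        (A + e + (B + e)) / (A + e) * (A + e) ^ 2 := by
      refine mul_le_mul_of_nonneg_left (hpA.trans ?_) (by positivity)
      exact pow_le_pow_left₀ hA (by linarith) 2
    have h5 : (A + e + (B + e)) / (B + e) * ∫ x in (0 : ℝ)..1, q x ^ 2 ≤
        (A + e + (B + e)) / (B + e) * (B + e) ^ 2 := by
      refine mul_le_mul_of_nonneg_left (hqB.trans ?_) (by positivity)
      exact pow_le_pow_left₀ hB (by linarith) 2
    refine (add_le_add h4 h5).trans (le_of_eq ?_)
    field_simp
  have hlim : Tendsto (fun e : ℝ => (A + e + (B + e)) ^ 2) (𝓝[>] 0) (𝓝 ((A + B) ^ 2)) := by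
    have : Continuous fun e : ℝ => (A + e + (B + e)) ^ 2 := by fun_prop
    simpa using (this.tendsto 0).mono_left nhdsWithin_le_nhds
  exact ge_of_tendsto hlim (eventually_mem_nhdsWithin.mono fun e he => key e he)

section H1Bound

variable {u v : ℝ → ℝ} {M N : ℝ}

theorem continuous_deriv_of_smooth (hu : ContDiff ℝ ∞ u) : Continuous (deriv u) :=
  hu.continuous_deriv (by simp)

theorem differentiable_of_smooth (hu : ContDiff ℝ ∞ u) : Differentiable ℝ u :=
  hu.differentiable (by simp)

theorem contDiff_iteratedDeriv (hu : ContDiff ℝ ∞ u) (l : ℕ) :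
    ContDiff ℝ ∞ (iteratedDeriv l u) := by
  rw [iteratedDeriv_eq_iterate]
  exact hu.iterate_deriv l

theorem H1Bound.add (hu : ContDiff ℝ ∞ u) (hv : ContDiff ℝ ∞ v) (h : H1Bound u M)
    (h' : H1Bound v N) : H1Bound (fun x => u x + v x) (M + N) := by
  refine ⟨fun x => (abs_add_le _ _).trans (add_le_add (h.abs_le x) (h'.abs_le x)), ?_⟩
  have : deriv (fun x => u x + v x) = fun x => deriv u x + deriv v x := funext fun x =>
    deriv_fun_add (differentiable_of_smooth hu x) (differentiable_of_smooth hv x)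
  rw [this]
  exact integral_add_sq_le (continuous_deriv_of_smooth hu) (continuous_deriv_of_smooth hv)
    h.nonneg h'.nonneg h.energy_le h'.energy_le

theorem H1Bound.const_mul (h : H1Bound u M) (c : ℝ) : H1Bound (fun x => c * u x) (|c| * M) := by
  refine ⟨fun x => ?_, ?_⟩
  · rw [abs_mul]
    exact mul_le_mul_of_nonneg_left (h.abs_le x) (abs_nonneg c)
  · simp only [deriv_const_mul_field, mul_pow, sq_abs, intervalIntegral.integral_const_mul]
    exact mul_le_mul_of_nonneg_left h.energy_le (sq_nonneg c)

theorem H1Bound.zero : H1Bound (fun _ => 0) 0 := ⟨fun x => by simp, by simp⟩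

theorem H1Bound.sum {ι : Type*} (s : Finset ι) {f : ι → ℝ → ℝ} {A : ι → ℝ}
    (hf : ∀ i ∈ s, ContDiff ℝ ∞ (f i)) (h : ∀ i ∈ s, H1Bound (f i) (A i)) :
    H1Bound (fun x => ∑ i ∈ s, f i x) (∑ i ∈ s, A i) := by
  classical
  induction s using Finset.induction_on with
  | empty => simpa using H1Bound.zero
  | insert a s ha ih =>
    simp only [Finset.sum_insert ha]
    simp only [Finset.mem_insert, forall_eq_or_imp] at hf h
    exact H1Bound.add hf.1 (ContDiff.sum hf.2) h.1 (ih hf.2 h.2)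

theorem integral_mul_sq_le {p q : ℝ → ℝ} (hp : Continuous p) (hq : Continuous q)
    (hpM : ∀ x, |p x| ≤ M) (hM : 0 ≤ M) (hqN : ∫ x in (0 : ℝ)..1, q x ^ 2 ≤ N ^ 2) :
    ∫ x in (0 : ℝ)..1, (p x * q x) ^ 2 ≤ (M * N) ^ 2 := by
  have h1 : ∫ x in (0 : ℝ)..1, (p x * q x) ^ 2 ≤ ∫ x in (0 : ℝ)..1, M ^ 2 * q x ^ 2 := by
    refine intervalIntegral.integral_mono_on zero_le_one
      (Continuous.intervalIntegrable (by fun_prop) _ _)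
      (Continuous.intervalIntegrable (by fun_prop) _ _) fun x _ => ?_
    rw [mul_pow]
    exact mul_le_mul_of_nonneg_right (sq_le_sq.2 (by rw [abs_of_nonneg hM]; exact hpM x))
      (sq_nonneg _)
  rw [intervalIntegral.integral_const_mul] at h1
  rw [mul_pow]
  exact h1.trans (mul_le_mul_of_nonneg_left hqN (sq_nonneg M))

/-- The factor 2 counts the two terms of (u v)', each of which has L² norm at most M N. -/
theorem H1Bound.mul (hu : ContDiff ℝ ∞ u) (hv : ContDiff ℝ ∞ v) (h : H1Bound u M)
    (h' : H1Bound v N) : H1Bound (fun x => u x * v x) (2 * (M * N)) := by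
  have hM := h.nonneg
  have hN := h'.nonneg
  refine ⟨fun x => ?_, ?_⟩
  · rw [abs_mul]
    have := mul_le_mul (h.abs_le x) (h'.abs_le x) (abs_nonneg _) hM
    have := mul_nonneg hM hN
    linarith
  · have : deriv (fun x => u x * v x) = fun x => v x * deriv u x + u x * deriv v x := by
      funext x
      rw [deriv_fun_mul (differentiable_of_smooth hu x) (differentiable_of_smooth hv x)]
      ring
    rw [this, two_mul]
    have hc := continuous_deriv_of_smooth hu
    have hc' := continuous_deriv_of_smooth hv
    have h1 := integral_mul_sq_le hv.continuous hc h'.abs_le hN h.energy_le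
    rw [mul_comm N M] at h1
    exact integral_add_sq_le (hv.continuous.mul hc) (hu.continuous.mul hc')
      (mul_nonneg hM hN) (mul_nonneg hM hN) h1
      (integral_mul_sq_le hu.continuous hc' h.abs_le hM h'.energy_le)

/-- Leibniz' rule for bounds. -/
theorem H1Bound.iteratedDeriv_mul (hu : ContDiff ℝ ∞ u) (hv : ContDiff ℝ ∞ v) {a b : ℕ → ℝ}
    (l : ℕ) (ha : ∀ i ≤ l, H1Bound (iteratedDeriv i u) (i.factorial * a i))
    (hb : ∀ i ≤ l, H1Bound (iteratedDeriv i v) (i.factorial * b i)) :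
    H1Bound (iteratedDeriv l (fun x => u x * v x))
      (2 * (l.factorial * ∑ i ∈ Finset.range (l + 1), a i * b (l - i))) := by
  have h1 : iteratedDeriv l (fun x => u x * v x) = fun x => ∑ i ∈ Finset.range (l + 1),
      (l.choose i : ℝ) * (iteratedDeriv i u x * iteratedDeriv (l - i) v x) := by
    funext x
    have := _root_.iteratedDeriv_mul (n := l) ((contDiff_infty.1 hu l).contDiffAt (x := x))
      ((contDiff_infty.1 hv l).contDiffAt (x := x))
    simp only [mul_assoc] at this
    exact this
  rw [h1, Finset.mul_sum, Finset.mul_sum]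
  refine H1Bound.sum _ (fun i _ => contDiff_const.mul
    ((contDiff_iteratedDeriv hu i).mul (contDiff_iteratedDeriv hv _))) fun i hi => ?_
  have hil : i ≤ l := Nat.lt_succ_iff.1 (Finset.mem_range.1 hi)
  have h2 := (H1Bound.mul (contDiff_iteratedDeriv hu i) (contDiff_iteratedDeriv hv (l - i))
    (ha i hil) (hb _ (Nat.sub_le l i))).const_mul (l.choose i : ℝ)
  refine h2.mono (le_of_eq ?_)
  rw [abs_of_nonneg (Nat.cast_nonneg _), ← Nat.choose_mul_factorial_mul_factorial hil]
  push_cast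
  ring

/-- Jensen's inequality: the variance of k f on the unit interval is nonnegative. -/
theorem sq_integral_mul_le {k f : ℝ → ℝ} (hk : Continuous k) (hf : Continuous f)
    (hk1 : ∀ s ∈ Icc (0 : ℝ) 1, |k s| ≤ 1) :
    (∫ s in (0 : ℝ)..1, k s * f s) ^ 2 ≤ ∫ s in (0 : ℝ)..1, f s ^ 2 := by
  set m := ∫ s in (0 : ℝ)..1, k s * f s with hm
  have h0 : 0 ≤ ∫ s in (0 : ℝ)..1, (k s * f s - m) ^ 2 :=
    intervalIntegral.integral_nonneg zero_le_one fun s _ => sq_nonneg _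
  have h1 : ∫ s in (0 : ℝ)..1, (k s * f s - m) ^ 2 =
      (∫ s in (0 : ℝ)..1, (k s * f s) ^ 2) - m ^ 2 := by
    have : ∀ s, (k s * f s - m) ^ 2 = (k s * f s) ^ 2 - (2 * m) * (k s * f s) + m ^ 2 :=
      fun s => by ring
    simp only [this]
    rw [intervalIntegral.integral_add (Continuous.intervalIntegrable (by fun_prop) _ _)
      (Continuous.intervalIntegrable (by fun_prop) _ _),
      intervalIntegral.integral_sub (Continuous.intervalIntegrable (by fun_prop) _ _)
      (Continuous.intervalIntegrable (by fun_prop) _ _), intervalIntegral.integral_const_mul,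
      ← hm]
    simp
    ring
  have h2 : ∫ s in (0 : ℝ)..1, (k s * f s) ^ 2 ≤ ∫ s in (0 : ℝ)..1, f s ^ 2 := by
    refine intervalIntegral.integral_mono_on zero_le_one
      (Continuous.intervalIntegrable (by fun_prop) _ _)
      (Continuous.intervalIntegrable (by fun_prop) _ _) fun s hs => ?_
    rw [mul_pow]
    exact mul_le_of_le_one_left (sq_nonneg _) ((sq_le_one_iff_abs_le_one _).2 (hk1 s hs))
  linarith

theorem intervalIntegral_swap_of_continuous {E : Type*} [NormedAddCommGroup E] [NormedSpace ℝ E]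
    {f : ℝ → ℝ → E} (hf : Continuous (Function.uncurry f)) (a b c d : ℝ) :
    ∫ x in a..b, ∫ y in c..d, f x y = ∫ y in c..d, ∫ x in a..b, f x y :=
  intervalIntegral_intervalIntegral_swap
    ((hf.continuousOn.integrableOn_compact (isCompact_uIcc.prod isCompact_uIcc)).mono_set
      (prod_mono uIoc_subset_uIcc uIoc_subset_uIcc))

/-- For the derivative, Jensen's inequality in s is applied at each x; after exchanging the
integrals every slice contributes at most M². No constant is lost. -/
theorem H1Bound.average {k : ℝ → ℝ} (hk : ContDiff ℝ ∞ k) (hk1 : ∀ s ∈ Icc (0 : ℝ) 1, |k s| ≤ 1)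
    {U : ℝ × ℝ → ℝ} (hU : ContDiff ℝ ∞ U) {w : ℝ}
    (h : ∀ s ∈ Icc (0 : ℝ) 1, H1Bound (fun x => U (x, s * w)) M) :
    H1Bound (fun x => average k U (x, w)) M := by
  refine ⟨fun x => ?_, ?_⟩
  · have := intervalIntegral.norm_integral_le_of_norm_le_const (a := 0) (b := 1) (C := M)
      (f := fun s => k s * U (x, s * w)) (fun s hs => by
        rw [uIoc_of_le zero_le_one] at hs
        have hs' := Ioc_subset_Icc_self hs
        rw [Real.norm_eq_abs, abs_mul]
        exact (mul_le_of_le_one_left (abs_nonneg _) (hk1 s hs')).trans ((h s hs').abs_le x))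
    simpa [MobiusEnergy.average] using this
  · have hd : ∀ x, deriv (fun x => MobiusEnergy.average k U (x, w)) x =
        ∫ s in (0 : ℝ)..1, k s * partialFst U (x, s * w) := fun x => by
      rw [(hasDerivAt_partialFst (contDiff_average hk hU) x w).deriv, partialFst_average hk hU]
      rfl
    have hc := (contDiff_partialFst hU).continuous
    have hkc := hk.continuous
    simp only [hd]
    have h1 : ∫ x in (0 : ℝ)..1, (∫ s in (0 : ℝ)..1, k s * partialFst U (x, s * w)) ^ 2 ≤
        ∫ x in (0 : ℝ)..1, ∫ s in (0 : ℝ)..1, partialFst U (x, s * w) ^ 2 := by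
      refine intervalIntegral.integral_mono_on zero_le_one
        (Continuous.intervalIntegrable ?_ _ _) (Continuous.intervalIntegrable ?_ _ _) fun x _ => ?_
      · exact (intervalIntegral.continuous_parametric_intervalIntegral_of_continuous'
          (f := fun x s => k s * partialFst U (x, s * w)) (by fun_prop) 0 1).pow 2
      · exact intervalIntegral.continuous_parametric_intervalIntegral_of_continuous'
          (f := fun x s => partialFst U (x, s * w) ^ 2) (by fun_prop) 0 1
      · exact sq_integral_mul_le hkc (by fun_prop) hk1
    refine h1.trans ?_
    rw [intervalIntegral_swap_of_continuous (by fun_prop)]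
    have h2 : ∫ s in (0 : ℝ)..1, ∫ x in (0 : ℝ)..1, partialFst U (x, s * w) ^ 2 ≤
        ∫ _ in (0 : ℝ)..1, M ^ 2 := by
      refine intervalIntegral.integral_mono_on zero_le_one
        (Continuous.intervalIntegrable ?_ _ _) intervalIntegrable_const fun s hs => ?_
      · exact intervalIntegral.continuous_parametric_intervalIntegral_of_continuous'
          (f := fun s x => partialFst U (x, s * w) ^ 2) (by fun_prop) 0 1
      · have := (h s hs).energy_le
        have hd' : deriv (fun x => U (x, s * w)) = fun x => partialFst U (x, s * w) :=
          funext fun x => (hasDerivAt_partialFst hU x _).deriv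
        rwa [hd'] at this
    simpa using h2

end H1Bound

/-! ## Geometric majorants -/

section Majorant

variable {Φ : PowerSeries ℝ}

/-- The power series `1 / (1 - c Φ)`. -/
def geometricSeries (Φ : PowerSeries ℝ) (c : ℝ) : PowerSeries ℝ :=
  (1 - PowerSeries.C c * Φ)⁻¹

theorem geometricSeries_mul_cancel (h0 : PowerSeries.constantCoeff Φ = 0) (c : ℝ) :
    geometricSeries Φ c * (1 - PowerSeries.C c * Φ) = 1 :=
  PowerSeries.inv_mul_cancel _ (by simp [h0])

theorem coeff_mul_nonneg {P Q : PowerSeries ℝ} (hP : ∀ n, 0 ≤ PowerSeries.coeff n P)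
    (hQ : ∀ n, 0 ≤ PowerSeries.coeff n Q) (n : ℕ) : 0 ≤ PowerSeries.coeff n (P * Q) := by
  rw [PowerSeries.coeff_mul]
  exact Finset.sum_nonneg fun p _ => mul_nonneg (hP _) (hQ _)

/-- From G = 1 + c Φ G: as Φ has no constant term, each coefficient of G is a nonnegative
combination of earlier ones. -/
theorem coeff_geometricSeries_nonneg (h0 : PowerSeries.constantCoeff Φ = 0)
    (hΦ : ∀ n, 0 ≤ PowerSeries.coeff n Φ) {c : ℝ} (hc : 0 ≤ c) (n : ℕ) :
    0 ≤ PowerSeries.coeff n (geometricSeries Φ c) := by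
  have h : geometricSeries Φ c = 1 + PowerSeries.C c * (Φ * geometricSeries Φ c) := by
    linear_combination geometricSeries_mul_cancel h0 c
  induction n using Nat.strong_induction_on with
  | _ n ih =>
    rw [h, map_add, PowerSeries.coeff_C_mul, PowerSeries.coeff_mul]
    refine add_nonneg ?_ (mul_nonneg hc (Finset.sum_nonneg fun p hp => ?_))
    · rw [PowerSeries.coeff_one]
      split_ifs <;> simp
    · rw [Finset.HasAntidiagonal.mem_antidiagonal] at hp
      rcases Nat.eq_zero_or_pos p.1 with h1 | h1
      · rw [h1, PowerSeries.coeff_zero_eq_constantCoeff_apply, h0, zero_mul]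
      · exact mul_nonneg (hΦ _) (ih _ (by omega))

/-- The resolvent identity. It yields monotonicity in c, and it measures how much is gained by
enlarging c, which is what absorbs the constants in the estimate of reciprocals. -/
theorem geometricSeries_sub (h0 : PowerSeries.constantCoeff Φ = 0) (c d : ℝ) :
    geometricSeries Φ d = geometricSeries Φ c + PowerSeries.C (d - c) *
      (Φ * (geometricSeries Φ c * geometricSeries Φ d)) := by
  have hc := geometricSeries_mul_cancel h0 c
  have hd := geometricSeries_mul_cancel h0 d
  rw [map_sub]
  linear_combination geometricSeries Φ c * hd - geometricSeries Φ d * hc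

theorem coeff_geometricSeries_mono (h0 : PowerSeries.constantCoeff Φ = 0)
    (hΦ : ∀ n, 0 ≤ PowerSeries.coeff n Φ) {c d : ℝ} (hc : 0 ≤ c) (hcd : c ≤ d) (n : ℕ) :
    PowerSeries.coeff n (geometricSeries Φ c) ≤ PowerSeries.coeff n (geometricSeries Φ d) := by
  rw [geometricSeries_sub h0 c d, map_add, PowerSeries.coeff_C_mul, le_add_iff_nonneg_right]
  exact mul_nonneg (sub_nonneg.2 hcd) (coeff_mul_nonneg hΦ (coeff_mul_nonneg
    (coeff_geometricSeries_nonneg h0 hΦ hc)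
    (coeff_geometricSeries_nonneg h0 hΦ (hc.trans hcd))) n)

/-- With y = c Φ, (1 - y)² = (1 - 2y) + y², so 1 / (1 - 2y) exceeds 1 / (1 - y)² by a series with
nonnegative coefficients. A product thus costs only a doubling of c. -/
theorem coeff_geometricSeries_mul_self_le (h0 : PowerSeries.constantCoeff Φ = 0)
    (hΦ : ∀ n, 0 ≤ PowerSeries.coeff n Φ) {c : ℝ} (hc : 0 ≤ c) (n : ℕ) :
    PowerSeries.coeff n (geometricSeries Φ c * geometricSeries Φ c) ≤
      PowerSeries.coeff n (geometricSeries Φ (2 * c)) := by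
  have h1 := geometricSeries_mul_cancel h0 c
  have h2 := geometricSeries_mul_cancel h0 (2 * c)
  have h : geometricSeries Φ (2 * c) = geometricSeries Φ c * geometricSeries Φ c +
      PowerSeries.C (c * c) * ((Φ * Φ) * (geometricSeries Φ (2 * c) *
        (geometricSeries Φ c * geometricSeries Φ c))) := by
    rw [two_mul, map_add] at h2
    rw [two_mul, map_mul]
    set g := geometricSeries Φ c
    set G := geometricSeries Φ (c + c)
    set y := PowerSeries.C c * Φ
    have h3 : G * (1 - (y + y)) = 1 := by rw [add_mul] at h2; exact h2
    have : G = g * g + y * y * (G * (g * g)) := by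
      linear_combination (g * g) * h3 - G * (1 + g * (1 - y)) * h1
    calc G = _ := this
      _ = _ := by ring
  rw [h, map_add, PowerSeries.coeff_C_mul, le_add_iff_nonneg_right]
  have hg := coeff_geometricSeries_nonneg h0 hΦ hc
  exact mul_nonneg (mul_self_nonneg c) (coeff_mul_nonneg (coeff_mul_nonneg hΦ hΦ)
    (coeff_mul_nonneg (coeff_geometricSeries_nonneg h0 hΦ (by positivity))
      (coeff_mul_nonneg hg hg)) n)

theorem coeff_mul_le_coeff_mul {P P' Q Q' : PowerSeries ℝ}
    (hP' : ∀ n, 0 ≤ PowerSeries.coeff n P') (hQ : ∀ n, 0 ≤ PowerSeries.coeff n Q)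
    (h : ∀ n, PowerSeries.coeff n P ≤ PowerSeries.coeff n P')
    (h' : ∀ n, PowerSeries.coeff n Q ≤ PowerSeries.coeff n Q') (n : ℕ) :
    PowerSeries.coeff n (P * Q) ≤ PowerSeries.coeff n (P' * Q') := by
  rw [PowerSeries.coeff_mul, PowerSeries.coeff_mul]
  exact Finset.sum_le_sum fun p _ => mul_le_mul (h _) (h' _) (hQ _) (hP' _)

theorem coeff_zero_geometricSeries (h0 : PowerSeries.constantCoeff Φ = 0) (c : ℝ) :
    PowerSeries.coeff 0 (geometricSeries Φ c) = 1 := by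
  have := congrArg PowerSeries.constantCoeff (geometricSeries_mul_cancel h0 c)
  simpa [h0] using this

theorem coeff_le_coeff_geometricSeries_one (h0 : PowerSeries.constantCoeff Φ = 0)
    (hΦ : ∀ n, 0 ≤ PowerSeries.coeff n Φ) (n : ℕ) :
    PowerSeries.coeff n Φ ≤ PowerSeries.coeff n (geometricSeries Φ 1) := by
  have h1 := geometricSeries_mul_cancel h0 1
  rw [map_one, one_mul] at h1
  have h : geometricSeries Φ 1 = Φ + (1 + Φ * Φ * geometricSeries Φ 1) := by
    linear_combination (1 + Φ) * h1
  rw [h, map_add, le_add_iff_nonneg_right, map_add]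
  refine add_nonneg ?_ (coeff_mul_nonneg (coeff_mul_nonneg hΦ hΦ)
    (coeff_geometricSeries_nonneg h0 hΦ zero_le_one) n)
  rw [PowerSeries.coeff_one]
  split_ifs <;> simp

/-- A majorant of the reciprocal `u` of a function `v`. -/
theorem H1Bound.iteratedDeriv_inv (h0 : PowerSeries.constantCoeff Φ = 0)
    (hΦ : ∀ n, 0 ≤ PowerSeries.coeff n Φ) {u v : ℝ → ℝ} (hu : ContDiff ℝ ∞ u)
    (hv : ContDiff ℝ ∞ v) (huv : ∀ x, u x * v x = 1) {K C c : ℝ} (hC : 0 ≤ C) (hc : 0 ≤ c)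
    (hK : H1Bound u K)
    (hb : ∀ l, H1Bound (iteratedDeriv l v)
      (C * (l.factorial * PowerSeries.coeff l (geometricSeries Φ c)))) (l : ℕ) :
    H1Bound (iteratedDeriv l u)
      (K * (l.factorial * PowerSeries.coeff l (geometricSeries Φ (c * (1 + 4 * K * C))))) := by
  have hK0 := hK.nonneg
  -- Chosen so that d - c = 4 K C c. The factor 4 K C is what one step of the recursion costs: two
  -- products, each with the constant 2, and the bounds K of u and C of the derivatives of v.
  set d := c * (1 + 4 * K * C) with hd
  have hcd : c ≤ d := le_mul_of_one_le_right hc (by nlinarith [mul_nonneg hK0 hC])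
  have hd0 : 0 ≤ d := hc.trans hcd
  set g := geometricSeries Φ c with hg
  set G := geometricSeries Φ d with hG
  have hgn : ∀ n, 0 ≤ PowerSeries.coeff n g := coeff_geometricSeries_nonneg h0 hΦ hc
  have hGn : ∀ n, 0 ≤ PowerSeries.coeff n G := coeff_geometricSeries_nonneg h0 hΦ hd0
  induction l using Nat.strong_induction_on with
  | _ l ih =>
    rcases Nat.eq_zero_or_pos l with rfl | hl
    · simpa [hG, coeff_zero_geometricSeries h0] using hK
    -- Leibniz' rule for (u v)^(l) = 0, solved for the term u^(l) v and multiplied by u = 1 / v.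
    · have hexp : iteratedDeriv l u = fun x => -1 * (u x * ∑ i ∈ Finset.range l,
          (l.choose i : ℝ) * (iteratedDeriv i u x * iteratedDeriv (l - i) v x)) := by
        funext x
        have h1 := _root_.iteratedDeriv_mul (n := l) ((contDiff_infty.1 hu l).contDiffAt (x := x))
          ((contDiff_infty.1 hv l).contDiffAt (x := x))
        have h2 : u * v = fun _ => (1 : ℝ) := funext huv
        rw [h2, iteratedDeriv_const, if_neg hl.ne', Finset.sum_range_succ] at h1
        simp only [Nat.choose_self, Nat.cast_one, one_mul, Nat.sub_self, iteratedDeriv_zero,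
          mul_assoc] at h1
        have h3 := huv x
        linear_combination (-(u x)) * h1 - iteratedDeriv l u x * h3
      rw [hexp]
      have hsmooth : ∀ i ∈ Finset.range l, ContDiff ℝ ∞ fun x => (l.choose i : ℝ) *
          (iteratedDeriv i u x * iteratedDeriv (l - i) v x) := fun i _ => contDiff_const.mul
        ((contDiff_iteratedDeriv hu i).mul (contDiff_iteratedDeriv hv _))
      have hsum : H1Bound (fun x => ∑ i ∈ Finset.range l, (l.choose i : ℝ) *
          (iteratedDeriv i u x * iteratedDeriv (l - i) v x))
          (∑ i ∈ Finset.range l, 2 * K * C * (l.factorial * (PowerSeries.coeff i G *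
            PowerSeries.coeff (l - i) g))) := by
        refine H1Bound.sum _ hsmooth fun i hi => ?_
        have hil := Finset.mem_range.1 hi
        have h2 := (H1Bound.mul (contDiff_iteratedDeriv hu i) (contDiff_iteratedDeriv hv (l - i))
          (ih i hil) (hb (l - i))).const_mul (l.choose i : ℝ)
        refine h2.mono (le_of_eq ?_)
        rw [abs_of_nonneg (Nat.cast_nonneg _), ← Nat.choose_mul_factorial_mul_factorial hil.le]
        push_cast
        ring
      have h3 := (H1Bound.mul hu (ContDiff.sum hsmooth) hK hsum).const_mul (-1)
      refine h3.mono ?_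
      -- The sum over i < l is the l-th coefficient of G g without its last term, hence that of c Φ
      -- g G. By the resolvent identity, 4 K C times this is the excess of G over g, so at most the
      -- coefficient of G.
      have h4 : PowerSeries.coeff l G + ∑ i ∈ Finset.range l, PowerSeries.coeff i G *
          PowerSeries.coeff (l - i) g = PowerSeries.coeff l (G * g) := by
        rw [PowerSeries.coeff_mul, Finset.Nat.sum_antidiagonal_eq_sum_range_succ
          (fun i j => PowerSeries.coeff i G * PowerSeries.coeff j g), Finset.sum_range_succ,
          Nat.sub_self, hg, coeff_zero_geometricSeries h0]
        ring
      have h5 : G * g = G + PowerSeries.C c * (Φ * (g * G)) := by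
        linear_combination G * geometricSeries_mul_cancel h0 c
      have h6 : PowerSeries.coeff l G = PowerSeries.coeff l g +
          (d - c) * PowerSeries.coeff l (Φ * (g * G)) := by
        conv_lhs => rw [hG, geometricSeries_sub h0 c d, map_add, PowerSeries.coeff_C_mul]
      have h7 : ∑ i ∈ Finset.range l, PowerSeries.coeff i G * PowerSeries.coeff (l - i) g =
          c * PowerSeries.coeff l (Φ * (g * G)) := by
        rw [h5, map_add, PowerSeries.coeff_C_mul] at h4
        linarith
      have h8 : 4 * K * C * (c * PowerSeries.coeff l (Φ * (g * G))) ≤ PowerSeries.coeff l G := by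
        rw [h6]
        have : d - c = 4 * K * C * c := by rw [hd]; ring
        rw [this]
        nlinarith [hgn l]
      rw [← Finset.mul_sum, ← Finset.mul_sum, h7]
      have h9 := mul_le_mul_of_nonneg_left h8
        (mul_nonneg hK0 (Nat.cast_nonneg (α := ℝ) l.factorial))
      rw [abs_neg, abs_one]
      linarith

end Majorant

/-! ## Families with geometric majorants -/

/-- A smooth family `U (·, w)` of periodic functions, whose derivatives are dominated by the
coefficients of some `C / (1 - c Φ)`, uniformly for `|w| ≤ 1 / 2`. -/
structure GoodFamily (Φ : PowerSeries ℝ) (U : ℝ × ℝ → ℝ) : Prop where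
  smooth : ContDiff ℝ ∞ U
  periodic : ∀ x w, U (x + 1, w) = U (x, w)
  bound : ∃ C c : ℝ, 0 ≤ C ∧ 0 ≤ c ∧ ∀ (l : ℕ) (w : ℝ), |w| ≤ 1 / 2 →
    H1Bound (iteratedDeriv l fun x => U (x, w))
      (C * (l.factorial * PowerSeries.coeff l (geometricSeries Φ c)))

section GoodFamily

variable {Φ : PowerSeries ℝ} {U V : ℝ × ℝ → ℝ}

theorem contDiff_slice (hU : ContDiff ℝ ∞ U) (w : ℝ) : ContDiff ℝ ∞ fun x => U (x, w) :=
  hU.comp (by fun_prop)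

theorem iteratedDeriv_add_fun {u v : ℝ → ℝ} (hu : ContDiff ℝ ∞ u) (hv : ContDiff ℝ ∞ v) (l : ℕ) :
    iteratedDeriv l (fun x => u x + v x) =
      fun x => iteratedDeriv l u x + iteratedDeriv l v x := funext fun x =>
  iteratedDeriv_add (f := u) (g := v) ((contDiff_infty.1 hu l).contDiffAt (x := x))
    ((contDiff_infty.1 hv l).contDiffAt (x := x))

theorem GoodFamily.add (h0 : PowerSeries.constantCoeff Φ = 0)
    (hΦ : ∀ n, 0 ≤ PowerSeries.coeff n Φ) (hU : GoodFamily Φ U) (hV : GoodFamily Φ V) :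
    GoodFamily Φ fun p => U p + V p := by
  obtain ⟨C, c, hC, hc, h⟩ := hU.bound
  obtain ⟨D, d, hD, hd, h'⟩ := hV.bound
  refine ⟨hU.smooth.add hV.smooth, fun x w => by rw [hU.periodic, hV.periodic],
    C + D, max c d, add_nonneg hC hD, hc.trans (le_max_left _ _), fun l w hw => ?_⟩
  have hu := contDiff_slice hU.smooth w
  have hv := contDiff_slice hV.smooth w
  rw [iteratedDeriv_add_fun hu hv]
  refine (H1Bound.add (contDiff_iteratedDeriv hu l) (contDiff_iteratedDeriv hv l)
    (h l w hw) (h' l w hw)).mono ?_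
  rw [add_mul]
  have h1 := coeff_geometricSeries_mono h0 hΦ hc (le_max_left c d) l
  have h2 := coeff_geometricSeries_mono h0 hΦ hd (le_max_right c d) l
  gcongr

theorem GoodFamily.const_mul (hU : GoodFamily Φ U) (a : ℝ) : GoodFamily Φ fun p => a * U p := by
  obtain ⟨C, c, hC, hc, h⟩ := hU.bound
  refine ⟨contDiff_const.mul hU.smooth, fun x w => by rw [hU.periodic], |a| * C, c,
    mul_nonneg (abs_nonneg a) hC, hc, fun l w hw => ?_⟩
  have : iteratedDeriv l (fun x => a * U (x, w)) =
      fun x => a * iteratedDeriv l (fun x => U (x, w)) x := funext fun x =>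
    iteratedDeriv_const_mul_field a _
  rw [this, mul_assoc]
  exact (h l w hw).const_mul a

theorem GoodFamily.sub (h0 : PowerSeries.constantCoeff Φ = 0)
    (hΦ : ∀ n, 0 ≤ PowerSeries.coeff n Φ) (hU : GoodFamily Φ U) (hV : GoodFamily Φ V) :
    GoodFamily Φ fun p => U p - V p := by
  have := hU.add h0 hΦ (hV.const_mul (-1))
  simpa [sub_eq_add_neg] using this

/-- Dividing the bounds by factorials turns Leibniz' rule into the Cauchy product of two geometric
series. Both are raised to the larger parameter, and the square is then dominated by doubling it. -/
theorem GoodFamily.mul (h0 : PowerSeries.constantCoeff Φ = 0)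
    (hΦ : ∀ n, 0 ≤ PowerSeries.coeff n Φ) (hU : GoodFamily Φ U) (hV : GoodFamily Φ V) :
    GoodFamily Φ fun p => U p * V p := by
  obtain ⟨C, c, hC, hc, h⟩ := hU.bound
  obtain ⟨D, d, hD, hd, h'⟩ := hV.bound
  have hm : 0 ≤ max c d := hc.trans (le_max_left _ _)
  refine ⟨hU.smooth.mul hV.smooth, fun x w => by rw [hU.periodic, hV.periodic],
    2 * (C * D), 2 * max c d, by positivity, by positivity, fun l w hw => ?_⟩
  refine (H1Bound.iteratedDeriv_mul (contDiff_slice hU.smooth w) (contDiff_slice hV.smooth w)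
    (a := fun i => C * PowerSeries.coeff i (geometricSeries Φ c))
    (b := fun i => D * PowerSeries.coeff i (geometricSeries Φ d)) l
    (fun i _ => (h i w hw).mono (le_of_eq (by ring)))
    (fun i _ => (h' i w hw).mono (le_of_eq (by ring)))).mono ?_
  have h1 : ∑ i ∈ Finset.range (l + 1), C * PowerSeries.coeff i (geometricSeries Φ c) *
      (D * PowerSeries.coeff (l - i) (geometricSeries Φ d)) =
      C * D * PowerSeries.coeff l (geometricSeries Φ c * geometricSeries Φ d) := by
    rw [PowerSeries.coeff_mul, Finset.Nat.sum_antidiagonal_eq_sum_range_succ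
      (fun i j => PowerSeries.coeff i (geometricSeries Φ c) *
        PowerSeries.coeff j (geometricSeries Φ d)), Finset.mul_sum]
    exact Finset.sum_congr rfl fun i _ => by ring
  have h2 : PowerSeries.coeff l (geometricSeries Φ c * geometricSeries Φ d) ≤
      PowerSeries.coeff l (geometricSeries Φ (2 * max c d)) :=
    (coeff_mul_le_coeff_mul (coeff_geometricSeries_nonneg h0 hΦ hm)
      (coeff_geometricSeries_nonneg h0 hΦ hd)
      (coeff_geometricSeries_mono h0 hΦ hc (le_max_left c d))
      (coeff_geometricSeries_mono h0 hΦ hd (le_max_right c d)) l).trans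
      (coeff_geometricSeries_mul_self_le h0 hΦ hm l)
  rw [h1]
  calc _ = 2 * (C * D) * (l.factorial *
        PowerSeries.coeff l (geometricSeries Φ c * geometricSeries Φ d)) := by ring
    _ ≤ _ := by gcongr

theorem GoodFamily.sum (h0 : PowerSeries.constantCoeff Φ = 0)
    (hΦ : ∀ n, 0 ≤ PowerSeries.coeff n Φ) {ι : Type*} (s : Finset ι) {f : ι → ℝ × ℝ → ℝ}
    (h : ∀ i ∈ s, GoodFamily Φ (f i)) : GoodFamily Φ fun p => ∑ i ∈ s, f i p := by
  classical
  induction s using Finset.induction_on with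
  | empty =>
    refine ⟨by simpa using contDiff_const, by simp, 0, 0, le_rfl, le_rfl, fun l w _ => ?_⟩
    have : iteratedDeriv l (fun _ : ℝ => (0 : ℝ)) = fun _ => 0 :=
      funext fun x => iteratedDeriv_fun_const_zero
    simpa [this] using H1Bound.zero
  | insert a s ha ih =>
    simp only [Finset.sum_insert ha]
    simp only [Finset.mem_insert, forall_eq_or_imp] at h
    exact h.1.add h0 hΦ (ih h.2)

/-- The range |w| ≤ 1/2 contains s w for all s in [0, 1], so the same C and c serve the average. -/
theorem GoodFamily.average (hU : GoodFamily Φ U) {k : ℝ → ℝ} (hk : ContDiff ℝ ∞ k)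
    (hk1 : ∀ s ∈ Icc (0 : ℝ) 1, |k s| ≤ 1) : GoodFamily Φ (average k U) := by
  obtain ⟨C, c, hC, hc, h⟩ := hU.bound
  refine ⟨contDiff_average hk hU.smooth, fun x w => by simp [MobiusEnergy.average, hU.periodic],
    C, c, hC, hc, fun l w hw => ?_⟩
  rw [iteratedDeriv_eq_iterate_partialFst (contDiff_average hk hU.smooth),
    iterate_partialFst_average hk hU.smooth]
  refine H1Bound.average hk hk1 (contDiff_iterate_partialFst hU.smooth l) fun s hs => ?_
  rw [← iteratedDeriv_eq_iterate_partialFst hU.smooth]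
  refine h l _ ?_
  rw [abs_mul, abs_of_nonneg hs.1]
  exact (mul_le_of_le_one_left (abs_nonneg _) hs.2).trans hw

theorem GoodFamily.slice (hU : GoodFamily Φ U) {w : ℝ} (hw : |w| ≤ 1 / 2) :
    GoodFamily Φ fun p => U (p.1, w) := by
  obtain ⟨C, c, hC, hc, h⟩ := hU.bound
  exact ⟨hU.smooth.comp (by fun_prop), fun x _ => hU.periodic x w, C, c, hC, hc,
    fun l _ _ => h l w hw⟩

theorem exists_H1Bound_uniform (hU : ContDiff ℝ ∞ U) (hper : ∀ x w, U (x + 1, w) = U (x, w)) :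
    ∃ K : ℝ, ∀ w, |w| ≤ 1 / 2 → H1Bound (fun x => U (x, w)) K := by
  have hcomp : IsCompact (Icc (0 : ℝ) 1 ×ˢ Icc (-(1 / 2) : ℝ) (1 / 2)) :=
    isCompact_Icc.prod isCompact_Icc
  obtain ⟨M, hM⟩ := hcomp.exists_bound_of_continuousOn hU.continuous.continuousOn
  obtain ⟨N, hN⟩ := hcomp.exists_bound_of_continuousOn (contDiff_partialFst hU).continuous.continuousOn
  refine ⟨max M N, fun w hw => ⟨fun x => ?_, ?_⟩⟩
  · have hp : Function.Periodic (fun x => U (x, w)) 1 := fun x => hper x w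
    obtain ⟨y, hy, hxy⟩ := hp.exists_mem_Ico₀ one_pos x
    rw [show U (x, w) = U (y, w) from hxy]
    exact (hM (y, w) ⟨Ico_subset_Icc_self hy, abs_le.1 hw⟩).trans (le_max_left _ _)
  · have hd : deriv (fun x => U (x, w)) = fun x => partialFst U (x, w) :=
      funext fun x => (hasDerivAt_partialFst hU x _).deriv
    have h2 : ∫ x in (0 : ℝ)..1, partialFst U (x, w) ^ 2 ≤ ∫ _ in (0 : ℝ)..1, max M N ^ 2 := by
      have hc := (contDiff_partialFst hU).continuous
      refine intervalIntegral.integral_mono_on zero_le_one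
        (Continuous.intervalIntegrable (by fun_prop) _ _) intervalIntegrable_const fun x hx => ?_
      rw [← sq_abs]
      exact pow_le_pow_left₀ (abs_nonneg _)
        ((hN (x, w) ⟨hx, abs_le.1 hw⟩).trans (le_max_right _ _)) 2
    rw [hd]
    simpa using h2

/-- Compactness supplies only the bound K of order zero; every higher order follows from the
recursion for reciprocals, so C and c do not depend on l. The relation U V = 1 is asked for only
where |w| ≤ 1/2, since the squared chord quotient to be inverted vanishes at w = ±1. -/
theorem GoodFamily.inv (h0 : PowerSeries.constantCoeff Φ = 0)
    (hΦ : ∀ n, 0 ≤ PowerSeries.coeff n Φ) (hV : GoodFamily Φ V) (hU : ContDiff ℝ ∞ U)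
    (hper : ∀ x w, U (x + 1, w) = U (x, w))
    (hUV : ∀ x w, |w| ≤ 1 / 2 → U (x, w) * V (x, w) = 1) : GoodFamily Φ U := by
  obtain ⟨C, c, hC, hc, h⟩ := hV.bound
  obtain ⟨K, hK⟩ := exists_H1Bound_uniform hU hper
  have hK0 : 0 ≤ K := (hK 0 (by norm_num)).nonneg
  exact ⟨hU, hper, K, c * (1 + 4 * K * C), hK0, by positivity, fun l w hw =>
    H1Bound.iteratedDeriv_inv h0 hΦ (contDiff_slice hU w) (contDiff_slice hV.smooth w)
      (fun x => hUV x w hw) hC hc (hK w hw) (fun l => h l w hw) l⟩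

end GoodFamily

/-! ## Faà di Bruno's polynomials as coefficients of power series -/

section FaaDiBruno

theorem coeff_eq_of_X_pow_dvd_sub {P Q : PowerSeries ℝ} {l : ℕ}
    (h : (PowerSeries.X : PowerSeries ℝ) ^ (l + 1) ∣ P - Q) :
    PowerSeries.coeff l P = PowerSeries.coeff l Q := by
  have := PowerSeries.X_pow_dvd_iff.1 h l (Nat.lt_succ_self l)
  rwa [map_sub, sub_eq_zero] at this

/-- The remainder of the finite geometric sum is divisible by X^(l + 1), because Φ has no constant
term. -/
theorem coeff_geometricSeries {Φ : PowerSeries ℝ} (h0 : PowerSeries.constantCoeff Φ = 0) (c : ℝ)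
    (l : ℕ) : PowerSeries.coeff l (geometricSeries Φ c) =
      ∑ k ∈ Finset.range (l + 1), c ^ k * PowerSeries.coeff l (Φ ^ k) := by
  have h1 := geometricSeries_mul_cancel h0 c
  set y := PowerSeries.C c * Φ with hy
  have h2 := mul_neg_geom_sum y (l + 1)
  have h3 : (PowerSeries.X : PowerSeries ℝ) ^ (l + 1) ∣
      geometricSeries Φ c - ∑ k ∈ Finset.range (l + 1), y ^ k := by
    have h4 : geometricSeries Φ c - ∑ k ∈ Finset.range (l + 1), y ^ k =
        y ^ (l + 1) * geometricSeries Φ c := by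
      linear_combination (-(geometricSeries Φ c)) * h2 +
        (∑ k ∈ Finset.range (l + 1), y ^ k) * h1
    rw [h4]
    refine Dvd.dvd.mul_right (pow_dvd_pow_of_dvd ?_ _) _
    rw [PowerSeries.X_dvd_iff, hy, map_mul, h0, mul_zero]
  rw [coeff_eq_of_X_pow_dvd_sub h3, map_sum]
  refine Finset.sum_congr rfl fun k _ => ?_
  rw [hy, mul_pow, ← map_pow, PowerSeries.coeff_C_mul]

variable {ι : Type} [Fintype ι]

/-- The exponential generating function of `∑ c, b · c`, with a shifted index. -/
def generatingSeries (b : ℕ → ι → ℝ) : PowerSeries ℝ :=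
  PowerSeries.X * PowerSeries.mk fun m => ∑ c, b m c / ((m + 1).factorial : ℝ)

theorem constantCoeff_generatingSeries (b : ℕ → ι → ℝ) :
    PowerSeries.constantCoeff (generatingSeries b) = 0 := by
  simp [generatingSeries]

theorem coeff_succ_generatingSeries (b : ℕ → ι → ℝ) (m : ℕ) :
    PowerSeries.coeff (m + 1) (generatingSeries b) =
      ∑ c, b m c / ((m + 1).factorial : ℝ) := by
  rw [generatingSeries, PowerSeries.coeff_succ_X_mul, PowerSeries.coeff_mk]

theorem coeff_generatingSeries_nonneg {b : ℕ → ι → ℝ} (hb : ∀ m c, 0 ≤ b m c) (n : ℕ) :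
    0 ≤ PowerSeries.coeff n (generatingSeries b) := by
  cases n with
  | zero => simp [constantCoeff_generatingSeries]
  | succ n =>
    rw [coeff_succ_generatingSeries]
    exact Finset.sum_nonneg fun c _ => div_nonneg (hb n c) (Nat.cast_nonneg _)

theorem X_pow_dvd_generatingSeries_sub (b : ℕ → ι → ℝ) (l : ℕ) :
    (PowerSeries.X : PowerSeries ℝ) ^ (l + 1) ∣ generatingSeries b - ∑ p : Fin l × ι,
      PowerSeries.monomial ((p.1 : ℕ) + 1) (b p.1 p.2 / (((p.1 : ℕ) + 1).factorial : ℝ)) := by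
  rw [PowerSeries.X_pow_dvd_iff]
  intro m hm
  rw [map_sub, map_sum, Fintype.sum_prod_type]
  simp only [PowerSeries.coeff_monomial]
  cases m with
  | zero => simp [constantCoeff_generatingSeries]
  | succ m =>
    rw [coeff_succ_generatingSeries, Finset.sum_eq_single (⟨m, by omega⟩ : Fin l)]
    · simp
    · intro i _ hi
      refine Finset.sum_eq_zero fun c _ => if_neg fun h => hi ?_
      ext
      simp only
      omega
    · simp

theorem coeff_generatingSeries_const_mul (b : ℕ → ι → ℝ) (a : ℝ) (l k : ℕ) :
    PowerSeries.coeff l (generatingSeries (fun m c => a * b m c) ^ k) =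
      a ^ k * PowerSeries.coeff l (generatingSeries b ^ k) := by
  have : generatingSeries (fun m c => a * b m c) = PowerSeries.C a * generatingSeries b := by
    ext m
    rw [PowerSeries.coeff_C_mul]
    cases m with
    | zero => simp [constantCoeff_generatingSeries]
    | succ m =>
      rw [coeff_succ_generatingSeries, coeff_succ_generatingSeries, Finset.mul_sum]
      exact Finset.sum_congr rfl fun c _ => mul_div_assoc _ _ _
  rw [this, mul_pow, ← map_pow, PowerSeries.coeff_C_mul]

theorem coeff_pow_nonneg {P : PowerSeries ℝ} (hP : ∀ n, 0 ≤ PowerSeries.coeff n P) (k : ℕ) :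
    ∀ n, 0 ≤ PowerSeries.coeff n (P ^ k) := by
  induction k with
  | zero =>
    intro n
    rw [pow_zero, PowerSeries.coeff_one]
    split_ifs <;> simp
  | succ k ih => exact fun n => by rw [pow_succ]; exact coeff_mul_nonneg ih hP n

variable [DecidableEq ι]

/-- The multinomial theorem, after replacing the series by its truncation modulo X^(l + 1), which
does not change the l-th coefficient of the power. -/
theorem coeff_generatingSeries_pow (b : ℕ → ι → ℝ) (l k : ℕ) :
    PowerSeries.coeff l (generatingSeries b ^ k) =
      ∑ q ∈ (Finset.piAntidiag (Finset.univ : Finset (Fin l × ι)) k).filter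
        (fun q => ∑ p, ((p.1 : ℕ) + 1) * q p = l),
        (Nat.multinomial Finset.univ q : ℝ) *
          ∏ p, (b p.1 p.2 / (((p.1 : ℕ) + 1).factorial : ℝ)) ^ q p := by
  rw [coeff_eq_of_X_pow_dvd_sub ((X_pow_dvd_generatingSeries_sub b l).trans
    (sub_dvd_pow_sub_pow _ _ k)), Finset.sum_pow_eq_sum_piAntidiag, map_sum, Finset.sum_filter]
  refine Finset.sum_congr rfl fun q _ => ?_
  simp only [PowerSeries.monomial_pow]
  rw [PowerSeries.prod_monomial, ← map_natCast (PowerSeries.C (R := ℝ)),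
    PowerSeries.coeff_C_mul, PowerSeries.coeff_monomial]
  have h1 : ∑ p : Fin l × ι, q p * ((p.1 : ℕ) + 1) = ∑ p : Fin l × ι, ((p.1 : ℕ) + 1) * q p :=
    Finset.sum_congr rfl fun p _ => mul_comm _ _
  rw [h1]
  by_cases h : ∑ p : Fin l × ι, ((p.1 : ℕ) + 1) * q p = l
  · rw [if_pos h, if_pos h.symm]
  · rw [if_neg h, if_neg (Ne.symm h), mul_zero]

/-- When A_α depends on |α| alone, the indices q can be grouped by k = |α|. Within a group, 1 / ∏ q!
is the multinomial coefficient divided by k!, and the remaining factorials normalize the variables b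
to the coefficients of the generating series. -/
theorem eval_faaDiBrunoPoly (b : ℕ → ι → ℝ) (A : ℕ → ℝ) (l : ℕ) :
    MvPolynomial.eval (Sum.elim (fun α : ι → ℕ => A (∑ c, α c))
      (fun p : Fin l × ι => b p.1 p.2)) (faaDiBrunoPoly l ι) =
      l.factorial * ∑ k ∈ Finset.range (l + 1), A k / k.factorial *
        PowerSeries.coeff l (generatingSeries b ^ k) := by
  have hmaps : ∀ q ∈ faaDiBrunoIndex l ι, ∑ i : Fin l, ∑ j, q i j ∈ Finset.range (l + 1) := by
    intro q hq
    have h1 := (Finset.mem_filter.1 hq).2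
    rw [Finset.mem_range, Nat.lt_succ_iff]
    calc ∑ i : Fin l, ∑ j, q i j ≤ ∑ i : Fin l, ((i : ℕ) + 1) * ∑ j, q i j :=
          Finset.sum_le_sum fun i _ => Nat.le_mul_of_pos_left _ (Nat.succ_pos _)
      _ = l := h1
  rw [faaDiBrunoPoly, map_sum, ← Finset.sum_fiberwise_of_maps_to hmaps, Finset.mul_sum]
  refine Finset.sum_congr rfl fun k _ => ?_
  rw [coeff_generatingSeries_pow, Finset.mul_sum, Finset.mul_sum]
  refine Finset.sum_nbij' (fun q p => q p.1 p.2) (fun q i j => q (i, j)) ?_ ?_ ?_ ?_ ?_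
  · intro q hq
    rw [Finset.mem_filter] at hq
    have h1 := (Finset.mem_filter.1 hq.1).2
    simp only [Finset.mem_filter, Finset.mem_piAntidiag, Finset.mem_univ, implies_true, and_true,
      Fintype.sum_prod_type, ← Finset.mul_sum]
    exact ⟨hq.2, h1⟩
  · intro q hq
    simp only [Finset.mem_filter, Finset.mem_piAntidiag, Finset.mem_univ, implies_true, and_true,
      Fintype.sum_prod_type, ← Finset.mul_sum] at hq
    rw [Finset.mem_filter, faaDiBrunoIndex, Finset.mem_filter]
    refine ⟨⟨?_, hq.2⟩, hq.1⟩
    simp only [Fintype.mem_piFinset, Finset.mem_range, Nat.lt_succ_iff]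
    intro i j
    calc q (i, j) ≤ ∑ j, q (i, j) :=
          Finset.single_le_sum (f := fun j => q (i, j)) (fun _ _ => Nat.zero_le _)
            (Finset.mem_univ j)
      _ ≤ ((i : ℕ) + 1) * ∑ j, q (i, j) := Nat.le_mul_of_pos_left _ (Nat.succ_pos _)
      _ ≤ ∑ i : Fin l, ((i : ℕ) + 1) * ∑ j, q (i, j) :=
          Finset.single_le_sum (f := fun i : Fin l => ((i : ℕ) + 1) * ∑ j, q (i, j))
            (fun _ _ => Nat.zero_le _) (Finset.mem_univ i)
      _ = l := hq.2
  · intro q _; rfl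
  · intro q _; rfl
  · intro q hq
    have hk : ∑ i : Fin l, ∑ j, q i j = k := (Finset.mem_filter.1 hq).2
    have hk' : ∑ j, ∑ i : Fin l, q i j = k := by rw [Finset.sum_comm, hk]
    have hspec := Nat.multinomial_spec (Finset.univ : Finset (Fin l × ι)) fun p => q p.1 p.2
    rw [Fintype.sum_prod_type, hk] at hspec
    have hspec' : (∏ i : Fin l, ∏ j, ((q i j).factorial : ℝ)) *
        (Nat.multinomial Finset.univ fun p : Fin l × ι => q p.1 p.2) = k.factorial := by
      rw [← hspec, Fintype.prod_prod_type]
      push_cast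
      rfl
    have hne : (∏ i : Fin l, ∏ j, ((q i j).factorial : ℝ)) ≠ 0 :=
      Finset.prod_ne_zero_iff.2 fun i _ => Finset.prod_ne_zero_iff.2 fun j _ =>
        Nat.cast_ne_zero.2 (Nat.factorial_ne_zero _)
    have hk0 : (k.factorial : ℝ) ≠ 0 := Nat.cast_ne_zero.2 (Nat.factorial_ne_zero _)
    have hne' : (∏ i : Fin l, (((i : ℕ) + 1).factorial : ℝ) ^ (∑ j, q i j)) ≠ 0 :=
      Finset.prod_ne_zero_iff.2 fun i _ => pow_ne_zero _
        (Nat.cast_ne_zero.2 (Nat.factorial_ne_zero _))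
    have hprod : ∏ p : Fin l × ι, (b p.1 p.2 / (((p.1 : ℕ) + 1).factorial : ℝ)) ^ q p.1 p.2 =
        (∏ i : Fin l, ∏ j, b i j ^ q i j) /
          ∏ i : Fin l, (((i : ℕ) + 1).factorial : ℝ) ^ (∑ j, q i j) := by
      rw [Fintype.prod_prod_type, ← Finset.prod_div_distrib]
      refine Finset.prod_congr rfl fun i _ => ?_
      rw [← Finset.prod_pow_eq_pow_sum, ← Finset.prod_div_distrib]
      exact Finset.prod_congr rfl fun j _ => div_pow _ _ _
    simp only [map_mul, map_prod, map_pow, MvPolynomial.eval_C, MvPolynomial.eval_X,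
      Sum.elim_inl, Sum.elim_inr, hk']
    rw [hprod]
    field_simp
    rw [← hspec']
    ring

/-- With r = C₁ / c, the power C₁^k from the rescaled variables combines with r^(-k) to c^k. The
right side then carries the extra factor (k + 1)! / k! = k + 1 ≥ 1 in each term. -/
theorem factorial_mul_coeff_geometricSeries_le {b : ℕ → ι → ℝ} (hb : ∀ m c, 0 ≤ b m c) {C₁ c : ℝ}
    (hC : 0 < C₁) (hc : 0 < c) (l : ℕ) :
    l.factorial * PowerSeries.coeff l (geometricSeries (generatingSeries b) c) ≤
      C₁ / c * MvPolynomial.eval (Sum.elim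
        (fun α : ι → ℕ => (((∑ j, α j) + 1).factorial : ℝ) / (C₁ / c) ^ ((∑ j, α j) + 1))
        (fun p : Fin l × ι => C₁ * b p.1 p.2)) (faaDiBrunoPoly l ι) := by
  rw [eval_faaDiBrunoPoly (fun m j => C₁ * b m j)
    (fun k => ((k + 1).factorial : ℝ) / (C₁ / c) ^ (k + 1)) l,
    coeff_geometricSeries (constantCoeff_generatingSeries b), mul_left_comm]
  refine mul_le_mul_of_nonneg_left ?_ (Nat.cast_nonneg _)
  rw [Finset.mul_sum]
  refine Finset.sum_le_sum fun k _ => ?_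
  rw [coeff_generatingSeries_const_mul]
  have h1 : C₁ / c * (((k + 1).factorial : ℝ) / (C₁ / c) ^ (k + 1) / k.factorial *
      (C₁ ^ k * PowerSeries.coeff l (generatingSeries b ^ k))) =
      ((k : ℝ) + 1) * (c ^ k * PowerSeries.coeff l (generatingSeries b ^ k)) := by
    have hk0 : (k.factorial : ℝ) ≠ 0 := Nat.cast_ne_zero.2 (Nat.factorial_ne_zero _)
    rw [Nat.factorial_succ, div_pow]
    push_cast
    field_simp
    ring
  rw [h1]
  refine le_mul_of_one_le_left (mul_nonneg (by positivity)
    (coeff_pow_nonneg (coeff_generatingSeries_nonneg hb) k l)) ?_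
  have : (0 : ℝ) ≤ k := Nat.cast_nonneg k
  linarith

end FaaDiBruno

/-! ## Fourier coefficients -/

section Fourier

/-- The Fourier coefficients of a function on `ℝ / ℤ`. -/
abbrev fourierCoeffUnit {E : Type*} [NormedAddCommGroup E] [NormedSpace ℂ E] (f : ℝ → E) (k : ℤ) :
    E :=
  fourierCoeffOn (zero_lt_one (α := ℝ)) f k

/-- The character `exp (2 π i k x)`. -/
def character (k : ℤ) (x : ℝ) : ℂ :=
  Complex.exp (2 * Real.pi * Complex.I * k * x)

theorem character_add (k m : ℤ) (x : ℝ) :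
    character (k + m) x = character k x * character m x := by
  rw [character, character, character, ← Complex.exp_add]
  congr 1
  push_cast
  ring

theorem character_zero (x : ℝ) : character 0 x = 1 := by simp [character]

theorem norm_character (k : ℤ) (x : ℝ) : ‖character k x‖ = 1 := by
  rw [character, show (2 * Real.pi * Complex.I * k * x : ℂ) =
    ((2 * Real.pi * k * x : ℝ) : ℂ) * Complex.I by push_cast; ring]
  exact Complex.norm_exp_ofReal_mul_I _

theorem character_add_right (k : ℤ) (x y : ℝ) :
    character k (x + y) = character k x * character k y := by
  rw [character, character, character, ← Complex.exp_add]
  congr 1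
  push_cast
  ring

theorem character_one_right (k : ℤ) : character k 1 = 1 := by
  rw [character, Complex.exp_eq_one_iff]
  exact ⟨k, by push_cast; ring⟩

theorem continuous_character (k : ℤ) : Continuous (character k) := by
  unfold character
  fun_prop

theorem fourierCoeffUnit_eq {E : Type*} [NormedAddCommGroup E] [NormedSpace ℂ E] (f : ℝ → E)
    (k : ℤ) : fourierCoeffUnit f k = ∫ x in (0 : ℝ)..1, character (-k) x • f x := by
  rw [fourierCoeffUnit, fourierCoeffOn_eq_integral]
  rw [show (1 / (1 - 0) : ℝ) = 1 by norm_num, one_smul]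
  refine intervalIntegral.integral_congr fun x _ => ?_
  simp only [character, fourier_coe_apply]
  congr 2
  simp

theorem integral_character (k : ℤ) :
    ∫ x in (0 : ℝ)..1, character k x = if k = 0 then 1 else 0 := by
  split_ifs with hk
  · simp [hk, character_zero]
  · have hc : (2 * Real.pi * Complex.I * k : ℂ) ≠ 0 := by
      simp [Real.pi_ne_zero, hk]
    have h := integral_exp_mul_complex (a := 0) (b := 1) hc
    have h1 := character_one_right k
    simp only [character] at h1 ⊢
    rw [h, h1]
    simp

theorem integrable_character_mul {f : ℝ → ℂ} (hf : IntervalIntegrable f volume 0 1) (k : ℤ) :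
    IntervalIntegrable (fun x => character k x * f x) volume 0 1 :=
  hf.continuousOn_mul (continuous_character k).continuousOn

theorem hasSum_integral_character_mul {c : ℤ → ℂ} (hc : Summable fun k => ‖c k‖) {f g : ℝ → ℂ}
    (hf : IntervalIntegrable f volume 0 1)
    (hg : ∀ᵐ x ∂volume.restrict (Ioc (0 : ℝ) 1), HasSum (fun k => c k * character k x) (g x)) :
    HasSum (fun k => c k * ∫ x in (0 : ℝ)..1, character k x * f x)
      (∫ x in (0 : ℝ)..1, g x * f x) := by
  have hf' : Integrable f (volume.restrict (Ioc (0 : ℝ) 1)) :=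
    (intervalIntegrable_iff_integrableOn_Ioc_of_le zero_le_one).1 hf
  have hint : ∀ k, Integrable (fun x => c k * (character k x * f x))
      (volume.restrict (Ioc (0 : ℝ) 1)) := fun k =>
    ((intervalIntegrable_iff_integrableOn_Ioc_of_le zero_le_one).1
      (integrable_character_mul hf k)).const_mul _
  have h := hasSum_integral_of_summable_integral_norm hint ?_
  · simp only [intervalIntegral.integral_of_le zero_le_one]
    convert! h using 1
    · exact funext fun k => (integral_const_mul _ _).symm
    · refine integral_congr_ae ?_
      filter_upwards [hg] with x hx
      rw [← hx.tsum_eq, ← tsum_mul_right]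
      exact tsum_congr fun k => mul_assoc _ _ _
  · simp only [norm_mul, norm_character, one_mul, integral_const_mul]
    exact hc.mul_right _

theorem memLp_of_continuous {E : Type*} [NormedAddCommGroup E] {f : ℝ → E} (hf : Continuous f)
    (p : ENNReal) : MemLp f p (volume.restrict (Ioc (0 : ℝ) 1)) := by
  obtain ⟨M, hM⟩ := isCompact_Icc.exists_bound_of_continuousOn
    (hf.continuousOn (s := Icc (0 : ℝ) 1))
  refine MemLp.of_bound hf.aestronglyMeasurable M ?_
  filter_upwards [ae_restrict_mem measurableSet_Ioc] with x hx
  exact hM x (Ioc_subset_Icc_self hx)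

theorem intervalIntegrable_of_memLp {f : ℝ → ℂ}
    (hf : MemLp f 2 (volume.restrict (Ioc (0 : ℝ) 1))) : IntervalIntegrable f volume 0 1 :=
  (intervalIntegrable_iff_integrableOn_Ioc_of_le zero_le_one).2 (hf.integrable one_le_two)

/-- A square integrable function with summable Fourier coefficients is the sum of its Fourier
series. -/
theorem ae_hasSum_fourier {f : ℝ → ℂ} (hf : MemLp f 2 (volume.restrict (Ioc (0 : ℝ) 1)))
    (hs : Summable fun k => ‖fourierCoeffUnit f k‖) :
    ∀ᵐ x ∂volume.restrict (Ioc (0 : ℝ) 1),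
      HasSum (fun k => fourierCoeffUnit f k * character k x) (f x) := by
  set F : ℝ → ℂ := fun x => ∑' k, fourierCoeffUnit f k * character k x with hF
  have hsum : ∀ x, HasSum (fun k => fourierCoeffUnit f k * character k x) (F x) := fun x =>
    Summable.hasSum (Summable.of_norm (by simpa [norm_character] using hs))
  have hcont : Continuous F := by
    refine continuous_tsum (fun k => continuous_const.mul (continuous_character k)) hs fun k x => ?_
    rw [norm_mul, norm_character, mul_one]
  -- The uniformly convergent series F has the same coefficients as f, so Parseval's identity makes
  -- the L² norm of f - F vanish.
  have hcoeff : ∀ k, fourierCoeffUnit F k = fourierCoeffUnit f k := by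
    intro k
    have h := hasSum_integral_character_mul hs
      ((continuous_character (-k)).intervalIntegrable (μ := volume) 0 1) (Eventually.of_forall hsum)
    have h1 : ∀ m, fourierCoeffUnit f m * ∫ x in (0 : ℝ)..1, character m x * character (-k) x =
        if m = k then fourierCoeffUnit f m else 0 := by
      intro m
      simp only [← character_add, integral_character, add_neg_eq_zero]
      split_ifs <;> simp
    simp only [h1] at h
    have h2 := h.unique (hasSum_ite_eq k (fourierCoeffUnit f k) |>.congr_fun fun m => by
      by_cases hm : m = k <;> simp [hm])
    rw [fourierCoeffUnit_eq F, ← h2]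
    exact intervalIntegral.integral_congr fun x _ => mul_comm _ _
  have hd : MemLp (f - F) 2 (volume.restrict (Ioc (0 : ℝ) 1)) :=
    hf.sub (memLp_of_continuous hcont 2)
  have hd0 : ∀ k, fourierCoeffUnit (f - F) k = 0 := by
    intro k
    have h1 := integrable_character_mul (intervalIntegrable_of_memLp hf) (-k)
    have h2 := integrable_character_mul (hcont.intervalIntegrable (μ := volume) 0 1) (-k)
    have h3 := intervalIntegral.integral_sub h1 h2
    have h4 := hcoeff k
    rw [fourierCoeffUnit_eq, fourierCoeffUnit_eq] at h4
    rw [fourierCoeffUnit_eq]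
    simp only [smul_eq_mul, Pi.sub_apply, mul_sub] at h3 h4 ⊢
    rw [h3, h4, sub_self]
  have hp := (hasSum_sq_fourierCoeffOn (zero_lt_one (α := ℝ)) hd)
  simp only [fourierCoeffUnit] at hd0
  simp only [hd0, norm_zero, ne_eq, OfNat.ofNat_ne_zero, not_false_eq_true, zero_pow, sub_zero,
    inv_one, one_smul] at hp
  have h0 := hp.unique hasSum_zero
  rw [intervalIntegral.integral_of_le zero_le_one, integral_eq_zero_iff_of_nonneg
    (fun x => by positivity) ((memLp_two_iff_integrable_sq_norm hd.1).1 hd)] at h0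
  filter_upwards [h0] with x hx
  have : f x = F x := by simpa [sub_eq_zero] using hx
  rw [this]
  exact hsum x

theorem fourierCoeffUnit_mul {f g : ℝ → ℂ} (hf : MemLp f 2 (volume.restrict (Ioc (0 : ℝ) 1)))
    (hs : Summable fun k => ‖fourierCoeffUnit f k‖) (hg : IntervalIntegrable g volume 0 1)
    (k : ℤ) : HasSum (fun a => fourierCoeffUnit f a * fourierCoeffUnit g (k - a))
      (fourierCoeffUnit (fun x => f x * g x) k) := by
  have h := hasSum_integral_character_mul hs (integrable_character_mul hg (-k))
    (ae_hasSum_fourier hf hs)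
  rw [fourierCoeffUnit_eq]
  convert! h using 1
  · funext a
    rw [fourierCoeffUnit_eq g]
    congr 1
    refine intervalIntegral.integral_congr fun x _ => ?_
    simp only [smul_eq_mul]
    rw [← mul_assoc, ← character_add]
    congr 2
    ring
  · exact intervalIntegral.integral_congr fun x _ => by simp only [smul_eq_mul]; ring

end Fourier

/-! ## The weighted convolution inequality -/

section Convolution

/-- The weight `1 + k ^ 2`. -/
def weight (k : ℤ) : ENNReal := ENNReal.ofReal (1 + (k : ℝ) ^ 2)

/-- The square of the weighted `ℓ²` norm that corresponds to `H¹`. -/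
def weightedSq (A : ℤ → ENNReal) : ENNReal := ∑' k, weight k * A k ^ 2

theorem weight_ne_zero (k : ℤ) : weight k ≠ 0 := by
  rw [weight, ne_eq, ENNReal.ofReal_eq_zero, not_le]
  positivity

theorem weight_ne_top (k : ℤ) : weight k ≠ ⊤ := ENNReal.ofReal_ne_top

theorem summable_inv_one_add_sq : Summable fun k : ℤ => (1 + (k : ℝ) ^ 2)⁻¹ := by
  refine Summable.of_nonneg_of_le (fun k => by positivity) (fun k => ?_)
    ((Real.summable_one_div_int_pow.2 one_lt_two).add
      (summable_of_hasFiniteSupport (f := fun k : ℤ => if k = 0 then (1 : ℝ) else 0)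
        ((finite_singleton (0 : ℤ)).subset fun k hk => by simpa using hk)))
  by_cases hk : k = 0
  · simp [hk]
  · have : (k : ℝ) ^ 2 ≠ 0 := by positivity
    rw [if_neg hk, add_zero, ← one_div]
    exact one_div_le_one_div_of_le (by positivity) (by linarith)

theorem tsum_inv_weight_ne_top : ∑' k, (weight k)⁻¹ ≠ ⊤ := by
  have h : ∀ k : ℤ, (weight k)⁻¹ = ENNReal.ofReal ((1 + (k : ℝ) ^ 2)⁻¹) := fun k =>
    (ENNReal.ofReal_inv_of_pos (by positivity)).symm
  simp only [h]
  exact summable_inv_one_add_sq.tsum_ofReal_ne_top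

theorem sq_tsum_mul_le (f g : ℤ → ENNReal) :
    (∑' a, f a * g a) ^ 2 ≤ (∑' a, f a ^ 2) * ∑' a, g a ^ 2 := by
  have h := ENNReal.lintegral_mul_le_Lp_mul_Lq (μ := Measure.count) (p := 2) (q := 2)
    (Real.HolderConjugate.two_two) (f := f) (g := g) (measurable_of_countable f).aemeasurable
    (measurable_of_countable g).aemeasurable
  simp only [Pi.mul_apply, lintegral_count] at h
  calc (∑' a, f a * g a) ^ 2 ≤ _ := pow_le_pow_left₀ (by simp) h 2
    _ = _ := by
      rw [mul_pow, ← ENNReal.rpow_natCast, ← ENNReal.rpow_mul, ← ENNReal.rpow_natCast,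
        ← ENNReal.rpow_mul]
      norm_num

/-- From k² ≤ 2 a² + 2 (k - a)². Summation over a then bounds the left side independently of k. -/
theorem weight_mul_inv_le (k a : ℤ) :
    weight k * ((weight a)⁻¹ * (weight (k - a))⁻¹) ≤
      2 * ((weight a)⁻¹ + (weight (k - a))⁻¹) := by
  have h : weight k ≤ 2 * (weight a + weight (k - a)) := by
    rw [weight, weight, weight, ← ENNReal.ofReal_add (by positivity) (by positivity),
      show (2 : ENNReal) = ENNReal.ofReal 2 by simp, ← ENNReal.ofReal_mul zero_le_two]
    refine ENNReal.ofReal_le_ofReal ?_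
    push_cast
    nlinarith [sq_nonneg ((k : ℝ) - 2 * a)]
  have ha := ENNReal.mul_inv_cancel (weight_ne_zero a) (weight_ne_top a)
  have hb := ENNReal.mul_inv_cancel (weight_ne_zero (k - a)) (weight_ne_top (k - a))
  calc _ ≤ 2 * (weight a + weight (k - a)) * ((weight a)⁻¹ * (weight (k - a))⁻¹) := by gcongr
    _ = 2 * ((weight a * (weight a)⁻¹) * (weight (k - a))⁻¹ +
        (weight (k - a) * (weight (k - a))⁻¹) * (weight a)⁻¹) := by ring
    _ = _ := by rw [ha, hb]; ring

/-- The Cauchy–Schwarz inequality after inserting the square roots ρ of the weights: the factor with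
inverse weights is bounded uniformly in k, and the other one is a convolution whose total sum
factorizes. Extended nonnegative values make all rearrangements legitimate without summability. -/
theorem weightedSq_convolution_le (A B : ℤ → ENNReal) :
    weightedSq (fun k => ∑' a, A a * B (k - a)) ≤
      4 * (∑' k, (weight k)⁻¹) * (weightedSq A * weightedSq B) := by
  have hsq : ∀ k, (weight k ^ (1 / 2 : ℝ)) ^ 2 = weight k := fun k => by
    rw [← ENNReal.rpow_natCast, ← ENNReal.rpow_mul]
    norm_num
  set ρ : ℤ → ENNReal := fun k => weight k ^ (1 / 2 : ℝ) with hρ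
  have hρ0 : ∀ k, ρ k ≠ 0 := fun k => by
    intro h
    apply weight_ne_zero k
    rw [← hsq k]
    simp only [hρ] at h
    rw [h]
    simp
  have hρt : ∀ k, ρ k ≠ ⊤ := fun k => ENNReal.rpow_ne_top_of_nonneg (by norm_num) (weight_ne_top k)
  have key : ∀ k, weight k * (∑' a, A a * B (k - a)) ^ 2 ≤ 4 * (∑' k, (weight k)⁻¹) *
      ∑' a, (weight a * A a ^ 2) * (weight (k - a) * B (k - a) ^ 2) := by
    intro k
    have h1 : ∀ a, A a * B (k - a) =
        (ρ a * A a * (ρ (k - a) * B (k - a))) * ((ρ a)⁻¹ * (ρ (k - a))⁻¹) := fun a => by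
      calc A a * B (k - a) = (ρ a * (ρ a)⁻¹) * (ρ (k - a) * (ρ (k - a))⁻¹) *
            (A a * B (k - a)) := by
            rw [ENNReal.mul_inv_cancel (hρ0 _) (hρt _), ENNReal.mul_inv_cancel (hρ0 _) (hρt _)]
            simp
        _ = _ := by ring
    have h2 : ∀ a, (ρ a * A a * (ρ (k - a) * B (k - a))) ^ 2 =
        (weight a * A a ^ 2) * (weight (k - a) * B (k - a) ^ 2) := fun a => by
      rw [← hsq a, ← hsq (k - a)]
      ring
    have h3 : ∀ a, ((ρ a)⁻¹ * (ρ (k - a))⁻¹) ^ 2 = (weight a)⁻¹ * (weight (k - a))⁻¹ := fun a => by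
      rw [← hsq a, ← hsq (k - a), mul_pow, ENNReal.inv_pow, ENNReal.inv_pow]
    have h4 : weight k * ∑' a, (weight a)⁻¹ * (weight (k - a))⁻¹ ≤ 4 * ∑' k, (weight k)⁻¹ := by
      rw [← ENNReal.tsum_mul_left]
      calc _ ≤ ∑' a, 2 * ((weight a)⁻¹ + (weight (k - a))⁻¹) :=
            ENNReal.tsum_le_tsum fun a => weight_mul_inv_le k a
        _ = 2 * (∑' a, (weight a)⁻¹ + ∑' a, (weight (k - a))⁻¹) := by
            rw [ENNReal.tsum_mul_left, ENNReal.tsum_add]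
        _ = _ := by
            have := (Equiv.subLeft k).tsum_eq fun a => (weight a)⁻¹
            simp only [Equiv.subLeft_apply] at this
            rw [this]
            ring
    calc weight k * (∑' a, A a * B (k - a)) ^ 2
        ≤ weight k * ((∑' a, (weight a * A a ^ 2) * (weight (k - a) * B (k - a) ^ 2)) *
          ∑' a, (weight a)⁻¹ * (weight (k - a))⁻¹) := by
          refine mul_le_mul_right ?_ _
          rw [tsum_congr h1]
          refine (sq_tsum_mul_le _ _).trans (le_of_eq ?_)
          rw [tsum_congr h2, tsum_congr h3]
      _ = (weight k * ∑' a, (weight a)⁻¹ * (weight (k - a))⁻¹) *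
          ∑' a, (weight a * A a ^ 2) * (weight (k - a) * B (k - a) ^ 2) := by ring
      _ ≤ _ := by gcongr
  calc weightedSq (fun k => ∑' a, A a * B (k - a))
      ≤ ∑' k, 4 * (∑' k, (weight k)⁻¹) *
        ∑' a, (weight a * A a ^ 2) * (weight (k - a) * B (k - a) ^ 2) := ENNReal.tsum_le_tsum key
    _ = _ := by
      rw [ENNReal.tsum_mul_left, ENNReal.tsum_comm]
      congr 1
      rw [weightedSq, ← ENNReal.tsum_mul_right]
      refine tsum_congr fun a => ?_
      rw [ENNReal.tsum_mul_left]
      congr 1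
      exact (Equiv.subRight a).tsum_eq fun k => weight k * B k ^ 2

end Convolution

/-! ## The `H¹` norm -/

section SobolevNorm

variable {E : Type*} [NormedAddCommGroup E] [NormedSpace ℂ E]

theorem weight_mul_enorm_sq (f : ℝ → E) (k : ℤ) :
    weight k * ‖fourierCoeffUnit f k‖ₑ ^ 2 =
      ENNReal.ofReal ((1 + (k : ℝ) ^ 2) ^ (1 : ℝ) * ‖fourierCoeffUnit f k‖ ^ 2) := by
  rw [weight, ← ofReal_norm, ← ENNReal.ofReal_pow (norm_nonneg _),
    ← ENNReal.ofReal_mul (by positivity), Real.rpow_one]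

theorem sobolev_term_nonneg (f : ℝ → E) (k : ℤ) :
    0 ≤ (1 + (k : ℝ) ^ 2) ^ (1 : ℝ) * ‖fourierCoeffUnit f k‖ ^ 2 := by positivity

theorem summable_sobolev_iff (f : ℝ → E) :
    (Summable fun k : ℤ => (1 + (k : ℝ) ^ 2) ^ (1 : ℝ) * ‖fourierCoeffUnit f k‖ ^ 2) ↔
      weightedSq (fun k => ‖fourierCoeffUnit f k‖ₑ) ≠ ⊤ := by
  simp only [weightedSq, weight_mul_enorm_sq]
  refine ⟨fun h => h.tsum_ofReal_ne_top, fun h => ?_⟩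
  have := ENNReal.summable_toReal h
  simpa only [ENNReal.toReal_ofReal (sobolev_term_nonneg f _)] using this

theorem ofReal_sobolevNorm_sq {f : ℝ → E}
    (h : Summable fun k : ℤ => (1 + (k : ℝ) ^ 2) ^ (1 : ℝ) * ‖fourierCoeffUnit f k‖ ^ 2) :
    ENNReal.ofReal (sobolevNorm 1 f ^ 2) = weightedSq (fun k => ‖fourierCoeffUnit f k‖ₑ) := by
  rw [sobolevNorm, Real.sq_sqrt (tsum_nonneg (sobolev_term_nonneg f)),
    ENNReal.ofReal_tsum_of_nonneg (sobolev_term_nonneg f) h, weightedSq]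
  exact tsum_congr fun k => (weight_mul_enorm_sq f k).symm

theorem sobolevNorm_nonneg (f : ℝ → E) : 0 ≤ sobolevNorm 1 f := Real.sqrt_nonneg _

/-- Finiteness of the extended sum gives summability together with the norm bound. Without it the
real sum could be the default value 0 of a divergent series. -/
theorem sobolevNorm_le_of_weightedSq_le {f : ℝ → E} {M : ℝ} (hM : 0 ≤ M)
    (h : weightedSq (fun k => ‖fourierCoeffUnit f k‖ₑ) ≤ ENNReal.ofReal (M ^ 2)) :
    (Summable fun k : ℤ => (1 + (k : ℝ) ^ 2) ^ (1 : ℝ) * ‖fourierCoeffUnit f k‖ ^ 2) ∧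
      sobolevNorm 1 f ≤ M := by
  have hs := (summable_sobolev_iff f).2 (h.trans_lt ENNReal.ofReal_lt_top).ne
  refine ⟨hs, ?_⟩
  rw [← ofReal_sobolevNorm_sq hs, ENNReal.ofReal_le_ofReal_iff (sq_nonneg M)] at h
  exact (pow_le_pow_iff_left₀ (sobolevNorm_nonneg f) hM two_ne_zero).1 h

theorem MemSobolev.summable_norm {f : ℝ → ℂ} (hf : MemSobolev 1 f) :
    Summable fun k => ‖fourierCoeffUnit f k‖ := by
  refine Summable.of_nonneg_of_le (fun k => norm_nonneg _) (fun k => ?_)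
    (summable_inv_one_add_sq.add hf.summable)
  rw [Real.rpow_one]
  set t := 1 + (k : ℝ) ^ 2
  have ht : 0 < t := by positivity
  set y := ‖fourierCoeffOn (zero_lt_one (α := ℝ)) f k‖
  change y ≤ t⁻¹ + t * y ^ 2
  have h1 : t⁻¹ + t * y ^ 2 - y = t⁻¹ * ((1 - t * y / 2) ^ 2 + 3 / 4 * (t * y) ^ 2) := by
    field_simp
    ring
  have h2 : 0 ≤ t⁻¹ * ((1 - t * y / 2) ^ 2 + 3 / 4 * (t * y) ^ 2) := by positivity
  linarith

/-- The constant in the weighted convolution inequality. -/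
def convolutionConstant : ℝ := (4 * ∑' k, (weight k)⁻¹).toReal

theorem ofReal_convolutionConstant :
    ENNReal.ofReal convolutionConstant = 4 * ∑' k, (weight k)⁻¹ :=
  ENNReal.ofReal_toReal (ENNReal.mul_ne_top (by simp) tsum_inv_weight_ne_top)

theorem convolutionConstant_nonneg : 0 ≤ convolutionConstant := ENNReal.toReal_nonneg

/-- The convolution inequality in terms of the `H¹` norm. -/
theorem weightedSq_convolution_le_sobolevNorm {f g : ℝ → ℂ}
    (hf : Summable fun k : ℤ => (1 + (k : ℝ) ^ 2) ^ (1 : ℝ) * ‖fourierCoeffUnit f k‖ ^ 2)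
    (hg : Summable fun k : ℤ => (1 + (k : ℝ) ^ 2) ^ (1 : ℝ) * ‖fourierCoeffUnit g k‖ ^ 2) :
    weightedSq (fun k => ∑' a, ‖fourierCoeffUnit f a‖ₑ * ‖fourierCoeffUnit g (k - a)‖ₑ) ≤
      ENNReal.ofReal ((Real.sqrt convolutionConstant * sobolevNorm 1 f * sobolevNorm 1 g) ^ 2) := by
  refine (weightedSq_convolution_le (fun a => ‖fourierCoeffUnit f a‖ₑ)
    (fun a => ‖fourierCoeffUnit g a‖ₑ)).trans (le_of_eq ?_)
  rw [mul_pow, mul_pow, Real.sq_sqrt convolutionConstant_nonneg,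
    ENNReal.ofReal_mul (mul_nonneg convolutionConstant_nonneg (sq_nonneg _)),
    ENNReal.ofReal_mul convolutionConstant_nonneg, ofReal_convolutionConstant,
    ofReal_sobolevNorm_sq hf, ofReal_sobolevNorm_sq hg]
  ring

theorem enorm_le_tsum_of_hasSum {c : ℤ → ℂ} {s : ℂ} (h : HasSum c s) : ‖s‖ₑ ≤ ∑' a, ‖c a‖ₑ := by
  rw [← h.tsum_eq]
  by_cases hc : ∑' a, ‖c a‖ₑ = ⊤
  · rw [hc]; exact le_top
  · have hs : Summable fun a => ‖c a‖ := by
      have := ENNReal.summable_toReal hc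
      simpa using this
    have h1 := norm_tsum_le_tsum_norm hs
    rw [← ofReal_norm]
    refine (ENNReal.ofReal_le_ofReal h1).trans ?_
    rw [ENNReal.ofReal_tsum_of_nonneg (fun a => norm_nonneg _) hs]
    exact le_of_eq (tsum_congr fun a => ofReal_norm _)

theorem weightedSq_mono {A B : ℤ → ENNReal} (h : ∀ k, A k ≤ B k) : weightedSq A ≤ weightedSq B :=
  ENNReal.tsum_le_tsum fun k => mul_le_mul_right (pow_le_pow_left₀ (by simp) (h k) 2) _

theorem memSobolev_mul {f g : ℝ → ℂ} (hf : MemSobolev 1 f) (hg : MemSobolev 1 g) :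
    MemSobolev 1 (fun x => f x * g x) ∧ sobolevNorm 1 (fun x => f x * g x) ≤
      Real.sqrt convolutionConstant * sobolevNorm 1 f * sobolevNorm 1 g := by
  have hM : 0 ≤ Real.sqrt convolutionConstant * sobolevNorm 1 f * sobolevNorm 1 g := by
    have := sobolevNorm_nonneg f
    have := sobolevNorm_nonneg g
    positivity
  have h := sobolevNorm_le_of_weightedSq_le (f := fun x => f x * g x) hM
    ((weightedSq_mono fun k => (enorm_le_tsum_of_hasSum (fourierCoeffUnit_mul hf.memLp
      hf.summable_norm (intervalIntegrable_of_memLp hg.memLp) k)).trans (le_of_eq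
        (tsum_congr fun a => enorm_mul _ _))).trans
      (weightedSq_convolution_le_sobolevNorm hf.summable hg.summable))
  refine ⟨⟨fun x => by simp only [hf.periodic x, hg.periodic x], ?_, h.1⟩, h.2⟩
  -- An absolutely summable Fourier series bounds f almost everywhere, so the product is square
  -- integrable along with g.
  refine MemLp.of_le_mul (c := ∑' k, ‖fourierCoeffUnit f k‖) hg.memLp
    (hf.memLp.1.mul hg.memLp.1) ?_
  filter_upwards [ae_hasSum_fourier hf.memLp hf.summable_norm] with x hx
  rw [norm_mul]
  refine mul_le_mul_of_nonneg_right ?_ (norm_nonneg _)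
  rw [← hx.tsum_eq]
  have h1 : (fun k => ‖fourierCoeffUnit f k * character k x‖) =
      fun k => ‖fourierCoeffUnit f k‖ := funext fun k => by
    rw [norm_mul, norm_character, mul_one]
  refine (norm_tsum_le_tsum_norm (by rw [h1]; exact hf.summable_norm)).trans (le_of_eq ?_)
  rw [h1]

theorem exists_isAlgebraConstantH1 : ∃ C₁, IsAlgebraConstantH1 C₁ := by
  refine ⟨Real.sqrt convolutionConstant + 1, by positivity, fun f g hf hg => ?_⟩
  have h := memSobolev_mul hf hg
  have he : (fun x => ((f x * g x : ℝ) : ℂ)) = fun x => (f x : ℂ) * (g x : ℂ) :=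
    funext fun x => Complex.ofReal_mul _ _
  refine ⟨by rw [ScalarMemH1, he]; exact h.1, ?_⟩
  rw [scalarNormH1, he]
  refine h.2.trans ?_
  have := sobolevNorm_nonneg fun x => (f x : ℂ)
  have := sobolevNorm_nonneg fun x => (g x : ℂ)
  simp only [scalarNormH1]
  gcongr
  linarith

end SobolevNorm

/-! ## Smooth periodic functions -/

section Smooth

theorem fourierCoeffUnit_deriv {f : ℝ → ℂ} (hf : ContDiff ℝ ∞ f) (hp : Function.Periodic f 1)
    (k : ℤ) : fourierCoeffUnit (deriv f) k = 2 * Real.pi * Complex.I * k * fourierCoeffUnit f k := by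
  rw [fourierCoeffUnit_eq, fourierCoeffUnit_eq]
  have hd : ∀ x ∈ uIcc (0 : ℝ) 1, HasDerivAt f (deriv f x) x := fun x _ =>
    (hf.differentiable (by simp) x).hasDerivAt
  have hc : ∀ x ∈ uIcc (0 : ℝ) 1, HasDerivAt (character (-k))
      (2 * Real.pi * Complex.I * ((-k : ℤ) : ℂ) * character (-k) x) x := fun x _ => by
    have h1 : HasDerivAt (fun x : ℝ => 2 * Real.pi * Complex.I * ((-k : ℤ) : ℂ) * (x : ℂ))
        (2 * Real.pi * Complex.I * ((-k : ℤ) : ℂ)) x := by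
      simpa using (Complex.ofRealCLM.hasDerivAt (x := x)).const_mul
        (2 * Real.pi * Complex.I * ((-k : ℤ) : ℂ))
    exact h1.cexp.congr_deriv (mul_comm _ _)
  have h := intervalIntegral.integral_mul_deriv_eq_deriv_mul hc hd
    (Continuous.intervalIntegrable (continuous_const.mul (continuous_character _)) _ _)
    ((hf.continuous_deriv (by simp)).intervalIntegrable _ _)
  simp only [smul_eq_mul]
  have h01 : f 1 = f 0 := by simpa using hp 0
  have hc0 : character (-k) 0 = 1 := by simp [character]
  rw [h, h01, character_one_right, hc0, sub_self, zero_sub]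
  simp only [mul_assoc, intervalIntegral.integral_const_mul]
  push_cast
  ring

theorem periodic_deriv {E : Type*} [NormedAddCommGroup E] [NormedSpace ℝ E] {f : ℝ → E}
    (hp : Function.Periodic f 1) : Function.Periodic (deriv f) 1 := fun x => by
  rw [← deriv_comp_add_const f 1 x]
  congr 1
  exact funext hp

theorem periodic_iteratedDeriv {E : Type*} [NormedAddCommGroup E] [NormedSpace ℝ E] {f : ℝ → E}
    (hp : Function.Periodic f 1) (l : ℕ) : Function.Periodic (iteratedDeriv l f) 1 := by
  induction l with
  | zero => simpa using hp
  | succ l ih => rw [iteratedDeriv_succ]; exact periodic_deriv ih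

/-- Parseval's identity for the `H¹` norm. -/
theorem hasSum_sobolev {f : ℝ → ℂ} (hf : ContDiff ℝ ∞ f) (hp : Function.Periodic f 1) :
    HasSum (fun k : ℤ => (1 + (k : ℝ) ^ 2) ^ (1 : ℝ) * ‖fourierCoeffUnit f k‖ ^ 2)
      ((∫ x in (0 : ℝ)..1, ‖f x‖ ^ 2) +
        (4 * Real.pi ^ 2)⁻¹ * ∫ x in (0 : ℝ)..1, ‖deriv f x‖ ^ 2) := by
  have h1 := hasSum_sq_fourierCoeffOn (zero_lt_one (α := ℝ)) (memLp_of_continuous hf.continuous 2)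
  have h2 := hasSum_sq_fourierCoeffOn (zero_lt_one (α := ℝ))
    (memLp_of_continuous (hf.continuous_deriv (by simp)) 2)
  simp only [sub_zero, inv_one, one_smul] at h1 h2
  have h3 := h1.add (h2.mul_left (4 * Real.pi ^ 2)⁻¹)
  convert! h3 using 1
  funext k
  have h4 := fourierCoeffUnit_deriv hf hp k
  simp only [fourierCoeffUnit] at h4 ⊢
  rw [h4, Real.rpow_one]
  have h5 : ‖(2 * Real.pi * Complex.I * k : ℂ)‖ ^ 2 = 4 * Real.pi ^ 2 * (k : ℝ) ^ 2 := by
    simp only [norm_mul, Complex.norm_I, Complex.norm_real, Complex.norm_intCast, mul_pow,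
      Real.norm_eq_abs, sq_abs]
    norm_num
  rw [norm_mul, mul_pow, h5]
  have := Real.pi_pos
  field_simp

theorem memSobolev_of_contDiff {f : ℝ → ℂ} (hf : ContDiff ℝ ∞ f) (hp : Function.Periodic f 1) :
    MemSobolev 1 f :=
  ⟨hp, memLp_of_continuous hf.continuous 2, (hasSum_sobolev hf hp).summable⟩

theorem contDiff_ofReal {u : ℝ → ℝ} (hu : ContDiff ℝ ∞ u) : ContDiff ℝ ∞ fun x => (u x : ℂ) :=
  Complex.ofRealCLM.contDiff.comp hu

theorem deriv_ofReal {u : ℝ → ℝ} (hu : ContDiff ℝ ∞ u) :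
    deriv (fun x => (u x : ℂ)) = fun x => ((deriv u x : ℝ) : ℂ) :=
  funext fun x => ((hu.differentiable (by simp) x).hasDerivAt.ofReal_comp).deriv

theorem iteratedDeriv_ofReal {u : ℝ → ℝ} (hu : ContDiff ℝ ∞ u) (l : ℕ) :
    iteratedDeriv l (fun x => (u x : ℂ)) = fun x => ((iteratedDeriv l u x : ℝ) : ℂ) := by
  induction l with
  | zero => simp
  | succ l ih =>
    rw [iteratedDeriv_succ, ih, deriv_ofReal (contDiff_iteratedDeriv hu l), iteratedDeriv_succ]

variable {u : ℝ → ℝ}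

theorem periodic_ofReal (hp : Function.Periodic u 1) : Function.Periodic (fun x => (u x : ℂ)) 1 :=
  fun x => by simp only [hp x]

theorem scalarNormH1_sq (hu : ContDiff ℝ ∞ u) (hp : Function.Periodic u 1) :
    scalarNormH1 u ^ 2 = (∫ x in (0 : ℝ)..1, u x ^ 2) +
        (4 * Real.pi ^ 2)⁻¹ * ∫ x in (0 : ℝ)..1, deriv u x ^ 2 := by
  have h := hasSum_sobolev (contDiff_ofReal hu) (periodic_ofReal hp)
  rw [scalarNormH1, sobolevNorm, Real.sq_sqrt (tsum_nonneg (sobolev_term_nonneg _)), h.tsum_eq]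
  simp only [deriv_ofReal hu, Complex.norm_real, Real.norm_eq_abs, sq_abs]

theorem scalarNormH1_nonneg (u : ℝ → ℝ) : 0 ≤ scalarNormH1 u := Real.sqrt_nonneg _

theorem H1Bound.scalarNormH1_le (hu : ContDiff ℝ ∞ u) (hp : Function.Periodic u 1) {M : ℝ}
    (h : H1Bound u M) : scalarNormH1 u ≤ 2 * M := by
  have hM := h.nonneg
  refine (pow_le_pow_iff_left₀ (scalarNormH1_nonneg u) (by positivity) two_ne_zero).1 ?_
  rw [scalarNormH1_sq hu hp]
  have h1 : ∫ x in (0 : ℝ)..1, u x ^ 2 ≤ ∫ _ in (0 : ℝ)..1, M ^ 2 := by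
    refine intervalIntegral.integral_mono_on zero_le_one
      ((hu.continuous.pow 2).intervalIntegrable _ _) intervalIntegrable_const fun x _ => ?_
    exact sq_le_sq.2 ((h.abs_le x).trans (le_abs_self M))
  have h2 := h.energy_le
  have h3 : (4 * Real.pi ^ 2)⁻¹ ≤ 1 := by
    rw [inv_le_one_iff₀]
    right
    nlinarith [Real.pi_gt_three]
  have h4 : 0 ≤ ∫ x in (0 : ℝ)..1, deriv u x ^ 2 :=
    intervalIntegral.integral_nonneg zero_le_one fun x _ => sq_nonneg _
  have h5 := mul_le_of_le_one_left h4 h3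
  simp only [intervalIntegral.integral_const, sub_zero, one_smul] at h1
  nlinarith [sq_nonneg M]

/-- The Sobolev inequality in dimension one: u(y)² - u(z)² is the integral of 2 u u' ≤ u² + u'², and
averaging over z in a period replaces u(z)² by its integral. -/
theorem sq_le_of_periodic (hu : ContDiff ℝ ∞ u) (hp : Function.Periodic u 1) (x : ℝ) :
    u x ^ 2 ≤ 2 * (∫ x in (0 : ℝ)..1, u x ^ 2) + ∫ x in (0 : ℝ)..1, deriv u x ^ 2 := by
  have hc := hu.continuous
  have hdc := continuous_deriv_of_smooth hu
  obtain ⟨y, hy, hxy⟩ := hp.exists_mem_Ico₀ one_pos x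
  rw [hxy]
  set I := ∫ x in (0 : ℝ)..1, (u x ^ 2 + deriv u x ^ 2) with hI
  have key : ∀ z ∈ Icc (0 : ℝ) 1, u y ^ 2 ≤ u z ^ 2 + I := by
    intro z hz
    have h1 : ∫ t in z..y, 2 * (u t * deriv u t) = u y ^ 2 - u z ^ 2 := by
      refine intervalIntegral.integral_eq_sub_of_hasDerivAt (f := fun t => u t ^ 2) (fun t _ => ?_)
        (Continuous.intervalIntegrable (by fun_prop) _ _)
      exact ((differentiable_of_smooth hu t).hasDerivAt.fun_pow 2).congr_deriv (by simp; ring)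
    have h2 : |∫ t in z..y, 2 * (u t * deriv u t)| ≤ |∫ t in z..y, (u t ^ 2 + deriv u t ^ 2)| := by
      refine intervalIntegral.norm_integral_le_abs_of_norm_le
        (μ := volume) (f := fun t => 2 * (u t * deriv u t)) (g := fun t => u t ^ 2 + deriv u t ^ 2) (Eventually.of_forall fun t => ?_)
        (Continuous.intervalIntegrable (by fun_prop) _ _)
      rw [Real.norm_eq_abs, abs_le]
      constructor <;> nlinarith [sq_nonneg (u t + deriv u t), sq_nonneg (u t - deriv u t)]
    have h3 : |∫ t in z..y, (u t ^ 2 + deriv u t ^ 2)| ≤ |I| := by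
      refine intervalIntegral.abs_integral_mono_interval ?_ (Eventually.of_forall fun t => ?_)
        (Continuous.intervalIntegrable (by fun_prop) _ _)
      · rw [uIoc_of_le zero_le_one]
        rcases le_total z y with h | h
        · rw [uIoc_of_le h]; exact Ioc_subset_Ioc hz.1 hy.2.le
        · rw [uIoc_of_ge h]; exact Ioc_subset_Ioc hy.1 hz.2
      · simp only [Pi.zero_apply]; positivity
    have hI0 : 0 ≤ I := intervalIntegral.integral_nonneg zero_le_one fun t _ => by positivity
    rw [abs_of_nonneg hI0] at h3
    have := (le_abs_self _).trans (h2.trans h3)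
    linarith
  have h4 := intervalIntegral.integral_mono_on (μ := volume) zero_le_one
    (intervalIntegrable_const (c := u y ^ 2))
    (Continuous.intervalIntegrable (by fun_prop : Continuous fun z => u z ^ 2 + I) _ _) key
  rw [intervalIntegral.integral_add (Continuous.intervalIntegrable (by fun_prop) _ _)
    (Continuous.intervalIntegrable (by fun_prop) _ _)] at h4
  simp only [intervalIntegral.integral_const, sub_zero, one_smul] at h4
  rw [intervalIntegral.integral_add (Continuous.intervalIntegrable (by fun_prop) _ _)
    (Continuous.intervalIntegrable (by fun_prop) _ _)] at hI
  linarith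

/-- By 4 π² ≤ 40 the integral of u'² is at most 40 times the squared H¹ norm, and the Sobolev
inequality then gives u² ≤ 42 times it; 7² = 49 covers both. -/
theorem h1Bound_scalarNormH1 (hu : ContDiff ℝ ∞ u) (hp : Function.Periodic u 1) :
    H1Bound u (7 * scalarNormH1 u) := by
  have h := scalarNormH1_sq hu hp
  have h0 : 0 ≤ ∫ x in (0 : ℝ)..1, u x ^ 2 :=
    intervalIntegral.integral_nonneg zero_le_one fun x _ => sq_nonneg _
  have h1 : 0 ≤ ∫ x in (0 : ℝ)..1, deriv u x ^ 2 :=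
    intervalIntegral.integral_nonneg zero_le_one fun x _ => sq_nonneg _
  have hpi : 4 * Real.pi ^ 2 ≤ 40 := by nlinarith [Real.pi_lt_d2, Real.pi_pos]
  have hpi0 : 0 < 4 * Real.pi ^ 2 := by positivity
  have h2 : ∫ x in (0 : ℝ)..1, deriv u x ^ 2 ≤ 40 * scalarNormH1 u ^ 2 := by
    have h3 : ∫ x in (0 : ℝ)..1, deriv u x ^ 2 =
        4 * Real.pi ^ 2 * ((4 * Real.pi ^ 2)⁻¹ * ∫ x in (0 : ℝ)..1, deriv u x ^ 2) := by
      field_simp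
    have h4 : 0 ≤ (4 * Real.pi ^ 2)⁻¹ * ∫ x in (0 : ℝ)..1, deriv u x ^ 2 := by positivity
    rw [h3]
    exact mul_le_mul hpi (by linarith) h4 (by norm_num)
  have h5 : 0 ≤ (4 * Real.pi ^ 2)⁻¹ * ∫ x in (0 : ℝ)..1, deriv u x ^ 2 := by positivity
  refine ⟨fun x => ?_, by nlinarith [sq_nonneg (scalarNormH1 u)]⟩
  refine abs_le_of_sq_le_sq ?_ (by have := scalarNormH1_nonneg u; positivity)
  have := sq_le_of_periodic hu hp x
  nlinarith [sq_nonneg (scalarNormH1 u)]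

end Smooth

/-! ## Vector-valued functions -/

section Vector

variable {n : ℕ} {f : ℝ → EuclideanSpace ℝ (Fin n)}

theorem contDiff_coord (hf : ContDiff ℝ ∞ f) (i : Fin n) : ContDiff ℝ ∞ fun x => f x i :=
  (contDiff_euclidean.1 hf) i

theorem iteratedDeriv_coord (hf : ContDiff ℝ ∞ f) (l : ℕ) (i : Fin n) :
    iteratedDeriv l (fun x => f x i) = fun x => iteratedDeriv l f x i := by
  induction l generalizing f with
  | zero => simp
  | succ l ih =>
    have h1 : deriv (fun x => f x i) = fun x => deriv f x i := funext fun x =>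
      (((EuclideanSpace.proj i : EuclideanSpace ℝ (Fin n) →L[ℝ] ℝ).hasFDerivAt).comp_hasDerivAt x
        (hf.differentiable (by simp) x).hasDerivAt).deriv
    rw [iteratedDeriv_succ', h1, ih (contDiff_infty_iff_deriv.1 hf).2, iteratedDeriv_succ']

theorem periodic_coord (hp : Function.Periodic f 1) (i : Fin n) :
    Function.Periodic (fun x => f x i) 1 := fun x => by simp only [hp x]

theorem contDiff_complexify (hf : ContDiff ℝ ∞ f) : ContDiff ℝ ∞ fun x => complexify (f x) := by
  have h : ContDiff ℝ ∞ fun x => fun i => ((f x i : ℝ) : ℂ) :=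
    contDiff_pi.2 fun i => contDiff_ofReal (contDiff_coord hf i)
  exact ((PiLp.continuousLinearEquiv 2 ℝ (fun _ : Fin n => ℂ)).symm.contDiff).comp h

theorem fourierCoeffUnit_complexify (hf : ContDiff ℝ ∞ f) (k : ℤ) (i : Fin n) :
    fourierCoeffUnit (fun x => complexify (f x)) k i =
      fourierCoeffUnit (fun x => ((f x i : ℝ) : ℂ)) k := by
  rw [fourierCoeffUnit_eq, fourierCoeffUnit_eq]
  have hint : IntervalIntegrable (fun x => character (-k) x • complexify (f x)) volume 0 1 :=
    Continuous.intervalIntegrable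
      ((continuous_character _).smul (contDiff_complexify hf).continuous) _ _
  have := (EuclideanSpace.proj i : EuclideanSpace ℂ (Fin n) →L[ℂ] ℂ).intervalIntegral_comp_comm hint
  exact this.symm

theorem hasSum_sobolev_complexify (hf : ContDiff ℝ ∞ f) (hp : Function.Periodic f 1) :
    HasSum (fun k : ℤ => (1 + (k : ℝ) ^ 2) ^ (1 : ℝ) *
      ‖fourierCoeffUnit (fun x => complexify (f x)) k‖ ^ 2)
      (∑ i, scalarNormH1 (fun x => f x i) ^ 2) := by
  have h1 : ∀ i ∈ Finset.univ, HasSum (fun k : ℤ => (1 + (k : ℝ) ^ 2) ^ (1 : ℝ) *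
      ‖fourierCoeffUnit (fun x => ((f x i : ℝ) : ℂ)) k‖ ^ 2) (scalarNormH1 (fun x => f x i) ^ 2) := by
    intro i _
    have h := hasSum_sobolev (contDiff_ofReal (contDiff_coord hf i))
      (periodic_ofReal (periodic_coord hp i))
    rwa [← h.tsum_eq, ← Real.sq_sqrt (tsum_nonneg (sobolev_term_nonneg _))] at h
  convert! hasSum_sum h1 using 1
  funext k
  rw [EuclideanSpace.norm_sq_eq, Finset.mul_sum]
  simp only [fourierCoeffUnit_complexify hf]

theorem memH1_of_contDiff (hf : ContDiff ℝ ∞ f) (hp : Function.Periodic f 1) : MemH1 f :=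
  ⟨fun x => by simp only [hp x], memLp_of_continuous (contDiff_complexify hf).continuous 2,
    (hasSum_sobolev_complexify hf hp).summable⟩

theorem normH1_sq (hf : ContDiff ℝ ∞ f) (hp : Function.Periodic f 1) :
    normH1 f ^ 2 = ∑ i, scalarNormH1 (fun x => f x i) ^ 2 := by
  rw [normH1, sobolevNorm, Real.sq_sqrt (tsum_nonneg (sobolev_term_nonneg _)),
    (hasSum_sobolev_complexify hf hp).tsum_eq]

theorem normH1_nonneg (f : ℝ → EuclideanSpace ℝ (Fin n)) : 0 ≤ normH1 f := Real.sqrt_nonneg _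

theorem scalarNormH1_coord_le (hf : ContDiff ℝ ∞ f) (hp : Function.Periodic f 1) (i : Fin n) :
    scalarNormH1 (fun x => f x i) ≤ normH1 f := by
  refine (pow_le_pow_iff_left₀ (scalarNormH1_nonneg _) (normH1_nonneg f) two_ne_zero).1 ?_
  rw [normH1_sq hf hp]
  exact Finset.single_le_sum (f := fun i => scalarNormH1 (fun x => f x i) ^ 2)
    (fun _ _ => sq_nonneg _) (Finset.mem_univ i)

theorem normH1_le_sum (hf : ContDiff ℝ ∞ f) (hp : Function.Periodic f 1) :
    normH1 f ≤ ∑ i, scalarNormH1 (fun x => f x i) := by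
  have h0 : ∀ i ∈ Finset.univ, 0 ≤ scalarNormH1 (fun x => f x i) := fun i _ => scalarNormH1_nonneg _
  refine (pow_le_pow_iff_left₀ (normH1_nonneg f) (Finset.sum_nonneg h0) two_ne_zero).1 ?_
  rw [normH1_sq hf hp]
  rw [sq, Finset.sum_mul]
  refine Finset.sum_le_sum fun i hi => ?_
  rw [sq]
  exact mul_le_mul_of_nonneg_left (Finset.single_le_sum h0 hi) (h0 i hi)

end Vector

/-! ## Difference quotients of an arc-length parametrized curve -/

/-- The family of translates of a function. -/
def translates (g : ℝ → ℝ) (p : ℝ × ℝ) : ℝ := g (p.1 + p.2)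

theorem contDiff_translates {g : ℝ → ℝ} (hg : ContDiff ℝ ∞ g) : ContDiff ℝ ∞ (translates g) :=
  hg.comp (by fun_prop)

/-- The fundamental theorem of calculus. The average of g' is the smooth extension of the difference
quotient across w = 0. -/
theorem mul_average_translates_deriv {g : ℝ → ℝ} (hg : ContDiff ℝ ∞ g) (x w : ℝ) :
    w * average (fun _ => 1) (translates (deriv g)) (x, w) = g (x + w) - g x := by
  have h : ∀ s ∈ uIcc (0 : ℝ) 1,
      HasDerivAt (fun s => g (x + s * w)) (deriv g (x + s * w) * w) s := fun s _ =>
    HasDerivAt.comp (h₂ := g) s (hg.differentiable (by simp) (x + s * w)).hasDerivAt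
      ((hasDerivAt_mul_const w).const_add x)
  have hc := continuous_deriv_of_smooth hg
  have h2 := intervalIntegral.integral_eq_sub_of_hasDerivAt h (Continuous.intervalIntegrable
    (by fun_prop) _ _)
  rw [intervalIntegral.integral_mul_const] at h2
  simp only [one_mul, zero_mul, add_zero] at h2
  simp only [average, translates, one_mul]
  linarith

section Curve

variable {n : ℕ} (γ : ℝ → EuclideanSpace ℝ (Fin n))

/-- The coordinates of `γ'`. -/
def velocity (i : Fin n) (x : ℝ) : ℝ := deriv γ x i

/-- The coordinates of `γ''`. -/
def acceleration (i : Fin n) (x : ℝ) : ℝ := iteratedDeriv 2 γ x i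

/-- The coordinates of `(γ (x + w) - γ x) / w`. -/
def chordQuotient (i : Fin n) : ℝ × ℝ → ℝ :=
  average (fun _ => 1) (translates (velocity γ i))

/-- The coordinates of `(γ' (x + w) - γ' x) / w`. -/
def velocityQuotient (i : Fin n) : ℝ × ℝ → ℝ :=
  average (fun _ => 1) (translates (acceleration γ i))

/-- The coordinates of `(γ (x + w) - γ x - w γ' x) / w ^ 2`. -/
def taylorQuotient (i : Fin n) : ℝ × ℝ → ℝ :=
  average (fun s => s) (velocityQuotient γ i)

/-- The squared length of `(γ' (x + w) - γ' x) / w`. -/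
def velocityQuotientSq (p : ℝ × ℝ) : ℝ :=
  ∑ i, velocityQuotient γ i p * velocityQuotient γ i p

/-- The squared length of `(γ (x + w) - γ x) / w`. -/
def chordQuotientSq (p : ℝ × ℝ) : ℝ :=
  ∑ i, chordQuotient γ i p * chordQuotient γ i p

/-- The quotient `(1 - |(γ (x + w) - γ x) / w| ^ 2) / w ^ 2`. -/
def chordDefect (p : ℝ × ℝ) : ℝ :=
  average (fun s => s ^ 2) (velocityQuotientSq γ) p -
    ∑ i, taylorQuotient γ i p * taylorQuotient γ i p

variable {γ}

theorem contDiff_velocity (hγ : ContDiff ℝ ∞ γ) (i : Fin n) : ContDiff ℝ ∞ (velocity γ i) :=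
  contDiff_coord (contDiff_infty_iff_deriv.1 hγ).2 i

theorem deriv_coord (hγ : ContDiff ℝ ∞ γ) (i : Fin n) :
    deriv (fun x => γ x i) = velocity γ i := by
  have := iteratedDeriv_coord hγ 1 i
  simp only [iteratedDeriv_one] at this
  exact this

theorem deriv_velocity (hγ : ContDiff ℝ ∞ γ) (i : Fin n) :
    deriv (velocity γ i) = acceleration γ i := by
  have := iteratedDeriv_coord hγ 2 i
  rw [iteratedDeriv_succ', iteratedDeriv_one, deriv_coord hγ] at this
  exact this

theorem contDiff_acceleration (hγ : ContDiff ℝ ∞ γ) (i : Fin n) :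
    ContDiff ℝ ∞ (acceleration γ i) := by
  rw [← deriv_velocity hγ]
  exact (contDiff_infty_iff_deriv.1 (contDiff_velocity hγ i)).2

theorem contDiff_chordQuotient (hγ : ContDiff ℝ ∞ γ) (i : Fin n) :
    ContDiff ℝ ∞ (chordQuotient γ i) :=
  contDiff_average contDiff_const (contDiff_translates (contDiff_velocity hγ i))

theorem contDiff_velocityQuotient (hγ : ContDiff ℝ ∞ γ) (i : Fin n) :
    ContDiff ℝ ∞ (velocityQuotient γ i) :=
  contDiff_average contDiff_const (contDiff_translates (contDiff_acceleration hγ i))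

theorem contDiff_taylorQuotient (hγ : ContDiff ℝ ∞ γ) (i : Fin n) :
    ContDiff ℝ ∞ (taylorQuotient γ i) :=
  contDiff_average contDiff_id (contDiff_velocityQuotient hγ i)

theorem contDiff_velocityQuotientSq (hγ : ContDiff ℝ ∞ γ) :
    ContDiff ℝ ∞ (velocityQuotientSq γ) :=
  ContDiff.sum fun i _ => (contDiff_velocityQuotient hγ i).mul (contDiff_velocityQuotient hγ i)

theorem contDiff_chordQuotientSq (hγ : ContDiff ℝ ∞ γ) : ContDiff ℝ ∞ (chordQuotientSq γ) :=
  ContDiff.sum fun i _ => (contDiff_chordQuotient hγ i).mul (contDiff_chordQuotient hγ i)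

theorem mul_chordQuotient (hγ : ContDiff ℝ ∞ γ) (i : Fin n) (x w : ℝ) :
    w * chordQuotient γ i (x, w) = γ (x + w) i - γ x i := by
  have := mul_average_translates_deriv (contDiff_coord hγ i) x w
  rwa [deriv_coord hγ] at this

theorem mul_velocityQuotient (hγ : ContDiff ℝ ∞ γ) (i : Fin n) (x w : ℝ) :
    w * velocityQuotient γ i (x, w) = velocity γ i (x + w) - velocity γ i x := by
  have := mul_average_translates_deriv (contDiff_velocity hγ i) x w
  rwa [deriv_velocity hγ] at this

theorem chordQuotient_eq (hγ : ContDiff ℝ ∞ γ) (i : Fin n) (x w : ℝ) :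
    chordQuotient γ i (x, w) = velocity γ i x + w * taylorQuotient γ i (x, w) := by
  have hv := (contDiff_velocityQuotient hγ i).continuous
  have h : ∀ s : ℝ, 1 * translates (velocity γ i) (x, s * w) =
      velocity γ i x + w * (s * velocityQuotient γ i (x, s * w)) := fun s => by
    have := mul_velocityQuotient hγ i x (s * w)
    simp only [translates]
    linarith
  simp only [chordQuotient, taylorQuotient, average] at h ⊢
  simp only [h]
  rw [intervalIntegral.integral_add intervalIntegrable_const
    (Continuous.intervalIntegrable (by fun_prop) _ _), intervalIntegral.integral_const_mul]
  simp

theorem sq_mul_taylorQuotient (hγ : ContDiff ℝ ∞ γ) (i : Fin n) (x w : ℝ) :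
    w ^ 2 * taylorQuotient γ i (x, w) = γ (x + w) i - γ x i - w * velocity γ i x := by
  rw [← mul_chordQuotient hγ, chordQuotient_eq hγ]
  ring

theorem sum_velocity_sq (hγ : IsSmoothArclengthKnot γ) (x : ℝ) :
    ∑ i, velocity γ i x * velocity γ i x = 1 := by
  have h := EuclideanSpace.real_norm_sq_eq (deriv γ x)
  rw [hγ.arclength, one_pow] at h
  rw [h]
  exact Finset.sum_congr rfl fun i _ => (sq _).symm

theorem sum_velocity_mul_acceleration (hγ : IsSmoothArclengthKnot γ) (x : ℝ) :
    ∑ i, velocity γ i x * acceleration γ i x = 0 := by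
  have h1 : HasDerivAt (fun x => ∑ i, velocity γ i x * velocity γ i x)
      (∑ i, (acceleration γ i x * velocity γ i x + velocity γ i x * acceleration γ i x)) x := by
    refine HasDerivAt.fun_sum fun i _ => ?_
    have h := ((contDiff_velocity hγ.smooth i).differentiable (by simp) x).hasDerivAt
    rw [deriv_velocity hγ.smooth] at h
    exact h.mul h
  simp only [sum_velocity_sq hγ] at h1
  have h2 := h1.unique (hasDerivAt_const x (1 : ℝ))
  rw [Finset.sum_add_distrib] at h2
  simp only [mul_comm (acceleration γ _ x)] at h2
  linarith

/-- Expanding |γ' (x + w)|² = 1 = |γ' x|² shows that the tangential component of the increment of γ'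
is quadratic in the increment, which gains the factor w. -/
theorem sum_velocity_mul_velocityQuotient (hγ : IsSmoothArclengthKnot γ) (x w : ℝ) :
    ∑ i, velocity γ i x * velocityQuotient γ i (x, w) =
      -(1 / 2) * w * velocityQuotientSq γ (x, w) := by
  rcases eq_or_ne w 0 with rfl | hw
  -- At w = 0, where the expansion cannot be divided by w, the claim is the orthogonality of γ' and
  -- γ''.
  · have h : ∀ i, velocityQuotient γ i (x, 0) = acceleration γ i x := fun i => by
      simp [velocityQuotient, average, translates]
    simp only [h, sum_velocity_mul_acceleration hγ]
    simp
  · have h1 := sum_velocity_sq hγ x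
    have h2 := sum_velocity_sq hγ (x + w)
    have h3 : ∀ i, velocity γ i (x + w) = velocity γ i x + w * velocityQuotient γ i (x, w) :=
      fun i => by rw [mul_velocityQuotient hγ.smooth]; ring
    have h4 : ∑ i, velocity γ i (x + w) * velocity γ i (x + w) =
        ∑ i, velocity γ i x * velocity γ i x +
          2 * w * ∑ i, velocity γ i x * velocityQuotient γ i (x, w) +
          w ^ 2 * velocityQuotientSq γ (x, w) := by
      rw [velocityQuotientSq, Finset.mul_sum, Finset.mul_sum, ← Finset.sum_add_distrib,
        ← Finset.sum_add_distrib]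
      refine Finset.sum_congr rfl fun i _ => ?_
      rw [h3]
      ring
    rw [h1, h2] at h4
    apply mul_left_cancel₀ (mul_ne_zero two_ne_zero hw)
    linear_combination -h4

theorem sum_velocity_mul_taylorQuotient (hγ : IsSmoothArclengthKnot γ) (x w : ℝ) :
    ∑ i, velocity γ i x * taylorQuotient γ i (x, w) =
      -(1 / 2) * w * average (fun s => s ^ 2) (velocityQuotientSq γ) (x, w) := by
  have hv := fun i => (contDiff_velocityQuotient hγ.smooth i).continuous
  have hs := (contDiff_velocityQuotientSq hγ.smooth).continuous
  simp only [taylorQuotient, average, ← intervalIntegral.integral_const_mul]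
  rw [← intervalIntegral.integral_finsetSum fun i _ =>
    Continuous.intervalIntegrable (by have := hv i; fun_prop) _ _]
  refine intervalIntegral.integral_congr fun s _ => ?_
  have h := sum_velocity_mul_velocityQuotient hγ x (s * w)
  calc _ = s * ∑ i, velocity γ i x * velocityQuotient γ i (x, s * w) := by
        rw [Finset.mul_sum]
        exact Finset.sum_congr rfl fun i _ => by ring
    _ = _ := by rw [h]; ring

/-- The chord quotient is γ' + w τ with τ the Taylor quotient. Its square is 1 up to order w²,
because the cross term 2 w ⟨γ', τ⟩ is itself of second order by arc length. -/
theorem chordQuotientSq_eq (hγ : IsSmoothArclengthKnot γ) (x w : ℝ) :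
    chordQuotientSq γ (x, w) = 1 - w ^ 2 * chordDefect γ (x, w) := by
  have h1 := sum_velocity_sq hγ x
  have h2 := sum_velocity_mul_taylorQuotient hγ x w
  have h3 : chordQuotientSq γ (x, w) = ∑ i, velocity γ i x * velocity γ i x +
      2 * w * ∑ i, velocity γ i x * taylorQuotient γ i (x, w) +
      w ^ 2 * ∑ i, taylorQuotient γ i (x, w) * taylorQuotient γ i (x, w) := by
    rw [chordQuotientSq, Finset.mul_sum, Finset.mul_sum, ← Finset.sum_add_distrib,
      ← Finset.sum_add_distrib]
    refine Finset.sum_congr rfl fun i _ => ?_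
    rw [chordQuotient_eq hγ.smooth]
    ring
  rw [h3, h1, h2, chordDefect]
  ring

theorem norm_chord_sq (hγ : ContDiff ℝ ∞ γ) (x w : ℝ) :
    ‖γ (x + w) - γ x‖ ^ 2 = w ^ 2 * chordQuotientSq γ (x, w) := by
  rw [EuclideanSpace.real_norm_sq_eq, chordQuotientSq, Finset.mul_sum]
  refine Finset.sum_congr rfl fun i _ => ?_
  rw [PiLp.sub_apply, ← mul_chordQuotient hγ]
  ring

theorem injective_of_abs_lt_one (hγ : IsSmoothArclengthKnot γ) {x w : ℝ} (hw : w ≠ 0)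
    (hw1 : |w| < 1) : γ (x + w) ≠ γ x := by
  intro h
  have h1 : ∀ y, γ y = γ (Int.fract y) := fun y => by
    have := hγ.periodic.sub_int_mul_eq ⌊y⌋ (x := y)
    rw [mul_one] at this
    exact this.symm
  rw [h1 (x + w), h1 x] at h
  have h2 := hγ.injOn ⟨Int.fract_nonneg _, Int.fract_lt_one _⟩
    ⟨Int.fract_nonneg _, Int.fract_lt_one _⟩ h
  obtain ⟨z, hz⟩ := Int.fract_eq_fract.1 h2
  rw [add_sub_cancel_left] at hz
  rw [hz] at hw hw1
  have hz0 : z ≠ 0 := by exact_mod_cast hw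
  have : |z| < 1 := by exact_mod_cast hw1
  exact hz0 (Int.abs_lt_one_iff.1 this)

theorem chordQuotientSq_pos (hγ : IsSmoothArclengthKnot γ) (x : ℝ) {w : ℝ} (hw : |w| ≤ 1 / 2) :
    0 < chordQuotientSq γ (x, w) := by
  rcases eq_or_ne w 0 with rfl | hw0
  · rw [chordQuotientSq_eq hγ]
    norm_num
  · have h1 := norm_chord_sq hγ.smooth x w
    have h2 : 0 < ‖γ (x + w) - γ x‖ :=
      norm_pos_iff.2 (sub_ne_zero.2 (injective_of_abs_lt_one hγ hw0 (by linarith)))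
    have h3 : 0 < w ^ 2 * chordQuotientSq γ (x, w) := by rw [← h1]; positivity
    exact (mul_pos_iff_of_pos_left (by positivity)).1 h3

theorem periodic_velocity (hγ : IsSmoothArclengthKnot γ) (i : Fin n) :
    Function.Periodic (velocity γ i) 1 :=
  periodic_coord (periodic_deriv hγ.periodic) i

theorem periodic_acceleration (hγ : IsSmoothArclengthKnot γ) (i : Fin n) :
    Function.Periodic (acceleration γ i) 1 :=
  periodic_coord (periodic_iteratedDeriv hγ.periodic 2) i

theorem chordQuotientSq_periodic (hγ : IsSmoothArclengthKnot γ) (x w : ℝ) :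
    chordQuotientSq γ (x + 1, w) = chordQuotientSq γ (x, w) := by
  have h : ∀ i (s : ℝ), velocity γ i (x + 1 + s * w) = velocity γ i (x + s * w) := fun i s => by
    rw [add_right_comm, periodic_velocity hγ i]
  simp only [chordQuotientSq, chordQuotient, average, translates, h]

/-- A cutoff that vanishes for y ≤ c/2 and equals 1 for y ≥ c removes the singularity of 1 / y. It
permits a globally smooth substitute for the reciprocal of the squared chord quotient. -/
theorem exists_smooth_inv {c : ℝ} (hc : 0 < c) :
    ∃ h : ℝ → ℝ, ContDiff ℝ ∞ h ∧ ∀ y, c ≤ y → h y * y = 1 := by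
  refine ⟨fun y => Real.smoothTransition (2 * y / c - 1) / y, ?_, fun y hy => ?_⟩
  · rw [contDiff_iff_contDiffAt]
    intro y
    have hnum : ContDiff ℝ ∞ fun y : ℝ => Real.smoothTransition (2 * y / c - 1) :=
      Real.smoothTransition.contDiff.comp (by fun_prop)
    rcases eq_or_ne y 0 with rfl | hy
    · have hev : (fun y => Real.smoothTransition (2 * y / c - 1) / y) =ᶠ[𝓝 0] fun _ => 0 := by
        filter_upwards [Iio_mem_nhds (show (0 : ℝ) < c / 2 by positivity)] with y hy
        have hy' : y < c / 2 := hy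
        rw [Real.smoothTransition.zero_of_nonpos, zero_div]
        rw [sub_nonpos, div_le_one hc]
        linarith
      exact contDiffAt_const.congr_of_eventuallyEq hev
    · exact hnum.contDiffAt.div contDiffAt_id hy
  · have hy0 : y ≠ 0 := (hc.trans_le hy).ne'
    have h1 : 1 ≤ 2 * y / c - 1 := by
      rw [le_sub_iff_add_le, le_div_iff₀ hc]
      linarith
    simp only [Real.smoothTransition.one_of_one_le h1]
    field_simp

theorem exists_chordQuotientSq_inv (hγ : IsSmoothArclengthKnot γ) :
    ∃ U : ℝ × ℝ → ℝ, ContDiff ℝ ∞ U ∧ (∀ x w, U (x + 1, w) = U (x, w)) ∧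
      ∀ x w, |w| ≤ 1 / 2 → U (x, w) * chordQuotientSq γ (x, w) = 1 := by
  have hs := contDiff_chordQuotientSq hγ.smooth
  have hcomp : IsCompact (Icc (0 : ℝ) 1 ×ˢ Icc (-(1 / 2) : ℝ) (1 / 2)) :=
    isCompact_Icc.prod isCompact_Icc
  obtain ⟨p, hp, hmin⟩ := hcomp.exists_isMinOn ⟨(0, 0), by norm_num⟩ hs.continuous.continuousOn
  obtain ⟨h, hh, hinv⟩ := exists_smooth_inv (chordQuotientSq_pos hγ p.1 (abs_le.2 hp.2))
  refine ⟨fun q => h (chordQuotientSq γ q), hh.comp hs, fun x w => by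
    simp only [chordQuotientSq_periodic hγ], fun x w hw => hinv _ ?_⟩
  have hper : Function.Periodic (fun x => chordQuotientSq γ (x, w)) 1 := fun x =>
    chordQuotientSq_periodic hγ x w
  obtain ⟨y, hy, hxy⟩ := hper.exists_mem_Ico₀ one_pos x
  rw [show chordQuotientSq γ (x, w) = chordQuotientSq γ (y, w) from hxy]
  exact hmin (show (y, w) ∈ _ from ⟨Ico_subset_Icc_self hy, abs_le.1 hw⟩)

end Curve

/-! ## Truncated integrals -/

section Truncated

variable {E : Type*} [NormedAddCommGroup E] [NormedSpace ℝ E]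

theorem truncated_eq {ε : ℝ} (hε : 0 < ε) :
    truncated ε = Icc (-(1 / 2)) (-ε) ∪ Icc ε (1 / 2) := by
  ext w
  simp only [truncated, mem_ofPred_eq, mem_Icc, mem_union, le_abs, abs_le]
  constructor
  · rintro ⟨h | h, h1, h2⟩
    · exact Or.inr ⟨h, h2⟩
    · exact Or.inl ⟨h1, by linarith⟩
  · rintro (⟨h1, h2⟩ | ⟨h1, h2⟩)
    · exact ⟨Or.inr (by linarith), h1, by linarith⟩
    · exact ⟨Or.inl h1, by linarith, h2⟩

theorem setIntegral_truncated {f : ℝ → E} (hf : ContinuousOn f {0}ᶜ) {ε : ℝ} (hε : 0 < ε)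
    (hε2 : ε ≤ 1 / 2) : ∫ w in truncated ε, f w = ∫ w in ε..1 / 2, (f w + f (-w)) := by
  have h1 : IntegrableOn f (Icc (-(1 / 2)) (-ε)) :=
    (hf.mono fun w hw => by
      have : w < 0 := hw.2.trans_lt (by linarith)
      exact this.ne).integrableOn_compact isCompact_Icc
  have h2 : IntegrableOn f (Icc ε (1 / 2)) :=
    (hf.mono fun w hw => (hε.trans_le hw.1).ne').integrableOn_compact isCompact_Icc
  have hdisj : Disjoint (Icc (-(1 / 2)) (-ε)) (Icc ε (1 / 2)) :=
    Set.disjoint_left.2 fun w hw hw' => by linarith [hw.2, hw'.1]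
  have h2' : IntervalIntegrable f volume ε (1 / 2) :=
    (intervalIntegrable_iff_integrableOn_Icc_of_le hε2).2 h2
  have h3' : IntervalIntegrable (fun w => f (-w)) volume ε (1 / 2) := by
    refine ContinuousOn.intervalIntegrable (hf.comp continuous_neg.continuousOn fun w hw => ?_)
    rw [uIcc_of_le hε2] at hw
    exact neg_ne_zero.2 (hε.trans_le hw.1).ne'
  rw [truncated_eq hε, setIntegral_union hdisj measurableSet_Icc h1 h2,
    integral_Icc_eq_integral_Ioc, integral_Icc_eq_integral_Ioc,
    ← intervalIntegral.integral_of_le (by linarith), ← intervalIntegral.integral_of_le hε2,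
    intervalIntegral.integral_add h2' h3',
    intervalIntegral.integral_comp_neg, add_comm]

/-- The truncation is symmetric, so only f w + f (-w) matters. The principal value exists as soon as
this sum extends continuously to w = 0. -/
theorem tendsto_integral_truncated [CompleteSpace E] {f G : ℝ → E} (hf : ContinuousOn f {0}ᶜ)
    (hG : Continuous G) (h : ∀ w, w ≠ 0 → f w + f (-w) = G w) (c : ℝ) :
    Tendsto (fun ε => c • ∫ w in truncated ε, f w) (𝓝[>] 0)
      (𝓝 (c • ∫ w in (0 : ℝ)..1 / 2, G w)) := by
  have hcont : Continuous fun ε : ℝ => c • ∫ w in ε..1 / 2, G w := by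
    have h1 : Continuous fun ε : ℝ => ∫ w in (1 / 2 : ℝ)..ε, G w :=
      intervalIntegral.continuous_primitive (fun a b => hG.intervalIntegrable a b) _
    have h2 : (fun ε : ℝ => c • ∫ w in ε..1 / 2, G w) =
        fun ε : ℝ => c • -∫ w in (1 / 2 : ℝ)..ε, G w := funext fun ε => by
      rw [intervalIntegral.integral_symm]
    rw [h2]
    exact h1.neg.const_smul c
  refine ((hcont.tendsto 0).mono_left nhdsWithin_le_nhds).congr' ?_
  filter_upwards [Ioc_mem_nhdsGT (show (0 : ℝ) < 1 / 2 by norm_num)] with ε hε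
  rw [setIntegral_truncated hf hε.1 hε.2]
  congr 1
  refine intervalIntegral.integral_congr fun w hw => ?_
  rw [uIcc_of_le hε.2] at hw
  exact (h w (hε.1.trans_le hw.1).ne').symm

end Truncated

/-! ## The majorant of an arc-length parametrized curve -/

section Blocks

theorem H1Bound.translate {u : ℝ → ℝ} {M : ℝ} (hp : Function.Periodic u 1) (h : H1Bound u M)
    (w : ℝ) : H1Bound (fun x => u (x + w)) M := by
  refine ⟨fun x => h.abs_le _, ?_⟩
  have h1 : ∀ x, deriv (fun x => u (x + w)) x = deriv u (x + w) := fun x =>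
    deriv_comp_add_const u w x
  have hp' : Function.Periodic (fun x => deriv u x ^ 2) 1 := fun x => by
    simp only [periodic_deriv hp x]
  have h2 := intervalIntegral.integral_comp_add_right (a := 0) (b := 1)
    (fun x => deriv u x ^ 2) w
  have h3 := hp'.intervalIntegral_add_eq w 0
  simp only [h1]
  rw [h2, zero_add, add_comm 1 w, h3, zero_add]
  exact h.energy_le

variable {n : ℕ} {γ : ℝ → EuclideanSpace ℝ (Fin n)}

theorem blockCurve_zero (γ : ℝ → EuclideanSpace ℝ (Fin n)) (i : Fin n) :
    blockCurve γ (0, i) = velocity γ i :=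
  funext fun x => by simp [blockCurve, velocity]

theorem blockCurve_one (γ : ℝ → EuclideanSpace ℝ (Fin n)) (i : Fin n) :
    blockCurve γ (1, i) = acceleration γ i :=
  funext fun x => by simp [blockCurve, acceleration]

theorem contDiff_blockCurve (hγ : ContDiff ℝ ∞ γ) (c : Fin 4 × Fin n) :
    ContDiff ℝ ∞ (blockCurve γ c) := by
  unfold blockCurve
  split_ifs
  · exact contDiff_velocity hγ c.2
  · exact contDiff_acceleration hγ c.2

theorem periodic_blockCurve (hγ : IsSmoothArclengthKnot γ) (c : Fin 4 × Fin n) :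
    Function.Periodic (blockCurve γ c) 1 := by
  unfold blockCurve
  split_ifs
  · exact periodic_velocity hγ c.2
  · exact periodic_acceleration hγ c.2

/-- The `H¹` norms of the derivatives of `(γ', γ'', γ'', γ'')`. -/
def blockNorms (γ : ℝ → EuclideanSpace ℝ (Fin n)) (m : ℕ) (c : Fin 4 × Fin n) : ℝ :=
  scalarNormH1 (iteratedDeriv (m + 1) (blockCurve γ c))

/-- The exponential generating function of these norms. -/
def blockSeries (γ : ℝ → EuclideanSpace ℝ (Fin n)) : PowerSeries ℝ :=
  generatingSeries (blockNorms γ)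

theorem blockNorms_nonneg (γ : ℝ → EuclideanSpace ℝ (Fin n)) (m : ℕ) (c : Fin 4 × Fin n) :
    0 ≤ blockNorms γ m c := scalarNormH1_nonneg _

theorem constantCoeff_blockSeries (γ : ℝ → EuclideanSpace ℝ (Fin n)) :
    PowerSeries.constantCoeff (blockSeries γ) = 0 := constantCoeff_generatingSeries _

theorem coeff_blockSeries_nonneg (γ : ℝ → EuclideanSpace ℝ (Fin n)) (m : ℕ) :
    0 ≤ PowerSeries.coeff m (blockSeries γ) :=
  coeff_generatingSeries_nonneg (blockNorms_nonneg γ) m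

/-- These are the generators of the class. For l ≥ 1 the H¹ norm of the l-th derivative is one of
the summands of l! times the l-th coefficient of Φ. Order zero is not recorded in Φ and enters
through the constant C instead. -/
theorem goodFamily_translates_blockCurve (hγ : IsSmoothArclengthKnot γ) (c : Fin 4 × Fin n) :
    GoodFamily (blockSeries γ) (translates (blockCurve γ c)) := by
  have hs := contDiff_blockCurve hγ.smooth c
  have hp := periodic_blockCurve hγ c
  have h0 := constantCoeff_blockSeries γ
  have hΦ := coeff_blockSeries_nonneg γ
  have hN := scalarNormH1_nonneg (blockCurve γ c)
  refine ⟨contDiff_translates hs, fun x w => ?_, 7 * (scalarNormH1 (blockCurve γ c) + 1), 1,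
    by positivity, zero_le_one, fun l w _ => ?_⟩
  · simp only [translates]
    rw [add_right_comm, hp]
  · have h1 : iteratedDeriv l (fun x => translates (blockCurve γ c) (x, w)) =
        fun x => iteratedDeriv l (blockCurve γ c) (x + w) := by
      simp only [translates]
      exact iteratedDeriv_comp_add_const l (blockCurve γ c) w
    rw [h1]
    refine (H1Bound.translate (periodic_iteratedDeriv hp l)
      (h1Bound_scalarNormH1 (contDiff_iteratedDeriv hs l) (periodic_iteratedDeriv hp l)) w).mono ?_
    cases l with
    | zero =>
      rw [coeff_zero_geometricSeries h0]
      simp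
    | succ l =>
      have h2 : scalarNormH1 (iteratedDeriv (l + 1) (blockCurve γ c)) ≤
          (l + 1).factorial * PowerSeries.coeff (l + 1) (blockSeries γ) := by
        rw [blockSeries, coeff_succ_generatingSeries, Finset.mul_sum]
        refine le_trans (le_of_eq ?_) (Finset.single_le_sum (f := fun c =>
          ((l + 1).factorial : ℝ) * (blockNorms γ l c / ((l + 1).factorial : ℝ)))
          (fun c _ => mul_nonneg (Nat.cast_nonneg _)
            (div_nonneg (blockNorms_nonneg γ l c) (Nat.cast_nonneg _))) (Finset.mem_univ c))
        have : ((l + 1).factorial : ℝ) ≠ 0 := Nat.cast_ne_zero.2 (Nat.factorial_ne_zero _)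
        field_simp
        rfl
      have h3 := coeff_le_coeff_geometricSeries_one h0 hΦ (l + 1)
      have h4 := mul_le_mul_of_nonneg_left h3 (Nat.cast_nonneg (α := ℝ) (l + 1).factorial)
      have h5 := mul_nonneg hN ((scalarNormH1_nonneg _).trans (h2.trans h4))
      nlinarith

theorem goodFamily_blockCurve (hγ : IsSmoothArclengthKnot γ) (c : Fin 4 × Fin n) :
    GoodFamily (blockSeries γ) fun p => blockCurve γ c p.1 := by
  have := (goodFamily_translates_blockCurve hγ c).slice (w := 0) (by norm_num)
  simpa [translates] using this

theorem goodFamily_velocity (hγ : IsSmoothArclengthKnot γ) (i : Fin n) :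
    GoodFamily (blockSeries γ) fun p => velocity γ i p.1 := by
  rw [← blockCurve_zero]
  exact goodFamily_blockCurve hγ _

theorem goodFamily_acceleration (hγ : IsSmoothArclengthKnot γ) (i : Fin n) :
    GoodFamily (blockSeries γ) fun p => acceleration γ i p.1 := by
  rw [← blockCurve_one]
  exact goodFamily_blockCurve hγ _

theorem goodFamily_chordQuotient (hγ : IsSmoothArclengthKnot γ) (i : Fin n) :
    GoodFamily (blockSeries γ) (chordQuotient γ i) := by
  have := goodFamily_translates_blockCurve hγ (0, i)
  rw [blockCurve_zero] at this
  exact this.average contDiff_const (by simp)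

theorem goodFamily_velocityQuotient (hγ : IsSmoothArclengthKnot γ) (i : Fin n) :
    GoodFamily (blockSeries γ) (velocityQuotient γ i) := by
  have := goodFamily_translates_blockCurve hγ (1, i)
  rw [blockCurve_one] at this
  exact this.average contDiff_const (by simp)

theorem abs_le_one_of_mem_Icc {s : ℝ} (hs : s ∈ Icc (0 : ℝ) 1) : |s| ≤ 1 := by
  rw [abs_of_nonneg hs.1]
  exact hs.2

theorem goodFamily_taylorQuotient (hγ : IsSmoothArclengthKnot γ) (i : Fin n) :
    GoodFamily (blockSeries γ) (taylorQuotient γ i) :=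
  (goodFamily_velocityQuotient hγ i).average contDiff_id fun _ hs => abs_le_one_of_mem_Icc hs

theorem goodFamily_chordQuotientSq (hγ : IsSmoothArclengthKnot γ) :
    GoodFamily (blockSeries γ) (chordQuotientSq γ) :=
  GoodFamily.sum (constantCoeff_blockSeries γ) (coeff_blockSeries_nonneg γ) _ fun i _ =>
    (goodFamily_chordQuotient hγ i).mul (constantCoeff_blockSeries γ) (coeff_blockSeries_nonneg γ)
      (goodFamily_chordQuotient hγ i)

theorem goodFamily_chordDefect (hγ : IsSmoothArclengthKnot γ) :
    GoodFamily (blockSeries γ) (chordDefect γ) := by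
  have h0 := constantCoeff_blockSeries γ
  have hΦ := coeff_blockSeries_nonneg γ
  have h1 : GoodFamily (blockSeries γ) (velocityQuotientSq γ) :=
    GoodFamily.sum h0 hΦ _ fun i _ =>
      (goodFamily_velocityQuotient hγ i).mul h0 hΦ (goodFamily_velocityQuotient hγ i)
  have h2 : GoodFamily (blockSeries γ) (average (fun s => s ^ 2) (velocityQuotientSq γ)) :=
    h1.average (contDiff_id.pow 2) fun s hs => by
      rw [abs_pow]
      exact pow_le_one₀ (abs_nonneg s) (abs_le_one_of_mem_Icc hs)
  exact h2.sub h0 hΦ (GoodFamily.sum h0 hΦ _ fun i _ =>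
    (goodFamily_taylorQuotient hγ i).mul h0 hΦ (goodFamily_taylorQuotient hγ i))

end Blocks

/-! ## The remainders -/

section Remainder

variable {n : ℕ} {γ : ℝ → EuclideanSpace ℝ (Fin n)}

/-- A truncated integral whose integrand extends to a family with geometric majorants. -/
theorem exists_goodFamily_of_truncated {F : Fin n → ℝ × ℝ → ℝ}
    (hF : ∀ i, GoodFamily (blockSeries γ) (F i)) {I : ℝ → ℝ → EuclideanSpace ℝ (Fin n)}
    (hI : ∀ x w, w ≠ 0 → |w| ≤ 1 / 2 → I x w = WithLp.toLp 2 fun i => F i (x, w)) (c : ℝ) :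
    ∃ V : Fin n → ℝ × ℝ → ℝ, (∀ i, GoodFamily (blockSeries γ) (V i)) ∧
      ∀ x, Tendsto (fun ε => c • ∫ w in truncated ε, I x w) (𝓝[>] 0)
        (𝓝 (WithLp.toLp 2 fun i => V i (x, 0))) := by
  have h0 := constantCoeff_blockSeries γ
  have hΦ := coeff_blockSeries_nonneg γ
  have hA : ∀ i, GoodFamily (blockSeries γ) (average (fun _ => 1) (F i)) := fun i =>
    (hF i).average contDiff_const (by simp)
  -- Averages at w = ±1/2 are twice the integrals over the two halves of [-1/2, 1/2], whence c / 2.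
  -- Writing the limit through slices of averages makes it a good family at once.
  refine ⟨fun i p => c / 2 * (average (fun _ => 1) (F i) (p.1, 1 / 2) +
    average (fun _ => 1) (F i) (p.1, -(1 / 2))), fun i => ?_, fun x => ?_⟩
  · exact ((((hA i).slice (w := 1 / 2) (by norm_num [abs_of_pos])).add h0 hΦ
      ((hA i).slice (w := -(1 / 2)) (by norm_num [abs_of_pos])))).const_mul (c / 2)
  · have hcF : ∀ i, Continuous fun w => F i (x, w) := fun i =>
      (hF i).smooth.continuous.comp (by fun_prop)
    have hneg : ∀ i, Continuous fun w => F i (x, -w) := fun i =>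
      (hF i).smooth.continuous.comp (by fun_prop)
    set f : ℝ → EuclideanSpace ℝ (Fin n) := fun w => WithLp.toLp 2 fun i => F i (x, w) with hf
    have hfc : Continuous f := (PiLp.continuous_toLp 2 _).comp (continuous_pi hcF)
    have hlim := tendsto_integral_truncated hfc.continuousOn
      (hfc.add (hfc.comp continuous_neg)) (fun w _ => rfl) c
    have hcongr : ∀ᶠ ε in 𝓝[>] (0 : ℝ), c • ∫ w in truncated ε, f w =
        c • ∫ w in truncated ε, I x w := by
      filter_upwards [self_mem_nhdsWithin] with ε hε
      congr 1
      have hε' : (0 : ℝ) < ε := hε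
      refine setIntegral_congr_fun ?_ fun w hw => (hI x w ?_ hw.2).symm
      · rw [truncated_eq hε']
        exact measurableSet_Icc.union measurableSet_Icc
      · rintro rfl
        have := hw.1
        simp only [abs_zero] at this
        linarith
    convert! hlim.congr' hcongr using 2
    ext i
    have hint : IntervalIntegrable (fun w => f w + f (-w)) volume 0 (1 / 2) :=
      (hfc.add (hfc.comp continuous_neg)).intervalIntegrable _ _
    have h1 := (EuclideanSpace.proj i : EuclideanSpace ℝ (Fin n) →L[ℝ] ℝ).intervalIntegral_comp_comm
      hint
    have h2 : (c • ∫ w in (0 : ℝ)..1 / 2, (f w + f (-w))) i =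
        c * ∫ w in (0 : ℝ)..1 / 2, (F i (x, w) + F i (x, -w)) := by
      rw [PiLp.smul_apply, smul_eq_mul]
      exact congrArg (c * ·) h1.symm
    have h3 : ∀ w : ℝ, w ≠ 0 → average (fun _ => 1) (F i) (x, w) =
        w⁻¹ * ∫ s in (0 : ℝ)..w, F i (x, s) := fun w hw => by
      have := intervalIntegral.integral_comp_mul_right (a := 0) (b := 1) (fun s => F i (x, s)) hw
      simp only [average, one_mul, this, zero_mul, smul_eq_mul]
    have h4 : ∫ w in (0 : ℝ)..1 / 2, F i (x, -w) = -∫ s in (0 : ℝ)..-(1 / 2), F i (x, s) := by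
      rw [intervalIntegral.integral_comp_neg (fun w => F i (x, w)), neg_zero,
        intervalIntegral.integral_symm]
    change c / 2 * (average (fun _ => 1) (F i) (x, 1 / 2) +
      average (fun _ => 1) (F i) (x, -(1 / 2))) = (c • ∫ w in (0 : ℝ)..1 / 2, (f w + f (-w))) i
    rw [h2, intervalIntegral.integral_add ((hcF i).intervalIntegrable _ _)
      ((hneg i).intervalIntegrable _ _), h4, h3 _ (by norm_num),
      h3 _ (by norm_num)]
    ring

/-- Let S be the squared chord quotient and D the defect, so 1 - S = w² D. Then the kernel is (1 -
S²) / (w⁴ S²) = D (1 + S) / (w² S²), and its singularity cancels against the w² in front of the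
Taylor quotient. -/
theorem exists_R₁_goodFamily (hγ : IsSmoothArclengthKnot γ) :
    ∃ V : Fin n → ℝ × ℝ → ℝ, (∀ i, GoodFamily (blockSeries γ) (V i)) ∧
      ∀ x, Tendsto (fun ε => R₁trunc γ ε x) (𝓝[>] 0) (𝓝 (WithLp.toLp 2 fun i => V i (x, 0))) := by
  have h0 := constantCoeff_blockSeries γ
  have hΦ := coeff_blockSeries_nonneg γ
  obtain ⟨U, hU, hUp, hUi⟩ := exists_chordQuotientSq_inv hγ
  have hgU := (goodFamily_chordQuotientSq hγ).inv h0 hΦ hU hUp hUi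
  have hD := goodFamily_chordDefect hγ
  have hfac := (hD.mul h0 hΦ (hgU.mul h0 hΦ hgU)).add h0 hΦ
    ((hD.mul h0 hΦ (goodFamily_chordQuotientSq hγ)).mul h0 hΦ (hgU.mul h0 hΦ hgU))
  refine exists_goodFamily_of_truncated
    (fun i => hfac.mul h0 hΦ (goodFamily_taylorQuotient hγ i)) (fun x w hw hw2 => ?_) 4
  have h1 := norm_chord_sq hγ.smooth x w
  have h2 := chordQuotientSq_eq hγ x w
  have h3 := hUi x w hw2
  have h4 : (1 / ‖γ (x + w) - γ x‖ ^ 4 - 1 / w ^ 4) =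
      (chordDefect γ (x, w) * (U (x, w) * U (x, w)) +
        chordDefect γ (x, w) * chordQuotientSq γ (x, w) * (U (x, w) * U (x, w))) / w ^ 2 := by
    have h5 : ‖γ (x + w) - γ x‖ ^ 4 = w ^ 4 * chordQuotientSq γ (x, w) ^ 2 := by
      rw [show ‖γ (x + w) - γ x‖ ^ 4 = (‖γ (x + w) - γ x‖ ^ 2) ^ 2 by ring, h1]
      ring
    have hD0 : chordQuotientSq γ (x, w) ≠ 0 := (chordQuotientSq_pos hγ x hw2).ne'
    have hUe : U (x, w) = (chordQuotientSq γ (x, w))⁻¹ := eq_inv_of_mul_eq_one_left h3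
    rw [h5, hUe]
    field_simp
    linear_combination (-(1 + chordQuotientSq γ (x, w))) * h2
  ext i
  have h6 := sq_mul_taylorQuotient hγ.smooth i x w
  change (1 / ‖γ (x + w) - γ x‖ ^ 4 - 1 / w ^ 4) * (γ (x + w) i - γ x i - w * velocity γ i x) = _
  rw [h4, ← h6]
  field_simp

/-- Here the kernel is (1 - S) / (w² S) = D / S, already without a singularity, where S is the
squared chord quotient and D the defect. -/
theorem exists_R₂_goodFamily (hγ : IsSmoothArclengthKnot γ) :
    ∃ V : Fin n → ℝ × ℝ → ℝ, (∀ i, GoodFamily (blockSeries γ) (V i)) ∧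
      ∀ x, Tendsto (fun ε => R₂trunc γ ε x) (𝓝[>] 0) (𝓝 (WithLp.toLp 2 fun i => V i (x, 0))) := by
  have h0 := constantCoeff_blockSeries γ
  have hΦ := coeff_blockSeries_nonneg γ
  obtain ⟨U, hU, hUp, hUi⟩ := exists_chordQuotientSq_inv hγ
  have hgU := (goodFamily_chordQuotientSq hγ).inv h0 hΦ hU hUp hUi
  refine exists_goodFamily_of_truncated (fun i => ((goodFamily_chordDefect hγ).mul h0 hΦ hgU).mul
    h0 hΦ (goodFamily_acceleration hγ i)) (fun x w hw hw2 => ?_) (-2)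
  have h1 := norm_chord_sq hγ.smooth x w
  have h2 := chordQuotientSq_eq hγ x w
  have h3 := hUi x w hw2
  have h4 : (1 / ‖γ (x + w) - γ x‖ ^ 2 - 1 / w ^ 2) = chordDefect γ (x, w) * U (x, w) := by
    have hD0 : chordQuotientSq γ (x, w) ≠ 0 := (chordQuotientSq_pos hγ x hw2).ne'
    have hUe : U (x, w) = (chordQuotientSq γ (x, w))⁻¹ := eq_inv_of_mul_eq_one_left h3
    rw [h1, hUe]
    field_simp
    linear_combination -h2
  ext i
  change (1 / ‖γ (x + w) - γ x‖ ^ 2 - 1 / w ^ 2) * acceleration γ i x = _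
  rw [h4]

theorem normalPart_apply (γ V : ℝ → EuclideanSpace ℝ (Fin n)) (x : ℝ) (i : Fin n) :
    normalPart γ V x i = V x i - (∑ j, V x j * velocity γ j x) * velocity γ i x := by
  simp only [normalPart, PiLp.sub_apply, PiLp.smul_apply, smul_eq_mul, PiLp.inner_apply,
    velocity]
  congr 2
  exact Finset.sum_congr rfl fun j _ => by simp [mul_comm]

/-- The normal part of a vector field with geometric majorants is smooth and satisfies the
estimates of the theorem. -/
theorem normalPart_bound (hγ : IsSmoothArclengthKnot γ) {V : ℝ → EuclideanSpace ℝ (Fin n)}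
    {F : Fin n → ℝ × ℝ → ℝ} (hF : ∀ i, GoodFamily (blockSeries γ) (F i))
    (hV : ∀ x, V x = WithLp.toLp 2 fun i => F i (x, 0)) :
    ContDiff ℝ ∞ (normalPart γ V) ∧ ∀ C₁, 0 < C₁ → ∃ C r : ℝ, 0 < C ∧ 0 < r ∧ ∀ l : ℕ,
      MemH1 (iteratedDeriv l (normalPart γ V)) ∧
        normH1 (iteratedDeriv l (normalPart γ V)) ≤ C * faaDiBrunoBound γ C₁ r l := by
  have h0 := constantCoeff_blockSeries γ
  have hΦ := coeff_blockSeries_nonneg γ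
  have hW : ∀ i, GoodFamily (blockSeries γ) fun p =>
      F i p - (∑ j, F j p * velocity γ j p.1) * velocity γ i p.1 := fun i =>
    (hF i).sub h0 hΦ ((GoodFamily.sum h0 hΦ _ fun j _ =>
      (hF j).mul h0 hΦ (goodFamily_velocity hγ j)).mul h0 hΦ (goodFamily_velocity hγ i))
  have hcoord : ∀ i, (fun x => normalPart γ V x i) = fun x =>
      F i (x, 0) - (∑ j, F j (x, 0) * velocity γ j x) * velocity γ i x := fun i =>
    funext fun x => by rw [normalPart_apply, hV]
  have hsm : ContDiff ℝ ∞ (normalPart γ V) := contDiff_euclidean.2 fun i => by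
    rw [hcoord]
    exact contDiff_slice (hW i).smooth 0
  have hper : Function.Periodic (normalPart γ V) 1 := fun x => by
    ext i
    rw [show normalPart γ V (x + 1) i = _ from congrFun (hcoord i) (x + 1),
      show normalPart γ V x i = _ from congrFun (hcoord i) x]
    exact (hW i).periodic x 0
  refine ⟨hsm, fun C₁ hC₁ => ?_⟩
  choose C c hC hc hb using fun i => (hW i).bound
  have hc' : 0 < 1 + ∑ i, c i := by
    have := Finset.sum_nonneg fun i (_ : i ∈ Finset.univ) => hc i
    linarith
  have hD : 0 ≤ ∑ i, 2 * C i := Finset.sum_nonneg fun i _ => mul_nonneg zero_le_two (hC i)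
  -- One parameter c = 1 + Σ c_i dominates those of all coordinates and is positive, so r = C₁ / c
  -- is admissible. The factor 2 on C_i is the cost of returning from `H1Bound` to the H¹ norm.
  refine ⟨(1 + ∑ i, 2 * C i) * (C₁ / (1 + ∑ i, c i)), C₁ / (1 + ∑ i, c i), by positivity,
    by positivity, fun l => ?_⟩
  have hsl : ContDiff ℝ ∞ (iteratedDeriv l (normalPart γ V)) := by
    rw [iteratedDeriv_eq_iterate]
    exact hsm.iterate_deriv l
  have hpl := periodic_iteratedDeriv hper l
  refine ⟨memH1_of_contDiff hsl hpl, ?_⟩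
  have hG := coeff_geometricSeries_nonneg h0 hΦ hc'.le l
  have hi : ∀ i, scalarNormH1 (fun x => iteratedDeriv l (normalPart γ V) x i) ≤
      2 * C i * (l.factorial * PowerSeries.coeff l
        (geometricSeries (blockSeries γ) (1 + ∑ i, c i))) := fun i => by
    have h1 := hb i l 0 (by norm_num)
    simp only [← hcoord i] at h1
    rw [iteratedDeriv_coord hsm] at h1
    refine (h1.scalarNormH1_le (contDiff_coord hsl i) (periodic_coord hpl i)).trans ?_
    have h2 : c i ≤ 1 + ∑ i, c i := by
      have := Finset.single_le_sum (f := c) (fun i _ => hc i) (Finset.mem_univ i)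
      linarith
    have h3 := coeff_geometricSeries_mono h0 hΦ (hc i) h2 l
    have h4 := hC i
    rw [mul_assoc]
    gcongr
  refine (normH1_le_sum hsl hpl).trans ((Finset.sum_le_sum fun i _ => hi i).trans ?_)
  rw [← Finset.sum_mul, mul_assoc (1 + _)]
  have h5 := factorial_mul_coeff_geometricSeries_le (blockNorms_nonneg γ) hC₁ hc' l
  refine mul_le_mul (by linarith) h5 ?_ (by linarith)
  exact mul_nonneg (Nat.cast_nonneg _) hG

end Remainder

/-! ## The main term -/

section MainTerm

variable {n : ℕ} {γ : ℝ → EuclideanSpace ℝ (Fin n)}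

theorem velocityQuotient_zero (γ : ℝ → EuclideanSpace ℝ (Fin n)) (i : Fin n) (x : ℝ) :
    velocityQuotient γ i (x, 0) = acceleration γ i x := by
  simp [velocityQuotient, average, translates]

theorem taylorQuotient_zero (γ : ℝ → EuclideanSpace ℝ (Fin n)) (i : Fin n) (x : ℝ) :
    taylorQuotient γ i (x, 0) = acceleration γ i x / 2 := by
  simp only [taylorQuotient, average, mul_zero, velocityQuotient_zero,
    intervalIntegral.integral_mul_const, integral_id]
  ring

/-- The symmetrized integrand of the main term is smooth. -/
theorem exists_symmetrized_integrand (hγ : ContDiff ℝ ∞ γ) (i : Fin n) :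
    ∃ κ : ℝ × ℝ → ℝ, ContDiff ℝ ∞ κ ∧ ∀ x w,
      2 * (taylorQuotient γ i (x, w) + taylorQuotient γ i (x, -w)) - 2 * acceleration γ i x =
        w ^ 2 * κ (x, w) := by
  have hs := contDiff_taylorQuotient hγ i
  have ha := contDiff_acceleration hγ i
  refine exists_eq_sq_mul (U := fun p => 2 * (taylorQuotient γ i (p.1, p.2) +
    taylorQuotient γ i (p.1, -p.2)) - 2 * acceleration γ i p.1) ?_ (fun x => ?_) fun x w => ?_
  · exact ((contDiff_const.mul ((hs.comp (by fun_prop)).add (hs.comp (by fun_prop))))).sub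
      (contDiff_const.mul (ha.comp contDiff_fst))
  · simp only [neg_zero, taylorQuotient_zero]
    ring
  · simp only [neg_neg]
    ring

theorem tendsto_Qtrunc (hγ : ContDiff ℝ ∞ γ) {κ : Fin n → ℝ × ℝ → ℝ}
    (hκ : ∀ i, ContDiff ℝ ∞ (κ i)) (h : ∀ i x w,
      2 * (taylorQuotient γ i (x, w) + taylorQuotient γ i (x, -w)) - 2 * acceleration γ i x =
        w ^ 2 * κ i (x, w)) (x : ℝ) :
    Tendsto (fun ε => Qtrunc γ ε x) (𝓝[>] 0)
      (𝓝 (WithLp.toLp 2 fun i => 2 * ∫ w in (0 : ℝ)..1 / 2, κ i (x, w))) := by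
  have hcκ : ∀ i, Continuous fun w => κ i (x, w) := fun i =>
    (hκ i).continuous.comp (by fun_prop)
  set G : ℝ → EuclideanSpace ℝ (Fin n) := fun w => WithLp.toLp 2 fun i => κ i (x, w) with hG
  have hGc : Continuous G := (PiLp.continuous_toLp 2 _).comp (continuous_pi hcκ)
  set f : ℝ → EuclideanSpace ℝ (Fin n) := fun w =>
    (1 / w ^ 2) • ((2 / w ^ 2) • (γ (x + w) - γ x - w • deriv γ x) - iteratedDeriv 2 γ x) with hf
  have hfc : ContinuousOn f {0}ᶜ := by
    have hγc := hγ.continuous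
    have h1 : ContinuousOn (fun w : ℝ => 1 / w ^ 2) {0}ᶜ :=
      continuousOn_const.div (by fun_prop) fun w hw => pow_ne_zero 2 hw
    have h2 : ContinuousOn (fun w : ℝ => 2 / w ^ 2) {0}ᶜ :=
      continuousOn_const.div (by fun_prop) fun w hw => pow_ne_zero 2 hw
    exact h1.smul ((h2.smul (by fun_prop)).sub continuousOn_const)
  have hfG : ∀ w, w ≠ 0 → f w + f (-w) = G w := fun w hw => by
    ext i
    have h1 : ∀ w, w ≠ 0 → f w i =
        (2 * taylorQuotient γ i (x, w) - acceleration γ i x) / w ^ 2 := fun w hw => by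
      have h2 := sq_mul_taylorQuotient hγ i x w
      change (1 / w ^ 2) * ((2 / w ^ 2) * (γ (x + w) i - γ x i - w * velocity γ i x) -
        acceleration γ i x) = _
      rw [← h2]
      field_simp
    rw [PiLp.add_apply, h1 w hw, h1 (-w) (neg_ne_zero.2 hw)]
    change _ = κ i (x, w)
    have h3 := h i x w
    rw [neg_sq, ← add_div, div_eq_iff (pow_ne_zero 2 hw)]
    linarith
  have hlim := tendsto_integral_truncated hfc hGc hfG 2
  convert! hlim using 2
  ext i
  have h1 := (EuclideanSpace.proj i : EuclideanSpace ℝ (Fin n) →L[ℝ] ℝ).intervalIntegral_comp_comm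
    (hGc.intervalIntegrable (μ := volume) 0 (1 / 2))
  exact congrArg (2 * ·) h1

theorem periodic_Q (hγ : IsSmoothArclengthKnot γ) : Function.Periodic (Q γ) 1 := fun x => by
  have h : (fun ε => Qtrunc γ ε (x + 1)) = fun ε => Qtrunc γ ε x := by
    funext ε
    simp only [Qtrunc, periodic_deriv hγ.periodic x, periodic_iteratedDeriv hγ.periodic 2 x,
      hγ.periodic x, add_right_comm x 1, hγ.periodic _]
  rw [Q, h, Q]

theorem tangentialPart_apply (γ V : ℝ → EuclideanSpace ℝ (Fin n)) (x : ℝ) (i : Fin n) :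
    tangentialPart γ V x i = (∑ j, velocity γ j x * V x j) * velocity γ i x := by
  simp only [tangentialPart, PiLp.smul_apply, smul_eq_mul, PiLp.inner_apply, velocity]
  congr 1

/-- The tangential component of the main term. -/
theorem exists_tangential_integrand (hγ : IsSmoothArclengthKnot γ) :
    ∃ m : ℝ × ℝ → ℝ, ContDiff ℝ ∞ m ∧
      (∀ x w, w ≠ 0 → m (x, w) = -(1 / w) * (average (fun s => s ^ 2) (velocityQuotientSq γ) (x, w) -
        average (fun s => s ^ 2) (velocityQuotientSq γ) (x, -w))) ∧
      (∀ x, Tendsto (fun ε => Qtrunc γ ε x) (𝓝[>] 0) (𝓝 (Q γ x))) ∧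
      ∀ x, ∑ j, velocity γ j x * Q γ x j = 2 * ∫ w in (0 : ℝ)..1 / 2, m (x, w) := by
  choose κ hκ h using exists_symmetrized_integrand hγ.smooth
  have hlim := tendsto_Qtrunc hγ.smooth hκ h
  have hQ : ∀ x, Q γ x = WithLp.toLp 2 fun i => 2 * ∫ w in (0 : ℝ)..1 / 2, κ i (x, w) :=
    fun x => (hlim x).limUnder_eq
  refine ⟨fun p => ∑ i, velocity γ i p.1 * κ i p, ContDiff.sum fun i _ =>
    ((contDiff_velocity hγ.smooth i).comp contDiff_fst).mul (hκ i), fun x w hw => ?_,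
    fun x => by rw [hQ]; exact hlim x, fun x => ?_⟩
  -- Paired with γ', the γ'' term disappears and each Taylor quotient becomes an average of squares
  -- times -w/2. The opposite signs of w leave a difference, odd in w, of these averages.
  · have h1 := sum_velocity_mul_taylorQuotient hγ x w
    have h2 := sum_velocity_mul_taylorQuotient hγ x (-w)
    have h3 := sum_velocity_mul_acceleration hγ x
    have h4 : w ^ 2 * ∑ i, velocity γ i x * κ i (x, w) =
        2 * (∑ i, velocity γ i x * taylorQuotient γ i (x, w) +
          ∑ i, velocity γ i x * taylorQuotient γ i (x, -w)) -
          2 * ∑ i, velocity γ i x * acceleration γ i x := by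
      rw [← Finset.sum_add_distrib, Finset.mul_sum, Finset.mul_sum, Finset.mul_sum,
        ← Finset.sum_sub_distrib]
      refine Finset.sum_congr rfl fun i _ => ?_
      linear_combination (-(velocity γ i x)) * h i x w
    rw [h1, h2, h3] at h4
    apply mul_left_cancel₀ (pow_ne_zero 2 hw)
    rw [h4]
    field_simp
    ring
  · have hc : ∀ i, Continuous fun w => velocity γ i x * κ i (x, w) := fun i =>
      continuous_const.mul ((hκ i).continuous.comp (by fun_prop))
    simp only
    rw [intervalIntegral.integral_finsetSum fun i _ => (hc i).intervalIntegrable _ _,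
      Finset.mul_sum]
    refine Finset.sum_congr rfl fun i _ => ?_
    simp only [hQ, intervalIntegral.integral_const_mul]
    ring

end MainTerm

/-! ## A bounded multiplier -/

section Multiplier

/-- Integration by parts with primitive -cos u / u: boundary terms and the remaining integral of cos
u / u² add up to at most 2 / A. -/
theorem abs_integral_sinc_le_of_one_le {A B : ℝ} (hA : 1 ≤ A) (hAB : A ≤ B) :
    |∫ u in A..B, Real.sinc u| ≤ 2 := by
  have hpos : ∀ u ∈ uIcc A B, 0 < u := fun u hu => by
    rw [uIcc_of_le hAB] at hu
    linarith [hu.1]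
  have hd : ∀ u ∈ uIcc A B, HasDerivAt (fun u => -Real.cos u / u)
      (Real.sinc u + Real.cos u / u ^ 2) u := fun u hu => by
    have hu0 := (hpos u hu).ne'
    refine ((Real.hasDerivAt_cos u).fun_neg.fun_div (hasDerivAt_id u) hu0).congr_deriv ?_
    rw [Real.sinc_of_ne_zero hu0]
    simp only [id]
    field_simp
    ring
  have hci : ContinuousOn (fun u => Real.cos u / u ^ 2) (uIcc A B) :=
    Real.continuous_cos.continuousOn.div (by fun_prop) fun u hu => pow_ne_zero 2 (hpos u hu).ne'
  have h1 := intervalIntegral.integral_eq_sub_of_hasDerivAt hd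
    ((Real.continuous_sinc.continuousOn.add hci).intervalIntegrable)
  rw [intervalIntegral.integral_add (Real.continuous_sinc.intervalIntegrable _ _)
    hci.intervalIntegrable] at h1
  have hd2 : ∀ u ∈ uIcc A B, HasDerivAt (fun u : ℝ => -u⁻¹) (1 / u ^ 2) u := fun u hu => by
    refine (hasDerivAt_inv (hpos u hu).ne').fun_neg.congr_deriv ?_
    simp
  have hci2 : ContinuousOn (fun u : ℝ => 1 / u ^ 2) (uIcc A B) :=
    continuousOn_const.div (by fun_prop) fun u hu => pow_ne_zero 2 (hpos u hu).ne'
  have h2 := intervalIntegral.integral_eq_sub_of_hasDerivAt hd2 hci2.intervalIntegrable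
  have h3 : |∫ u in A..B, Real.cos u / u ^ 2| ≤ ∫ u in A..B, 1 / u ^ 2 := by
    refine intervalIntegral.abs_integral_le_integral_abs hAB |>.trans ?_
    refine intervalIntegral.integral_mono_on hAB hci.abs.intervalIntegrable
      hci2.intervalIntegrable fun u _ => ?_
    rw [abs_div, abs_of_nonneg (sq_nonneg u)]
    exact div_le_div_of_nonneg_right (Real.abs_cos_le_one u) (sq_nonneg u)
  have hB : 1 ≤ B := hA.trans hAB
  have h4 : |(-Real.cos B / B)| ≤ B⁻¹ := by
    rw [abs_div, abs_neg, abs_of_pos (by linarith : 0 < B), ← one_div]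
    exact div_le_div_of_nonneg_right (Real.abs_cos_le_one B) (by linarith)
  have h5 : |(-Real.cos A / A)| ≤ A⁻¹ := by
    rw [abs_div, abs_neg, abs_of_pos (by linarith : 0 < A), ← one_div]
    exact div_le_div_of_nonneg_right (Real.abs_cos_le_one A) (by linarith)
  have h6 : A⁻¹ ≤ 1 := inv_le_one_of_one_le₀ hA
  rw [h2] at h3
  rw [abs_le] at h3 h4 h5 ⊢
  constructor <;> linarith

theorem abs_integral_sinc_le_sub {A B : ℝ} (hAB : A ≤ B) : |∫ u in A..B, Real.sinc u| ≤ B - A := by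
  have := intervalIntegral.norm_integral_le_of_norm_le_const (a := A) (b := B) (C := 1)
    (f := Real.sinc) fun u _ => Real.abs_sinc_le_one u
  rwa [one_mul, abs_of_nonneg (sub_nonneg.2 hAB), Real.norm_eq_abs] at this

theorem abs_integral_sinc_le {A B : ℝ} (hA : 0 ≤ A) (hAB : A ≤ B) :
    |∫ u in A..B, Real.sinc u| ≤ 3 := by
  rcases le_total 1 A with h | h
  · exact (abs_integral_sinc_le_of_one_le h hAB).trans (by norm_num)
  rcases le_total B 1 with h' | h'
  · exact (abs_integral_sinc_le_sub hAB).trans (by linarith)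
  · rw [← intervalIntegral.integral_add_adjacent_intervals (b := 1)
      (Real.continuous_sinc.intervalIntegrable _ _) (Real.continuous_sinc.intervalIntegrable _ _)]
    have h1 := abs_integral_sinc_le_sub h
    have h2 := abs_integral_sinc_le_of_one_le le_rfl h'
    exact (abs_add_le _ _).trans (by linarith)

/-- The substitution u = y w reduces this to the integral of sinc, whose bound is independent of the
limits. Uniformity in y is what prevents the odd kernel 1 / w from costing a derivative. -/
theorem abs_integral_sin_div_le (y : ℝ) {a b : ℝ} (ha : 0 < a) (hab : a ≤ b) :
    |∫ w in a..b, w⁻¹ * Real.sin (y * w)| ≤ 3 := by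
  wlog hy : 0 ≤ y generalizing y
  · have := this (-y) (by linarith)
    simpa only [neg_mul, Real.sin_neg, mul_neg, intervalIntegral.integral_neg, abs_neg] using this
  rcases hy.eq_or_lt with rfl | hy
  · simp
  · have h1 : ∫ w in a..b, w⁻¹ * Real.sin (y * w) = ∫ w in a..b, y * Real.sinc (y * w) := by
      refine intervalIntegral.integral_congr fun w hw => ?_
      rw [uIcc_of_le hab] at hw
      have hw0 : w ≠ 0 := (ha.trans_le hw.1).ne'
      rw [Real.sinc_of_ne_zero (mul_ne_zero hy.ne' hw0)]
      field_simp
    rw [h1, intervalIntegral.integral_const_mul, intervalIntegral.mul_integral_comp_mul_left]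
    exact abs_integral_sinc_le (by positivity) (by gcongr)

end Multiplier

/-! ## Fourier coefficients of the tangential part -/

section Tangential

theorem fourierCoeffUnit_translate {f : ℝ → ℂ} (hp : Function.Periodic f 1) (h : ℝ) (k : ℤ) :
    fourierCoeffUnit (fun x => f (x + h)) k = character k h * fourierCoeffUnit f k := by
  rw [fourierCoeffUnit_eq, fourierCoeffUnit_eq]
  have h1 : ∀ x, character (-k) x • f (x + h) =
      character k h * (character (-k) (x + h) • f (x + h)) := fun x => by
    have h2 : character k h * character (-k) h = 1 := by
      rw [← character_add, add_neg_cancel, character_zero]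
    rw [character_add_right, smul_eq_mul, smul_eq_mul]
    linear_combination (-(character (-k) x * f (x + h))) * h2
  have h3 : Function.Periodic (fun x => character (-k) x • f x) 1 := fun x => by
    simp only [character_add_right, character_one_right, mul_one, hp x]
  have h4 := intervalIntegral.integral_comp_add_right (a := 0) (b := 1)
    (fun x => character (-k) x • f x) h
  have h5 := h3.intervalIntegral_add_eq h 0
  simp only [h1, intervalIntegral.integral_const_mul]
  rw [h4, zero_add, add_comm 1 h, h5, zero_add]

theorem summable_norm_mul_norm_sub {c : ℤ → ℂ} (hc : Summable fun a => ‖c a‖) (k : ℤ) :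
    Summable fun a => ‖c a‖ * ‖c (k - a)‖ :=
  Summable.of_nonneg_of_le (fun a => by positivity)
    (fun a => mul_le_mul_of_nonneg_left (hc.le_tsum (k - a) fun _ _ => norm_nonneg _)
      (norm_nonneg _)) (hc.mul_right _)

theorem character_mul_sub_character_mul (a b : ℤ) (σ ρ w : ℝ) :
    character a (σ * w) * character b (ρ * w) - character a (-(σ * w)) * character b (-(ρ * w)) =
      2 * Complex.I * (Real.sin (2 * Real.pi * (a * σ + b * ρ) * w) : ℝ) := by
  have h1 : character a (σ * w) * character b (ρ * w) =
      Complex.exp ((2 * Real.pi * (a * σ + b * ρ) * w : ℝ) * Complex.I) := by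
    rw [character, character, ← Complex.exp_add]
    congr 1
    push_cast
    ring
  have h2 : character a (-(σ * w)) * character b (-(ρ * w)) =
      Complex.exp (-(2 * Real.pi * (a * σ + b * ρ) * w : ℝ) * Complex.I) := by
    rw [character, character, ← Complex.exp_add]
    congr 1
    push_cast
    ring
  rw [h1, h2, Complex.ofReal_sin, Complex.sin]
  linear_combination (Complex.exp ((2 * Real.pi * (a * σ + b * ρ) * w : ℝ) * Complex.I) -
    Complex.exp (-(2 * Real.pi * (a * σ + b * ρ) * w : ℝ) * Complex.I)) * Complex.I_mul_I

/-- The function `1 / w`, made constant on `w ≤ ε`. -/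
def cutoffInv (ε w : ℝ) : ℝ := (max w ε)⁻¹

theorem continuous_cutoffInv {ε : ℝ} (hε : 0 < ε) : Continuous (cutoffInv ε) :=
  (continuous_id.max continuous_const).inv₀ fun _ => (hε.trans_le (le_max_right _ _)).ne'

theorem cutoffInv_of_le {ε w : ℝ} (h : ε ≤ w) : cutoffInv ε w = w⁻¹ := by
  rw [cutoffInv, max_eq_left h]

/-- The odd part in `w` of `u (x + σ w) * u (x + ρ w)`, divided by `w ≥ ε`. -/
def oddQuotient (u : ℝ → ℝ) (ε σ ρ x w : ℝ) : ℝ :=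
  cutoffInv ε w * (u (x + σ * w) * u (x + ρ * w) - u (x + -(σ * w)) * u (x + -(ρ * w)))

/-- Expanding both factors in Fourier series, the odd part in w of each product of characters is 2 i
sin (y w) with a frequency y depending on a, k, σ, ρ. Integration against 1 / w costs at most 3 for
every y, so 6 works for all ε, σ, ρ. The cutoff of 1 / w makes the integrand continuous everywhere,
as the exchange of integrals requires. -/
theorem norm_integral_oddQuotient_le {u : ℝ → ℝ} (hu : ContDiff ℝ ∞ u)
    (hp : Function.Periodic u 1) {ε : ℝ} (hε : 0 < ε) (hε2 : ε ≤ 1 / 2) (σ ρ : ℝ) (k : ℤ) :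
    ‖∫ x in (0 : ℝ)..1, ∫ w in ε..1 / 2, character (-k) x * (oddQuotient u ε σ ρ x w : ℝ)‖ ≤
      6 * ∑' a, ‖fourierCoeffUnit (fun x => (u x : ℂ)) a‖ *
        ‖fourierCoeffUnit (fun x => (u x : ℂ)) (k - a)‖ := by
  set f : ℝ → ℂ := fun x => (u x : ℂ) with hf
  set c := fourierCoeffUnit f with hc
  have huc := hu.continuous
  have hfp : Function.Periodic f 1 := periodic_ofReal hp
  have hfs : ContDiff ℝ ∞ f := contDiff_ofReal hu
  have hcs : Summable fun a => ‖c a‖ := (memSobolev_of_contDiff hfs hfp).summable_norm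
  have hek := continuous_character (-k)
  have hinv := continuous_cutoffInv hε
  have hprod : ∀ h h' : ℝ, HasSum (fun a => c a * c (k - a) * (character a h * character (k - a) h'))
      (fourierCoeffUnit (fun x => f (x + h) * f (x + h')) k) := fun h h' => by
    have hsh : ContDiff ℝ ∞ fun x => f (x + h) := hfs.comp (by fun_prop)
    have hsh' : Continuous fun x => f (x + h') := hfs.continuous.comp (by fun_prop)
    have h1 := fourierCoeffUnit_mul (memLp_of_continuous hsh.continuous 2)
      (memSobolev_of_contDiff hsh fun x => by
        simp only [add_right_comm x 1, hfp (x + h)]).summable_norm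
      (hsh'.intervalIntegrable (μ := volume) 0 1) k
    simp only [fourierCoeffUnit_translate hfp] at h1
    convert! h1 using 1
    funext a
    ring
  have hZ : ∀ w, HasSum (fun a => (cutoffInv ε w : ℂ) * (c a * c (k - a) * (2 * Complex.I *
      (Real.sin (2 * Real.pi * (a * σ + (k - a : ℤ) * ρ) * w) : ℝ))))
      (∫ x in (0 : ℝ)..1, character (-k) x * (oddQuotient u ε σ ρ x w : ℝ)) := fun w => by
    have h1 := ((hprod (σ * w) (ρ * w)).sub (hprod (-(σ * w)) (-(ρ * w)))).mul_left
      (cutoffInv ε w : ℂ)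
    simp only [← mul_sub, character_mul_sub_character_mul] at h1
    convert! h1 using 1
    have hi : ∀ h h' : ℝ, IntervalIntegrable
        (fun x => character (-k) x • (f (x + h) * f (x + h'))) volume 0 1 := fun h h' =>
      Continuous.intervalIntegrable (by have := hfs.continuous; fun_prop) _ _
    rw [fourierCoeffUnit_eq, fourierCoeffUnit_eq, ← intervalIntegral.integral_sub (hi _ _) (hi _ _),
      ← intervalIntegral.integral_const_mul]
    refine intervalIntegral.integral_congr fun x _ => ?_
    simp only [oddQuotient, hf, smul_eq_mul]
    push_cast
    ring
  have hswap : ∫ x in (0 : ℝ)..1, ∫ w in ε..1 / 2,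
      character (-k) x * (oddQuotient u ε σ ρ x w : ℝ) = ∫ w in ε..1 / 2, ∫ x in (0 : ℝ)..1,
      character (-k) x * (oddQuotient u ε σ ρ x w : ℝ) :=
    intervalIntegral_swap_of_continuous (by unfold oddQuotient; fun_prop) _ _ _ _
  have hsc := summable_norm_mul_norm_sub hcs k
  have hsum := intervalIntegral.hasSum_integral_of_dominated_convergence (μ := volume)
    (a := ε) (b := 1 / 2) (fun a _ => ε⁻¹ * (‖c a‖ * ‖c (k - a)‖ * 2))
    (fun a => Continuous.aestronglyMeasurable (by fun_prop))
    (fun a => Eventually.of_forall fun w _ => by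
      rw [norm_mul, norm_mul, norm_mul, norm_mul, norm_mul, Complex.norm_I, Complex.norm_real,
        Complex.norm_real, Real.norm_eq_abs, Real.norm_eq_abs,
        abs_of_pos (show 0 < cutoffInv ε w from inv_pos.2 (hε.trans_le (le_max_right w ε)))]
      have h1 := Real.abs_sin_le_one (2 * Real.pi * (a * σ + (k - a : ℤ) * ρ) * w)
      have h2 : cutoffInv ε w ≤ ε⁻¹ := inv_anti₀ hε (le_max_right w ε)
      have h3 : ‖(2 : ℂ)‖ = 2 := by simp
      rw [h3, mul_one]
      refine mul_le_mul h2 (mul_le_mul_of_nonneg_left ?_ (by positivity)) (by positivity)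
        (by positivity)
      linarith)
    (Eventually.of_forall fun w _ => (hsc.mul_right 2).mul_left _) intervalIntegrable_const
    (Eventually.of_forall fun w _ => hZ w)
  rw [hswap, ← hsum.tsum_eq, ← tsum_mul_left]
  have hterm : ∀ a : ℤ, ‖∫ w in ε..1 / 2, (cutoffInv ε w : ℂ) * (c a * c (k - a) *
      (2 * Complex.I * (Real.sin (2 * Real.pi * (a * σ + (k - a : ℤ) * ρ) * w) : ℝ)))‖ ≤
      6 * (‖c a‖ * ‖c (k - a)‖) := fun a => by
    have h1 : ∫ w in ε..1 / 2, (cutoffInv ε w : ℂ) * (c a * c (k - a) *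
        (2 * Complex.I * (Real.sin (2 * Real.pi * (a * σ + (k - a : ℤ) * ρ) * w) : ℝ))) =
        c a * c (k - a) * (2 * Complex.I) *
          ((∫ w in ε..1 / 2, w⁻¹ * Real.sin (2 * Real.pi * (a * σ + (k - a : ℤ) * ρ) * w) : ℝ) :
            ℂ) := by
      rw [← intervalIntegral.integral_ofReal, ← intervalIntegral.integral_const_mul]
      refine intervalIntegral.integral_congr fun w hw => ?_
      rw [uIcc_of_le hε2] at hw
      simp only [cutoffInv_of_le hw.1]
      push_cast
      ring
    rw [h1, norm_mul, norm_mul, norm_mul, norm_mul, Complex.norm_I, Complex.norm_real,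
      Real.norm_eq_abs]
    have h2 := abs_integral_sin_div_le (2 * Real.pi * (a * σ + (k - a : ℤ) * ρ)) hε hε2
    have h3 : ‖(2 : ℂ)‖ = 2 := by simp
    rw [h3]
    have h4 : 0 ≤ ‖c a‖ * ‖c (k - a)‖ := by positivity
    nlinarith
  exact tsum_of_norm_bounded (hsc.mul_left 6).hasSum hterm

/-- By Fubini the average over s can be taken last, so bounds uniform in s survive it. -/
theorem norm_integral_average_le {F : ℝ → ℝ → ℝ → ℂ}
    (hF : Continuous fun p : ℝ × ℝ × ℝ => F p.1 p.2.1 p.2.2) {a b M : ℝ}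
    (h : ∀ s ∈ Icc (0 : ℝ) 1, ‖∫ x in (0 : ℝ)..1, ∫ w in a..b, F s x w‖ ≤ M) :
    ‖∫ x in (0 : ℝ)..1, ∫ w in a..b, ∫ s in (0 : ℝ)..1, F s x w‖ ≤ M := by
  have h1 : ∀ x, ∫ w in a..b, ∫ s in (0 : ℝ)..1, F s x w = ∫ s in (0 : ℝ)..1, ∫ w in a..b, F s x w :=
    fun x => intervalIntegral_swap_of_continuous (f := fun w s => F s x w)
      (hF.comp (by fun_prop : Continuous fun q : ℝ × ℝ => (q.2, x, q.1))) _ _ _ _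
  have h2 : Continuous (Function.uncurry fun x s => ∫ w in a..b, F s x w) :=
    intervalIntegral.continuous_parametric_intervalIntegral_of_continuous'
      (f := fun (q : ℝ × ℝ) w => F q.2 q.1 w)
      (hF.comp (by fun_prop : Continuous fun q : (ℝ × ℝ) × ℝ => (q.1.2, q.1.1, q.2))) a b
  simp only [h1]
  rw [intervalIntegral_swap_of_continuous h2]
  have h3 := intervalIntegral.norm_integral_le_of_norm_le_const (a := 0) (b := 1) (C := M)
    (f := fun s => ∫ x in (0 : ℝ)..1, ∫ w in a..b, F s x w) fun s hs => by
      rw [uIoc_of_le zero_le_one] at hs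
      exact h s (Ioc_subset_Icc_self hs)
  simpa using h3

variable {n : ℕ} {γ : ℝ → EuclideanSpace ℝ (Fin n)}

theorem velocityQuotient_sq_eq (γ : ℝ → EuclideanSpace ℝ (Fin n)) (i : Fin n) (x t w : ℝ) :
    velocityQuotient γ i (x, t * w) * velocityQuotient γ i (x, t * w) =
      ∫ σ in (0 : ℝ)..1, ∫ ρ in (0 : ℝ)..1,
        acceleration γ i (x + σ * t * w) * acceleration γ i (x + ρ * t * w) := by
  simp only [intervalIntegral.integral_const_mul, intervalIntegral.integral_mul_const,
    velocityQuotient, average, translates, one_mul, mul_assoc]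

theorem inv_mul_average_sub_eq (hγ : ContDiff ℝ ∞ γ) {ε : ℝ} (x : ℝ) {w : ℝ}
    (hw : ε ≤ w) :
    1 / w * (average (fun s => s ^ 2) (velocityQuotientSq γ) (x, w) -
        average (fun s => s ^ 2) (velocityQuotientSq γ) (x, -w)) =
      ∑ i, ∫ t in (0 : ℝ)..1, ∫ σ in (0 : ℝ)..1, ∫ ρ in (0 : ℝ)..1,
        t ^ 2 * oddQuotient (acceleration γ i) ε (σ * t) (ρ * t) x w := by
  have hsq := (contDiff_velocityQuotientSq hγ).continuous
  have hv := fun i => (contDiff_velocityQuotient hγ i).continuous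
  have ha := fun i => (contDiff_acceleration hγ i).continuous
  simp only [average]
  rw [← intervalIntegral.integral_sub (Continuous.intervalIntegrable (by fun_prop) _ _)
    (Continuous.intervalIntegrable (by fun_prop) _ _), ← intervalIntegral.integral_const_mul]
  have h1 : ∀ i, Continuous fun t => ∫ σ in (0 : ℝ)..1, ∫ ρ in (0 : ℝ)..1,
      t ^ 2 * oddQuotient (acceleration γ i) ε (σ * t) (ρ * t) x w := fun i => by
    have := ha i
    unfold oddQuotient
    fun_prop
  rw [← intervalIntegral.integral_finsetSum fun i _ => (h1 i).intervalIntegrable _ _]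
  refine intervalIntegral.integral_congr fun t _ => ?_
  simp only [velocityQuotientSq]
  rw [← mul_sub, ← Finset.sum_sub_distrib, Finset.mul_sum, Finset.mul_sum]
  refine Finset.sum_congr rfl fun i _ => ?_
  have h2 := velocityQuotient_sq_eq γ i x t w
  have h3 := velocityQuotient_sq_eq γ i x t (-w)
  have hai := ha i
  rw [h2, h3, ← intervalIntegral.integral_sub (Continuous.intervalIntegrable (by fun_prop) _ _)
    (Continuous.intervalIntegrable (by fun_prop) _ _), ← mul_assoc,
    ← intervalIntegral.integral_const_mul]
  refine intervalIntegral.integral_congr fun σ _ => ?_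
  rw [← intervalIntegral.integral_sub (Continuous.intervalIntegrable (by fun_prop) _ _)
    (Continuous.intervalIntegrable (by fun_prop) _ _), ← intervalIntegral.integral_const_mul]
  refine intervalIntegral.integral_congr fun ρ _ => ?_
  simp only [oddQuotient, cutoffInv_of_le hw, mul_neg]
  ring

/-- The squared velocity quotients are double averages of products of translates of γ''. For w ≥ ε
the tangential integrand is thus a threefold average of odd quotients, each bounded uniformly. The
constant is 12 = 2 · 6, with 2 the factor in front of Qγ. -/
theorem norm_fourierCoeffUnit_tangential_le (hγ : IsSmoothArclengthKnot γ) (k : ℤ) :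
    ‖fourierCoeffUnit (fun x => ((∑ j, velocity γ j x * Q γ x j : ℝ) : ℂ)) k‖ ≤
      ∑ i, 12 * ∑' a, ‖fourierCoeffUnit (fun x => (acceleration γ i x : ℂ)) a‖ *
        ‖fourierCoeffUnit (fun x => (acceleration γ i x : ℂ)) (k - a)‖ := by
  obtain ⟨m, hm, hmw, -, hmQ⟩ := exists_tangential_integrand hγ
  have hmc := hm.continuous
  have hek := continuous_character (-k)
  set M := ∑ i, 6 * ∑' a, ‖fourierCoeffUnit (fun x => (acceleration γ i x : ℂ)) a‖ *
        ‖fourierCoeffUnit (fun x => (acceleration γ i x : ℂ)) (k - a)‖ with hM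
  set Ψ : ℝ → ℂ := fun ε => ∫ x in (0 : ℝ)..1, ∫ w in ε..1 / 2, character (-k) x * (m (x, w) : ℝ)
    with hΨ
  have hΨc : Continuous Ψ := by
    have h1 : Ψ = fun ε => ∫ x in (0 : ℝ)..1,
        -∫ w in (1 / 2 : ℝ)..ε, character (-k) x * (m (x, w) : ℝ) := by
      funext ε
      simp only [hΨ]
      refine intervalIntegral.integral_congr fun x _ => ?_
      exact intervalIntegral.integral_symm _ _
    have h2 : Continuous fun q : ℝ × ℝ =>
        ∫ w in (1 / 2 : ℝ)..q.1, character (-k) q.2 * (m (q.2, w) : ℝ) :=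
      intervalIntegral.continuous_parametric_intervalIntegral_of_continuous
        (f := fun (q : ℝ × ℝ) w => character (-k) q.2 * (m (q.2, w) : ℝ)) (by fun_prop)
        continuous_fst
    rw [h1]
    exact intervalIntegral.continuous_parametric_intervalIntegral_of_continuous'
      (f := fun ε x => -∫ w in (1 / 2 : ℝ)..ε, character (-k) x * (m (x, w) : ℝ)) h2.neg 0 1
  have hΨM : ∀ ε ∈ Ioc (0 : ℝ) (1 / 2), ‖Ψ ε‖ ≤ M := by
    intro ε hε
    have hinv := continuous_cutoffInv hε.1
    set T : Fin n → ℝ → ℝ → ℂ := fun i x w => ∫ t in (0 : ℝ)..1, ∫ σ in (0 : ℝ)..1,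
      ∫ ρ in (0 : ℝ)..1, character (-k) x *
        ((t ^ 2 * oddQuotient (acceleration γ i) ε (σ * t) (ρ * t) x w : ℝ) : ℂ) with hT
    have hTc : ∀ i, Continuous (Function.uncurry (T i)) := fun i => by
      have := (contDiff_acceleration hγ.smooth i).continuous
      unfold oddQuotient at hT
      simp only [hT, Function.uncurry_def]
      fun_prop
    have h1 : Ψ ε = ∫ x in (0 : ℝ)..1, ∫ w in ε..1 / 2, -∑ i, T i x w := by
      refine intervalIntegral.integral_congr fun x _ => ?_
      refine intervalIntegral.integral_congr fun w hw => ?_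
      rw [uIcc_of_le hε.2] at hw
      have hw0 : w ≠ 0 := (hε.1.trans_le hw.1).ne'
      change character (-k) x * (m (x, w) : ℂ) = _
      rw [hmw x w hw0, neg_mul, inv_mul_average_sub_eq hγ.smooth x hw.1, Complex.ofReal_neg,
        mul_neg, Complex.ofReal_sum, Finset.mul_sum]
      congr 1
      refine Finset.sum_congr rfl fun i _ => ?_
      simp only [hT, intervalIntegral.integral_const_mul, intervalIntegral.integral_ofReal]
    have h2 : ∫ x in (0 : ℝ)..1, ∫ w in ε..1 / 2, -∑ i, T i x w =
        -∑ i, ∫ x in (0 : ℝ)..1, ∫ w in ε..1 / 2, T i x w := by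
      have h3 : ∀ i, Continuous fun x => ∫ w in ε..1 / 2, T i x w := fun i =>
        intervalIntegral.continuous_parametric_intervalIntegral_of_continuous' (hTc i) _ _
      rw [← intervalIntegral.integral_finsetSum fun i _ => (h3 i).intervalIntegrable _ _,
        ← intervalIntegral.integral_neg]
      refine intervalIntegral.integral_congr fun x _ => ?_
      simp only [intervalIntegral.integral_neg]
      congr 1
      exact intervalIntegral.integral_finsetSum fun i _ =>
        ((hTc i).comp (by fun_prop : Continuous fun w : ℝ => (x, w))).intervalIntegrable _ _
    rw [h1, h2, norm_neg]
    refine (norm_sum_le _ _).trans (Finset.sum_le_sum fun i _ => ?_)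
    have hai := (contDiff_acceleration hγ.smooth i).continuous
    refine norm_integral_average_le (by unfold oddQuotient; fun_prop) fun t ht => ?_
    refine norm_integral_average_le (by unfold oddQuotient; fun_prop) fun σ _ => ?_
    refine norm_integral_average_le (by unfold oddQuotient; fun_prop) fun ρ _ => ?_
    have h4 := norm_integral_oddQuotient_le (contDiff_acceleration hγ.smooth i)
      (periodic_acceleration hγ i) hε.1 hε.2 (σ * t) (ρ * t) k
    have h5 : ∫ x in (0 : ℝ)..1, ∫ w in ε..1 / 2, character (-k) x *
        ((t ^ 2 * oddQuotient (acceleration γ i) ε (σ * t) (ρ * t) x w : ℝ) : ℂ) =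
        ((t ^ 2 : ℝ) : ℂ) * ∫ x in (0 : ℝ)..1, ∫ w in ε..1 / 2, character (-k) x *
          (oddQuotient (acceleration γ i) ε (σ * t) (ρ * t) x w : ℝ) := by
      simp only [← intervalIntegral.integral_const_mul]
      refine intervalIntegral.integral_congr fun x _ => ?_
      refine intervalIntegral.integral_congr fun w _ => ?_
      push_cast
      ring
    rw [h5, norm_mul, Complex.norm_real, Real.norm_eq_abs, abs_pow]
    exact (mul_le_of_le_one_left (norm_nonneg _)
      (pow_le_one₀ (abs_nonneg t) (abs_le_one_of_mem_Icc ht))).trans h4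
  -- The bound M does not depend on ε, and Ψ is continuous at 0 because m is smooth there.
  have h0 : ‖Ψ 0‖ ≤ M := by
    refine le_of_tendsto ((hΨc.norm.tendsto 0).mono_left nhdsWithin_le_nhds)
      (Filter.mem_of_superset (Ioc_mem_nhdsGT (show (0 : ℝ) < 1 / 2 by norm_num)) hΨM)
  have hb : fourierCoeffUnit (fun x => ((∑ j, velocity γ j x * Q γ x j : ℝ) : ℂ)) k = 2 * Ψ 0 := by
    rw [fourierCoeffUnit_eq, hΨ, ← intervalIntegral.integral_const_mul]
    refine intervalIntegral.integral_congr fun x _ => ?_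
    simp only [hmQ, smul_eq_mul, intervalIntegral.integral_const_mul,
      intervalIntegral.integral_ofReal]
    push_cast
    ring
  rw [hb, norm_mul]
  have h6 : ∑ i, 12 * ∑' a, ‖fourierCoeffUnit (fun x => (acceleration γ i x : ℂ)) a‖ *
        ‖fourierCoeffUnit (fun x => (acceleration γ i x : ℂ)) (k - a)‖ = 2 * M := by
    rw [hM, Finset.mul_sum]
    exact Finset.sum_congr rfl fun i _ => by ring
  rw [h6]
  simpa using h0

end Tangential

/-! ## The triangle inequality for the weighted norm -/

section WeightedNorm

theorem weightedSq_add_le {A B : ℤ → ENNReal} {M N : ℝ} (hM : 0 ≤ M) (hN : 0 ≤ N)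
    (hA : weightedSq A ≤ ENNReal.ofReal (M ^ 2)) (hB : weightedSq B ≤ ENNReal.ofReal (N ^ 2)) :
    weightedSq (fun k => A k + B k) ≤ ENNReal.ofReal ((M + N) ^ 2) := by
  have hsq : ∀ k, (weight k ^ (1 / 2 : ℝ)) ^ 2 = weight k := fun k => by
    rw [← ENNReal.rpow_natCast, ← ENNReal.rpow_mul]
    norm_num
  have hAB : ∑' k, weight k * (A k * B k) ≤ ENNReal.ofReal (M * N) := by
    have h := sq_tsum_mul_le (fun k => weight k ^ (1 / 2 : ℝ) * A k)
      (fun k => weight k ^ (1 / 2 : ℝ) * B k)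
    simp only [mul_pow, hsq] at h
    have h1 : ∀ k, weight k ^ (1 / 2 : ℝ) * A k * (weight k ^ (1 / 2 : ℝ) * B k) =
        weight k * (A k * B k) := fun k => by
      nth_rw 3 [← hsq k]
      ring
    simp only [h1] at h
    refine (ENNReal.pow_le_pow_left_iff two_ne_zero).1 (h.trans ((mul_le_mul' hA hB).trans ?_))
    rw [← ENNReal.ofReal_pow (by positivity), ← ENNReal.ofReal_mul (by positivity), mul_pow]
  calc weightedSq (fun k => A k + B k)
      = weightedSq A + 2 * ∑' k, weight k * (A k * B k) + weightedSq B := by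
        rw [weightedSq, weightedSq, weightedSq, ← ENNReal.tsum_mul_left, ← ENNReal.tsum_add,
          ← ENNReal.tsum_add]
        exact tsum_congr fun k => by ring
    _ ≤ ENNReal.ofReal (M ^ 2) + 2 * ENNReal.ofReal (M * N) + ENNReal.ofReal (N ^ 2) := by gcongr
    _ = ENNReal.ofReal ((M + N) ^ 2) := by
        rw [show (2 : ENNReal) = ENNReal.ofReal 2 by simp, ← ENNReal.ofReal_mul zero_le_two,
          ← ENNReal.ofReal_add (by positivity) (by positivity),
          ← ENNReal.ofReal_add (by positivity) (by positivity)]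
        congr 1
        ring

theorem weightedSq_sum_le {ι : Type*} (s : Finset ι) {A : ι → ℤ → ENNReal} {M : ι → ℝ}
    (hM : ∀ j, 0 ≤ M j) (hA : ∀ j, weightedSq (A j) ≤ ENNReal.ofReal (M j ^ 2)) :
    weightedSq (fun k => ∑ j ∈ s, A j k) ≤ ENNReal.ofReal ((∑ j ∈ s, M j) ^ 2) := by
  classical
  induction s using Finset.induction_on with
  | empty => simp [weightedSq]
  | insert j s hj ih =>
    simp only [Finset.sum_insert hj]
    exact weightedSq_add_le (hM j) (Finset.sum_nonneg fun j _ => hM j) (hA j) ih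

theorem weightedSq_const_mul_le {A : ℤ → ENNReal} {c M : ℝ} (hc : 0 ≤ c)
    (hA : weightedSq A ≤ ENNReal.ofReal (M ^ 2)) :
    weightedSq (fun k => ENNReal.ofReal c * A k) ≤ ENNReal.ofReal ((c * M) ^ 2) := by
  have h : weightedSq (fun k => ENNReal.ofReal c * A k) =
      ENNReal.ofReal c ^ 2 * weightedSq A := by
    rw [weightedSq, weightedSq, ← ENNReal.tsum_mul_left]
    exact tsum_congr fun k => by ring
  rw [h, mul_pow, ENNReal.ofReal_mul (by positivity), ← ENNReal.ofReal_pow hc]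
  gcongr

theorem enorm_fourierCoeffUnit_iteratedDeriv {f : ℝ → ℂ} (hf : ContDiff ℝ ∞ f)
    (hp : Function.Periodic f 1) (l : ℕ) (k : ℤ) :
    ‖fourierCoeffUnit (iteratedDeriv l f) k‖ₑ =
      ‖(2 * Real.pi * Complex.I * k : ℂ)‖ₑ ^ l * ‖fourierCoeffUnit f k‖ₑ := by
  induction l with
  | zero => simp
  | succ l ih =>
    have h : ContDiff ℝ ∞ (iteratedDeriv l f) := by
      rw [iteratedDeriv_eq_iterate]
      exact hf.iterate_deriv l
    rw [iteratedDeriv_succ, fourierCoeffUnit_deriv h (periodic_iteratedDeriv hp l), enorm_mul, ih,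
      pow_succ']
    ring

/-- If the Fourier coefficients of `b` are dominated by those of squares, then the derivatives of
`b` satisfy the same estimates as the derivatives of squares. -/
theorem scalarNormH1_iteratedDeriv_le_of_convolution {ι : Type*} [Fintype ι] {b : ℝ → ℝ}
    {f : ι → ℝ → ℝ} (hb : ContDiff ℝ ∞ b) (hbp : Function.Periodic b 1)
    (hf : ∀ i, ContDiff ℝ ∞ (f i)) (hfp : ∀ i, Function.Periodic (f i) 1) {c : ℝ} (hc : 0 ≤ c)
    (h : ∀ k, ‖fourierCoeffUnit (fun x => (b x : ℂ)) k‖ ≤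
      ∑ i, c * ∑' a, ‖fourierCoeffUnit (fun x => (f i x : ℂ)) a‖ *
        ‖fourierCoeffUnit (fun x => (f i x : ℂ)) (k - a)‖) (l : ℕ) :
    scalarNormH1 (iteratedDeriv l b) ≤ ∑ i, ∑ j ∈ Finset.range (l + 1), c * l.choose j *
      (Real.sqrt convolutionConstant * scalarNormH1 (iteratedDeriv j (f i)) *
        scalarNormH1 (iteratedDeriv (l - j) (f i))) := by
  set F : ι → ℝ → ℂ := fun i x => (f i x : ℂ) with hF
  have hFs : ∀ i, ContDiff ℝ ∞ (F i) := fun i => contDiff_ofReal (hf i)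
  have hFp : ∀ i, Function.Periodic (F i) 1 := fun i => periodic_ofReal (hfp i)
  -- The symbol of d/dx has a subadditive modulus. The binomial expansion of (e a + e (k - a))^l
  -- then distributes the l derivatives over the two factors, as Leibniz' rule would for a genuine
  -- product.
  set e : ℤ → ENNReal := fun k => ‖(2 * Real.pi * Complex.I * k : ℂ)‖ₑ with he
  have hadd : ∀ k a, e k ≤ e a + e (k - a) := fun k a => by
    have h1 : (2 * Real.pi * Complex.I * k : ℂ) = 2 * Real.pi * Complex.I * a +
        2 * Real.pi * Complex.I * (k - a : ℤ) := by
      push_cast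
      ring
    simp only [he]
    rw [h1]
    exact enorm_add_le _ _
  have hnn : ∀ i j, 0 ≤ Real.sqrt convolutionConstant * scalarNormH1 (iteratedDeriv j (f i)) *
      scalarNormH1 (iteratedDeriv (l - j) (f i)) := fun i j => by
    have := scalarNormH1_nonneg (iteratedDeriv j (f i))
    have := scalarNormH1_nonneg (iteratedDeriv (l - j) (f i))
    positivity
  have hnn' : ∀ i (j : ℕ), 0 ≤ c * l.choose j * (Real.sqrt convolutionConstant *
      scalarNormH1 (iteratedDeriv j (f i)) * scalarNormH1 (iteratedDeriv (l - j) (f i))) :=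
    fun i j => mul_nonneg (by positivity) (hnn i j)
  set A : ι → ℕ → ℤ → ENNReal := fun i j k => ∑' a,
    ‖fourierCoeffUnit (iteratedDeriv j (F i)) a‖ₑ *
      ‖fourierCoeffUnit (iteratedDeriv (l - j) (F i)) (k - a)‖ₑ with hA
  have hsob : ∀ i j, Summable fun k : ℤ =>
      (1 + (k : ℝ) ^ 2) ^ (1 : ℝ) * ‖fourierCoeffUnit (iteratedDeriv j (F i)) k‖ ^ 2 := fun i j => by
    rw [iteratedDeriv_ofReal (hf i)]
    exact (memSobolev_of_contDiff (contDiff_ofReal (contDiff_iteratedDeriv (hf i) j))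
      (periodic_ofReal (periodic_iteratedDeriv (hfp i) j))).summable
  have hAle : ∀ i j, weightedSq (A i j) ≤ ENNReal.ofReal ((Real.sqrt convolutionConstant *
      scalarNormH1 (iteratedDeriv j (f i)) * scalarNormH1 (iteratedDeriv (l - j) (f i))) ^ 2) :=
    fun i j => by
      have h1 := weightedSq_convolution_le_sobolevNorm (hsob i j) (hsob i (l - j))
      simpa only [hA, scalarNormH1, hF, iteratedDeriv_ofReal (hf i)] using h1
  have hcoeff : ∀ k, ‖fourierCoeffUnit (iteratedDeriv l fun x => (b x : ℂ)) k‖ₑ ≤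
      ∑ i, ∑ j ∈ Finset.range (l + 1), ENNReal.ofReal (c * l.choose j) * A i j k := fun k => by
    rw [enorm_fourierCoeffUnit_iteratedDeriv (contDiff_ofReal hb) (periodic_ofReal hbp)]
    have h1 : ‖fourierCoeffUnit (fun x => (b x : ℂ)) k‖ₑ ≤ ∑ i, ENNReal.ofReal c *
        ∑' a, ‖fourierCoeffUnit (F i) a‖ₑ * ‖fourierCoeffUnit (F i) (k - a)‖ₑ := by
      rw [← ofReal_norm]
      refine (ENNReal.ofReal_le_ofReal (h k)).trans (le_of_eq ?_)
      have hpos : ∀ i a, 0 ≤ ‖fourierCoeffUnit (F i) a‖ * ‖fourierCoeffUnit (F i) (k - a)‖ :=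
        fun i a => by positivity
      rw [ENNReal.ofReal_sum_of_nonneg fun i _ => mul_nonneg hc (tsum_nonneg (hpos i))]
      refine Finset.sum_congr rfl fun i _ => ?_
      rw [ENNReal.ofReal_mul hc, ENNReal.ofReal_tsum_of_nonneg (hpos i)
        (summable_norm_mul_norm_sub (memSobolev_of_contDiff (hFs i) (hFp i)).summable_norm k)]
      simp only [ENNReal.ofReal_mul (norm_nonneg _), ofReal_norm]
    refine (mul_le_mul_right h1 _).trans ?_
    rw [Finset.mul_sum]
    refine Finset.sum_le_sum fun i _ => ?_
    rw [mul_left_comm, ← ENNReal.tsum_mul_left]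
    have h2 : ∑ j ∈ Finset.range (l + 1), ENNReal.ofReal (c * l.choose j) * A i j k =
        ENNReal.ofReal c * ∑' a, (∑ j ∈ Finset.range (l + 1), e a ^ j * e (k - a) ^ (l - j) *
          l.choose j) * (‖fourierCoeffUnit (F i) a‖ₑ * ‖fourierCoeffUnit (F i) (k - a)‖ₑ) := by
      simp only [Finset.sum_mul]
      rw [Summable.tsum_finsetSum fun _ _ => ENNReal.summable, Finset.mul_sum]
      refine Finset.sum_congr rfl fun j _ => ?_
      rw [ENNReal.ofReal_mul hc, ENNReal.ofReal_natCast, mul_assoc, hA, ← ENNReal.tsum_mul_left]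
      congr 1
      refine tsum_congr fun a => ?_
      rw [enorm_fourierCoeffUnit_iteratedDeriv (hFs i) (hFp i),
        enorm_fourierCoeffUnit_iteratedDeriv (hFs i) (hFp i)]
      ring
    rw [h2]
    gcongr with a
    rw [← add_pow]
    exact pow_le_pow_left₀ (by simp) (hadd k a) l
  have h0 : 0 ≤ ∑ i, ∑ j ∈ Finset.range (l + 1), c * l.choose j *
      (Real.sqrt convolutionConstant * scalarNormH1 (iteratedDeriv j (f i)) *
        scalarNormH1 (iteratedDeriv (l - j) (f i))) :=
    Finset.sum_nonneg fun i _ => Finset.sum_nonneg fun j _ => hnn' i j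
  refine (sobolevNorm_le_of_weightedSq_le h0 ?_).2
  rw [← iteratedDeriv_ofReal hb]
  exact (weightedSq_mono hcoeff).trans (weightedSq_sum_le _
    (fun i => Finset.sum_nonneg fun j _ => hnn' i j) fun i => weightedSq_sum_le _ (hnn' i)
      fun j => weightedSq_const_mul_le (by positivity) (hAle i j))

end WeightedNorm

/-! ## Binomial convolutions -/

section BinomialConvolution

/-- The binomial convolution of two sequences. -/
def binomialConvolution (x y : ℕ → ℝ) (l : ℕ) : ℝ :=
  ∑ m ∈ Finset.range (l + 1), l.choose m * x m * y (l - m)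

/-- The exponential generating series of a sequence. -/
def exponentialSeries (x : ℕ → ℝ) : PowerSeries ℝ := PowerSeries.mk fun k => x k / k.factorial

theorem exponentialSeries_injective : Function.Injective exponentialSeries := fun x y h => by
  funext k
  have h1 := congrArg (PowerSeries.coeff k) h
  simp only [exponentialSeries, PowerSeries.coeff_mk] at h1
  have h2 : (k.factorial : ℝ) ≠ 0 := Nat.cast_ne_zero.2 k.factorial_ne_zero
  rwa [div_left_inj' h2] at h1

theorem exponentialSeries_binomialConvolution (x y : ℕ → ℝ) :
    exponentialSeries (binomialConvolution x y) = exponentialSeries x * exponentialSeries y := by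
  ext l
  rw [PowerSeries.coeff_mul, Finset.Nat.sum_antidiagonal_eq_sum_range_succ_mk]
  simp only [exponentialSeries, PowerSeries.coeff_mk, binomialConvolution]
  rw [Finset.sum_div]
  refine Finset.sum_congr rfl fun m hm => ?_
  have hml : m ≤ l := Nat.lt_succ_iff.1 (Finset.mem_range.1 hm)
  have h1 : (l.choose m : ℝ) * m.factorial * (l - m).factorial = l.factorial := by
    exact_mod_cast Nat.choose_mul_factorial_mul_factorial hml
  have h2 : (l.factorial : ℝ) ≠ 0 := Nat.cast_ne_zero.2 l.factorial_ne_zero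
  have h3 : (m.factorial : ℝ) ≠ 0 := Nat.cast_ne_zero.2 m.factorial_ne_zero
  have h4 : ((l - m).factorial : ℝ) ≠ 0 := Nat.cast_ne_zero.2 (l - m).factorial_ne_zero
  rw [← h1] at h2 ⊢
  have h5 : (l.choose m : ℝ) ≠ 0 := fun h => h2 (by rw [h]; ring)
  field_simp

/-- Exponential generating series turn the convolution into multiplication in a commutative ring.
This reconciles the order of the three factors in the stated sum with the order in which they arise.
-/
theorem binomialConvolution_right_comm (x y z : ℕ → ℝ) :
    binomialConvolution (binomialConvolution x y) z =
      binomialConvolution (binomialConvolution z y) x := by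
  apply exponentialSeries_injective
  simp only [exponentialSeries_binomialConvolution]
  ring

theorem binomialConvolution_mono {x x' y : ℕ → ℝ} (hy : ∀ k, 0 ≤ y k) (h : ∀ k, x k ≤ x' k)
    (l : ℕ) : binomialConvolution x y l ≤ binomialConvolution x' y l :=
  Finset.sum_le_sum fun m _ => mul_le_mul_of_nonneg_right
    (mul_le_mul_of_nonneg_left (h m) (Nat.cast_nonneg _)) (hy _)

theorem binomialConvolution_const_mul_left (c : ℝ) (x y : ℕ → ℝ) (l : ℕ) :
    binomialConvolution (fun k => c * x k) y l = c * binomialConvolution x y l := by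
  rw [binomialConvolution, binomialConvolution, Finset.mul_sum]
  exact Finset.sum_congr rfl fun m _ => by ring

/-- The Leibniz rule for the `H¹` norm. -/
theorem scalarNormH1_iteratedDeriv_mul_le {u v : ℝ → ℝ} (hu : ContDiff ℝ ∞ u)
    (hup : Function.Periodic u 1) (hv : ContDiff ℝ ∞ v) (hvp : Function.Periodic v 1) (l : ℕ) :
    scalarNormH1 (iteratedDeriv l fun x => u x * v x) ≤
      196 * binomialConvolution (fun m => scalarNormH1 (iteratedDeriv m u))
        (fun m => scalarNormH1 (iteratedDeriv m v)) l := by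
  -- The constant 196 is 7 · 7 for passing from H¹ norms to `H1Bound`, times 2 for the product and 2
  -- for the way back.
  have hF : ∀ {w : ℝ → ℝ}, ContDiff ℝ ∞ w → Function.Periodic w 1 → ∀ i : ℕ,
      H1Bound (iteratedDeriv i w)
        (i.factorial * (7 * (scalarNormH1 (iteratedDeriv i w) / i.factorial))) :=
    fun hw hwp i => by
      have h2 : (i.factorial : ℝ) ≠ 0 := Nat.cast_ne_zero.2 i.factorial_ne_zero
      convert! h1Bound_scalarNormH1 (contDiff_iteratedDeriv hw i) (periodic_iteratedDeriv hwp i)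
        using 1
      field_simp
  have h1 := H1Bound.iteratedDeriv_mul hu hv l (fun i _ => hF hu hup i) fun i _ => hF hv hvp i
  have hp : Function.Periodic (fun x => u x * v x) 1 := fun x => by simp only [hup x, hvp x]
  refine (h1.scalarNormH1_le (contDiff_iteratedDeriv (hu.mul hv) l)
    (periodic_iteratedDeriv hp l)).trans (le_of_eq ?_)
  have h3 := congrArg (PowerSeries.coeff l) (exponentialSeries_binomialConvolution
    (fun m => scalarNormH1 (iteratedDeriv m u)) fun m => scalarNormH1 (iteratedDeriv m v))
  rw [PowerSeries.coeff_mul, Finset.Nat.sum_antidiagonal_eq_sum_range_succ_mk] at h3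
  simp only [exponentialSeries, PowerSeries.coeff_mk] at h3
  rw [div_eq_iff (Nat.cast_ne_zero.2 l.factorial_ne_zero)] at h3
  rw [h3, Finset.mul_sum, Finset.sum_mul, Finset.mul_sum, Finset.mul_sum, Finset.mul_sum]
  exact Finset.sum_congr rfl fun m _ => by ring

end BinomialConvolution

/-! ## The estimate of the tangential part -/

section TangentialEstimate

variable {n : ℕ} {γ : ℝ → EuclideanSpace ℝ (Fin n)}

theorem iteratedDeriv_iteratedDeriv {E : Type*} [NormedAddCommGroup E] [NormedSpace ℝ E]
    (f : ℝ → E) (i j : ℕ) : iteratedDeriv i (iteratedDeriv j f) = iteratedDeriv (i + j) f := by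
  simp only [iteratedDeriv_eq_iterate, Function.iterate_add_apply]

theorem contDiff_iteratedDeriv_curve (hγ : ContDiff ℝ ∞ γ) (l : ℕ) :
    ContDiff ℝ ∞ (iteratedDeriv l γ) := by
  rw [iteratedDeriv_eq_iterate]
  exact hγ.iterate_deriv l

theorem scalarNormH1_iteratedDeriv_coord_le (hγ : IsSmoothArclengthKnot γ) (l j : ℕ) (i : Fin n) :
    scalarNormH1 (iteratedDeriv l fun x => iteratedDeriv j γ x i) ≤
      normH1 (iteratedDeriv (l + j) γ) := by
  rw [iteratedDeriv_coord (contDiff_iteratedDeriv_curve hγ.smooth j), iteratedDeriv_iteratedDeriv]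
  exact scalarNormH1_coord_le (contDiff_iteratedDeriv_curve hγ.smooth _)
    (periodic_iteratedDeriv hγ.periodic _) i

theorem contDiff_sum_velocity_mul_Q (hγ : IsSmoothArclengthKnot γ) :
    ContDiff ℝ ∞ fun x => ∑ j, velocity γ j x * Q γ x j := by
  obtain ⟨m, hm, -, -, h⟩ := exists_tangential_integrand hγ
  simp only [h]
  exact contDiff_const.mul (contDiff_intervalIntegral hm 0 (1 / 2))

theorem periodic_sum_velocity_mul_Q (hγ : IsSmoothArclengthKnot γ) :
    Function.Periodic (fun x => ∑ j, velocity γ j x * Q γ x j) 1 := fun x => by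
  simp only [periodic_velocity hγ _ x, periodic_Q hγ x]

theorem scalarNormH1_iteratedDeriv_sum_velocity_mul_Q_le (hγ : IsSmoothArclengthKnot γ) (l : ℕ) :
    scalarNormH1 (iteratedDeriv l fun x => ∑ j, velocity γ j x * Q γ x j) ≤
      n * (12 * Real.sqrt convolutionConstant) *
        binomialConvolution (fun m => normH1 (iteratedDeriv (m + 2) γ))
          (fun m => normH1 (iteratedDeriv (m + 2) γ)) l := by
  refine (scalarNormH1_iteratedDeriv_le_of_convolution (contDiff_sum_velocity_mul_Q hγ)
    (periodic_sum_velocity_mul_Q hγ) (contDiff_acceleration hγ.smooth) (periodic_acceleration hγ)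
    (by norm_num) (norm_fourierCoeffUnit_tangential_le hγ) l).trans ?_
  rw [mul_assoc, ← nsmul_eq_mul]
  refine (Finset.sum_le_card_nsmul _ _ _ fun i _ => ?_).trans_eq (by rw [Finset.card_fin])
  rw [binomialConvolution, Finset.mul_sum]
  refine Finset.sum_le_sum fun j _ => ?_
  have h1 := scalarNormH1_iteratedDeriv_coord_le hγ j 2 i
  have h2 := scalarNormH1_iteratedDeriv_coord_le hγ (l - j) 2 i
  have h3 := mul_le_mul h1 h2 (scalarNormH1_nonneg _) (normH1_nonneg _)
  have h4 : 0 ≤ 12 * (l.choose j : ℝ) * Real.sqrt convolutionConstant := by positivity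
  have h5 := mul_le_mul_of_nonneg_left h3 h4
  change 12 * (l.choose j : ℝ) * (Real.sqrt convolutionConstant *
    scalarNormH1 (iteratedDeriv j fun x => iteratedDeriv 2 γ x i) *
    scalarNormH1 (iteratedDeriv (l - j) fun x => iteratedDeriv 2 γ x i)) ≤ _
  linarith

theorem contDiff_tangentialPart_Q (hγ : IsSmoothArclengthKnot γ) :
    ContDiff ℝ ∞ (tangentialPart γ (Q γ)) := contDiff_euclidean.2 fun i => by
  simp only [tangentialPart_apply]
  exact (contDiff_sum_velocity_mul_Q hγ).mul (contDiff_velocity hγ.smooth i)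

theorem periodic_tangentialPart_Q (hγ : IsSmoothArclengthKnot γ) :
    Function.Periodic (tangentialPart γ (Q γ)) 1 := fun x => by
  ext i
  rw [tangentialPart_apply, tangentialPart_apply, periodic_velocity hγ i x]
  rw [show ∑ j, velocity γ j (x + 1) * Q γ (x + 1) j = _ from periodic_sum_velocity_mul_Q hγ x]

theorem tangentialPart_Q_bound (hγ : IsSmoothArclengthKnot γ) :
    ∃ C : ℝ, 0 < C ∧ ∀ l : ℕ, MemH1 (iteratedDeriv l (tangentialPart γ (Q γ))) ∧
      normH1 (iteratedDeriv l (tangentialPart γ (Q γ))) ≤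
        C * ∑ k₁ ∈ Finset.range (l + 1), ∑ k₂ ∈ Finset.range (k₁ + 1),
          (l.choose k₁ : ℝ) * (k₁.choose k₂ : ℝ) *
            normH1 (iteratedDeriv (l - k₁ + 2) γ) *
            normH1 (iteratedDeriv (k₁ - k₂ + 2) γ) *
            normH1 (iteratedDeriv (k₂ + 1) γ) := by
  set K : ℝ := n * (12 * Real.sqrt convolutionConstant) with hK
  have hK0 : 0 ≤ K := by positivity
  set a : ℕ → ℝ := fun m => normH1 (iteratedDeriv (m + 2) γ) with ha
  set d : ℕ → ℝ := fun m => normH1 (iteratedDeriv (m + 1) γ) with hd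
  have ha0 : ∀ m, 0 ≤ a m := fun m => normH1_nonneg _
  have hd0 : ∀ m, 0 ≤ d m := fun m => normH1_nonneg _
  -- K comes from the scalar ⟨Qγ, γ'⟩, 196 from its product with γ', and n from summing over the
  -- coordinates; the summand 1 ensures positivity.
  refine ⟨n * (196 * K) + 1, by positivity, fun l => ?_⟩
  have hsm := contDiff_tangentialPart_Q hγ
  have hsl : ContDiff ℝ ∞ (iteratedDeriv l (tangentialPart γ (Q γ))) :=
    contDiff_iteratedDeriv_curve hsm l
  have hpl := periodic_iteratedDeriv (periodic_tangentialPart_Q hγ) l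
  refine ⟨memH1_of_contDiff hsl hpl, ?_⟩
  have hrhs : ∑ k₁ ∈ Finset.range (l + 1), ∑ k₂ ∈ Finset.range (k₁ + 1),
      (l.choose k₁ : ℝ) * (k₁.choose k₂ : ℝ) * a (l - k₁) * a (k₁ - k₂) * d k₂ =
      binomialConvolution (binomialConvolution a a) d l := by
    rw [binomialConvolution_right_comm, binomialConvolution]
    refine Finset.sum_congr rfl fun k₁ _ => ?_
    rw [binomialConvolution, Finset.mul_sum, Finset.sum_mul]
    exact Finset.sum_congr rfl fun k₂ _ => by ring
  have hpos : 0 ≤ binomialConvolution (binomialConvolution a a) d l :=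
    Finset.sum_nonneg fun m _ => mul_nonneg (mul_nonneg (Nat.cast_nonneg _)
      (Finset.sum_nonneg fun j _ => mul_nonneg (mul_nonneg (Nat.cast_nonneg _) (ha0 _)) (ha0 _)))
      (hd0 _)
  have hi : ∀ i, scalarNormH1 (fun x => iteratedDeriv l (tangentialPart γ (Q γ)) x i) ≤
      196 * K * binomialConvolution (binomialConvolution a a) d l := fun i => by
    rw [← iteratedDeriv_coord hsm]
    simp only [tangentialPart_apply]
    have hv := contDiff_velocity hγ.smooth i
    refine (scalarNormH1_iteratedDeriv_mul_le (contDiff_sum_velocity_mul_Q hγ)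
      (periodic_sum_velocity_mul_Q hγ) hv (periodic_velocity hγ i) l).trans ?_
    rw [mul_assoc, ← binomialConvolution_const_mul_left K]
    refine mul_le_mul_of_nonneg_left ?_ (by norm_num : (0 : ℝ) ≤ 196)
    refine (binomialConvolution_mono (fun m => scalarNormH1_nonneg _)
      (scalarNormH1_iteratedDeriv_sum_velocity_mul_Q_le hγ) l).trans ?_
    refine Finset.sum_le_sum fun m _ => mul_le_mul_of_nonneg_left ?_ ?_
    · have h1 := scalarNormH1_iteratedDeriv_coord_le hγ (l - m) 1 i
      rw [iteratedDeriv_one] at h1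
      exact h1
    · exact mul_nonneg (Nat.cast_nonneg _) (mul_nonneg hK0
        (Finset.sum_nonneg fun j _ => mul_nonneg (mul_nonneg (Nat.cast_nonneg _) (ha0 _)) (ha0 _)))
  change _ ≤ _ * ∑ k₁ ∈ Finset.range (l + 1), ∑ k₂ ∈ Finset.range (k₁ + 1),
      (l.choose k₁ : ℝ) * (k₁.choose k₂ : ℝ) * a (l - k₁) * a (k₁ - k₂) * d k₂
  rw [hrhs]
  refine (normH1_le_sum hsl hpl).trans ?_
  refine (Finset.sum_le_card_nsmul _ _ _ fun i _ => hi i).trans ?_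
  rw [Finset.card_fin, nsmul_eq_mul]
  linarith

end TangentialEstimate

end MobiusEnergy

end

/-! ### The theorem -/

theorem mainTheorem4 (n : ℕ) (γ : ℝ → EuclideanSpace ℝ (Fin n))
    (hγ : IsSmoothArclengthKnot γ) (hcrit : IsCriticalPoint γ) :
    -- the limits that define the three parts exist, and the parts in question are smooth
    (∀ x, Tendsto (fun ε => Qtrunc γ ε x) (𝓝[>] 0) (𝓝 (Q γ x)) ∧
      Tendsto (fun ε => R₁trunc γ ε x) (𝓝[>] 0) (𝓝 (R₁ γ x)) ∧
      Tendsto (fun ε => R₂trunc γ ε x) (𝓝[>] 0) (𝓝 (R₂ γ x))) ∧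
    ContDiff ℝ ∞ (tangentialPart γ (Q γ)) ∧
    ContDiff ℝ ∞ (normalPart γ (R₁ γ)) ∧
    ContDiff ℝ ∞ (normalPart γ (R₂ γ)) ∧
    -- the Banach algebra inequality holds with some constant, and any such constant will do
    (∃ C₁, IsAlgebraConstantH1 C₁) ∧
    ∀ C₁, IsAlgebraConstantH1 C₁ →
      ∃ C_Q C_R₁ C_R₂ r s : ℝ, 0 < C_Q ∧ 0 < C_R₁ ∧ 0 < C_R₂ ∧ 0 < r ∧ 0 < s ∧
        ∀ l : ℕ, 1 ≤ l →
          (MemH1 (iteratedDeriv l (tangentialPart γ (Q γ))) ∧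
            normH1 (iteratedDeriv l (tangentialPart γ (Q γ))) ≤
              C_Q * ∑ k₁ ∈ Finset.range (l + 1), ∑ k₂ ∈ Finset.range (k₁ + 1),
                (l.choose k₁ : ℝ) * (k₁.choose k₂ : ℝ) *
                  normH1 (iteratedDeriv (l - k₁ + 2) γ) *
                  normH1 (iteratedDeriv (k₁ - k₂ + 2) γ) *
                  normH1 (iteratedDeriv (k₂ + 1) γ)) ∧
          (MemH1 (iteratedDeriv l (normalPart γ (R₁ γ))) ∧
            normH1 (iteratedDeriv l (normalPart γ (R₁ γ))) ≤
              C_R₁ * faaDiBrunoBound γ C₁ r l) ∧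
          (MemH1 (iteratedDeriv l (normalPart γ (R₂ γ))) ∧
            normH1 (iteratedDeriv l (normalPart γ (R₂ γ))) ≤
              C_R₂ * faaDiBrunoBound γ C₁ s l) := by
  obtain ⟨m, -, -, hQ, -⟩ := exists_tangential_integrand hγ
  obtain ⟨V₁, hV₁, hlim₁⟩ := exists_R₁_goodFamily hγ
  obtain ⟨V₂, hV₂, hlim₂⟩ := exists_R₂_goodFamily hγ
  -- The remainders are defined as `limUnder`, whose value is known only once convergence has been
  -- established.
  have hR₁ : ∀ x, R₁ γ x = WithLp.toLp 2 fun i => V₁ i (x, 0) := fun x => (hlim₁ x).limUnder_eq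
  have hR₂ : ∀ x, R₂ γ x = WithLp.toLp 2 fun i => V₂ i (x, 0) := fun x => (hlim₂ x).limUnder_eq
  obtain ⟨hs₁, hb₁⟩ := normalPart_bound hγ hV₁ hR₁
  obtain ⟨hs₂, hb₂⟩ := normalPart_bound hγ hV₂ hR₂
  refine ⟨fun x => ⟨hQ x, ?_, ?_⟩, contDiff_tangentialPart_Q hγ, hs₁, hs₂,
    exists_isAlgebraConstantH1, fun C₁ hC₁ => ?_⟩
  · rw [hR₁]
    exact hlim₁ x
  · rw [hR₂]
    exact hlim₂ x
  · obtain ⟨C, hC, hbC⟩ := tangentialPart_Q_bound hγ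
    obtain ⟨D₁, r, hD₁, hr, h₁⟩ := hb₁ C₁ hC₁.1
    obtain ⟨D₂, s, hD₂, hs, h₂⟩ := hb₂ C₁ hC₁.1
    exact ⟨C, D₁, D₂, r, s, hC, hD₁, hD₂, hr, hs, fun l _ => ⟨hbC l, h₁ l, h₂ l⟩⟩
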